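/- Let $M_N$ denote the space of $N\times N$ complex matrices with the operator norm on $\ell_2^N$. For operator spaces $E,F$ and a linear map $u:E\to F$ let $u_N=\mathrm{Id}\otimes u: M_N(E)\to M_N(F)$, and let $$d_N(E,F)=\inf\{\|u_N\|\,\|(u^{-1})_N\| \ :\ u:E\to F \text{ a linear isomorphism}\}$$ (with $d_N(E,F)=\infty$ if $E$ and $F$ are not isomorphic). For a finite-dimensional operator space $E$ and $C>0$ let $k_E(N,C)$ be the least integer $k$ such that the direct sum $M_N\oplus\cdots\oplus M_N$ of $k$ copies of $M_N$ (with the maximum norm) contains a linear subspace $F$ with $d_N(E,F)\le C$ (and $k_E(N,C)=\infty$ if there is no such $k$). Consider the following $n$-dimensional operator spaces. (a) $OH_n$: the space $\ell_2^n$ with orthonormal basis $(e_j)$ and $\|\sum_j x_j\otimes e_j\|_{M_m(OH_n)}=\|\sum_j x_j\otimes\overline{x_j}\|^{1/2}$ for all $m\ge 1$ and $x_1,\dots,x_n\in M_m$. (b) $\max(\ell_1^n)$: the space $\ell_1^n$ with its maximal operator space structure. (c) $R_n+C_n$: the quotient of the operator space direct sum $R_n\oplus_1 C_n$ of the row space $R_n=M_{1,n}$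 and the column space $C_n=M_{n,1}$ by the map $(a,b)\mapsto a+b$, where $R_n$ and $C_n$ are both identified with $\mathbb C^n$ in the canonical way. Theorem. There are numbers $C_1>1$, $b>0$ and an integer $n_0>1$ such that for all $n\ge n_0$, all $N\ge 1$ and each of the three spaces $E=OH_n$, $E=\max(\ell_1^n)$, $E=R_n+C_n$ we have $$k_E(N,C_1)\ \ge\ \exp(b\,nN^2).$$ -/

import Mathlib

noncomputable section

namespace MatricialMultiplicity

open scoped Matrix.Norms.L2Operator Kronecker

section NormLemmas

variable {p q r s : Type*} [Fintype p] [Fintype q] [Fintype r] [Fintype s]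
  [DecidableEq q] [DecidableEq s]

theorem sum_norm_mulVec_sq_le (A : Matrix p q ℂ) (v : q → ℂ) :
    ∑ i, ‖(A.mulVec v) i‖ ^ 2 ≤ ‖A‖ ^ 2 * ∑ j, ‖v j‖ ^ 2 := by
  have h := A.l2_opNorm_mulVec (WithLp.toLp 2 v)
  have h2 := pow_le_pow_left₀ (norm_nonneg _) h 2
  rw [mul_pow, EuclideanSpace.norm_sq_eq, EuclideanSpace.norm_sq_eq] at h2
  simpa using h2

theorem opNorm_le_of_sq {A : Matrix p q ℂ} {c : ℝ} (hc : 0 ≤ c)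
    (h : ∀ v : q → ℂ, ∑ i, ‖(A.mulVec v) i‖ ^ 2 ≤ c ^ 2 * ∑ j, ‖v j‖ ^ 2) : ‖A‖ ≤ c := by
  rw [Matrix.l2_opNorm_def]
  refine ContinuousLinearMap.opNorm_le_bound _ hc fun v => ?_
  refine (sq_le_sq₀ (norm_nonneg _) (by positivity)).mp ?_
  rw [mul_pow, EuclideanSpace.norm_sq_eq, EuclideanSpace.norm_sq_eq]
  simpa using h v.ofLp

theorem norm_submatrix_equiv_le (A : Matrix p q ℂ) (e : r ≃ p) (f : s ≃ q) :
    ‖A.submatrix e f‖ ≤ ‖A‖ := by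
  refine opNorm_le_of_sq (norm_nonneg _) fun v => ?_
  have h := sum_norm_mulVec_sq_le A (v ∘ f.symm)
  rw [← e.sum_comp, ← f.sum_comp (fun j => ‖(v ∘ f.symm) j‖ ^ 2)] at h
  simpa [Matrix.submatrix_mulVec_equiv] using h

theorem norm_fromBlocks_diag_le (A : Matrix p q ℂ) (D : Matrix r s ℂ) :
    ‖Matrix.fromBlocks A 0 0 D‖ ≤ max ‖A‖ ‖D‖ := by
  have h0 : 0 ≤ max ‖A‖ ‖D‖ := le_max_of_le_left (norm_nonneg _)
  refine opNorm_le_of_sq h0 fun v => ?_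
  have hA := sum_norm_mulVec_sq_le A (v ∘ Sum.inl)
  have hD := sum_norm_mulVec_sq_le D (v ∘ Sum.inr)
  rw [Matrix.fromBlocks_mulVec, Fintype.sum_sum_type, Fintype.sum_sum_type, mul_add]
  have hA2 : ‖A‖ ^ 2 ≤ (max ‖A‖ ‖D‖) ^ 2 := by gcongr; exact le_max_left _ _
  have hD2 : ‖D‖ ^ 2 ≤ (max ‖A‖ ‖D‖) ^ 2 := by gcongr; exact le_max_right _ _
  have hA3 := hA.trans (mul_le_mul_of_nonneg_right hA2
    (Finset.sum_nonneg fun j _ => sq_nonneg ‖(v ∘ Sum.inl) j‖))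
  have hD3 := hD.trans (mul_le_mul_of_nonneg_right hD2
    (Finset.sum_nonneg fun j _ => sq_nonneg ‖(v ∘ Sum.inr) j‖))
  simpa using add_le_add hA3 hD3

theorem norm_kronecker_one_le (A : Matrix p q ℂ) :
    ‖A ⊗ₖ (1 : Matrix s s ℂ)‖ ≤ ‖A‖ := by
  refine opNorm_le_of_sq (norm_nonneg _) fun v => ?_
  have h : ∀ i t, ((A ⊗ₖ (1 : Matrix s s ℂ)).mulVec v) (i, t) =
      (A.mulVec fun j => v (j, t)) i := by
    intro i t
    simp [Matrix.mulVec, dotProduct, Fintype.sum_prod_type, Matrix.one_apply]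
  rw [Fintype.sum_prod_type_right, Fintype.sum_prod_type_right, Finset.mul_sum]
  refine Finset.sum_le_sum fun t _ => ?_
  simp only [h]
  exact sum_norm_mulVec_sq_le A fun j => v (j, t)

end NormLemmas

/-- The product `α x β`, with entries `∑ α i a • x a b • β b j`, of a matrix `x` over `E` with
scalar matrices. -/
def scalarMul {E : Type*} [AddCommGroup E] [Module ℂ E] {k m : ℕ}
    (α : Matrix (Fin k) (Fin m) ℂ) (x : Matrix (Fin m) (Fin m) E)
    (β : Matrix (Fin m) (Fin k) ℂ) : Matrix (Fin k) (Fin k) E :=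
  Matrix.of fun i j => ∑ a, ∑ b, (α i a * β b j) • x a b

/-- The block diagonal matrix `x ⊕ y`. -/
def blockSum {E : Type*} [Zero E] {m k : ℕ} (x : Matrix (Fin m) (Fin m) E)
    (y : Matrix (Fin k) (Fin k) E) : Matrix (Fin (m + k)) (Fin (m + k)) E :=
  Matrix.reindex finSumFinEquiv finSumFinEquiv (Matrix.fromBlocks x 0 0 y)

/-- A sequence of seminorms on the spaces `M_m(E)` that satisfies Ruan's axioms. (The inequality
opposite to `blockSum_le` follows from `scalarMul_le`.) -/
structure MatrixSeminorm (E : Type*) [AddCommGroup E] [Module ℂ E] where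
  norm : (m : ℕ) → Matrix (Fin m) (Fin m) E → ℝ
  add_le : ∀ (m : ℕ) (x y : Matrix (Fin m) (Fin m) E), norm m (x + y) ≤ norm m x + norm m y
  smul_eq : ∀ (m : ℕ) (c : ℂ) (x : Matrix (Fin m) (Fin m) E), norm m (c • x) = ‖c‖ * norm m x
  blockSum_le : ∀ (m k : ℕ) (x : Matrix (Fin m) (Fin m) E) (y : Matrix (Fin k) (Fin k) E),
    norm (m + k) (blockSum x y) ≤ max (norm m x) (norm k y)
  scalarMul_le : ∀ (k m : ℕ) (α : Matrix (Fin k) (Fin m) ℂ) (x : Matrix (Fin m) (Fin m) E)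
    (β : Matrix (Fin m) (Fin k) ℂ), norm k (scalarMul α x β) ≤ ‖α‖ * norm m x * ‖β‖

/-- An operator space structure on a complex vector space `E`: norms on all the spaces `M_m(E)`
that satisfy Ruan's axioms. By Ruan's theorem these are the matrix norms that come from linear
embeddings of `E` into some `B(H)`. -/
structure OperatorSpace (E : Type*) [AddCommGroup E] [Module ℂ E] extends MatrixSeminorm E where
  eq_zero_of_norm : ∀ (m : ℕ) (x : Matrix (Fin m) (Fin m) E), norm m x = 0 → x = 0

section Constructions

variable {E F : Type*} [AddCommGroup E] [Module ℂ E] [AddCommGroup F] [Module ℂ F]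

theorem MatrixSeminorm.norm_zero (S : MatrixSeminorm E) (m : ℕ) : S.norm m 0 = 0 := by
  simpa using S.smul_eq m 0 0

theorem MatrixSeminorm.norm_nonneg (S : MatrixSeminorm E) (m : ℕ)
    (x : Matrix (Fin m) (Fin m) E) : 0 ≤ S.norm m x := by
  have h := S.add_le m x ((-1 : ℂ) • x)
  have h0 : x + (-1 : ℂ) • x = 0 := by simp
  rw [S.smul_eq, h0, S.norm_zero] at h
  simp at h
  linarith

/-- The map `u_m = Id ⊗ u : M_m(E) → M_m(F)`. -/
def amplify (u : E →ₗ[ℂ] F) (m : ℕ) (x : Matrix (Fin m) (Fin m) E) : Matrix (Fin m) (Fin m) F :=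
  x.map u

theorem amplify_add (u : E →ₗ[ℂ] F) (m : ℕ) (x y : Matrix (Fin m) (Fin m) E) :
    amplify u m (x + y) = amplify u m x + amplify u m y := by
  ext; simp [amplify]

theorem amplify_smul (u : E →ₗ[ℂ] F) (m : ℕ) (c : ℂ) (x : Matrix (Fin m) (Fin m) E) :
    amplify u m (c • x) = c • amplify u m x := by
  ext; simp [amplify]

theorem amplify_blockSum (u : E →ₗ[ℂ] F) (m k : ℕ) (x : Matrix (Fin m) (Fin m) E)
    (y : Matrix (Fin k) (Fin k) E) :
    amplify u (m + k) (blockSum x y) = blockSum (amplify u m x) (amplify u k y) := by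
  ext i j
  obtain ⟨i, rfl⟩ := finSumFinEquiv.surjective i
  obtain ⟨j, rfl⟩ := finSumFinEquiv.surjective j
  rcases i with i | i <;> rcases j with j | j <;> simp [amplify, blockSum]

theorem amplify_scalarMul (u : E →ₗ[ℂ] F) (k m : ℕ) (α : Matrix (Fin k) (Fin m) ℂ)
    (x : Matrix (Fin m) (Fin m) E) (β : Matrix (Fin m) (Fin k) ℂ) :
    amplify u k (scalarMul α x β) = scalarMul α (amplify u m x) β := by
  ext i j; simp [amplify, scalarMul]

/-- The matrix seminorms on `E` induced by a linear map from `E` to `F`. -/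
def MatrixSeminorm.pullback (S : MatrixSeminorm F) (u : E →ₗ[ℂ] F) : MatrixSeminorm E where
  norm m x := S.norm m (amplify u m x)
  add_le m x y := by rw [amplify_add]; exact S.add_le _ _ _
  smul_eq m c x := by rw [amplify_smul]; exact S.smul_eq _ _ _
  blockSum_le m k x y := by rw [amplify_blockSum]; exact S.blockSum_le _ _ _ _
  scalarMul_le k m α x β := by rw [amplify_scalarMul]; exact S.scalarMul_le _ _ _ _ _

/-- The operator space structure on `E` induced by an injective linear map from `E` to `F`. -/
def OperatorSpace.pullback (S : OperatorSpace F) (u : E →ₗ[ℂ] F) (hu : Function.Injective u) :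
    OperatorSpace E where
  toMatrixSeminorm := S.toMatrixSeminorm.pullback u
  eq_zero_of_norm m x hx := by
    have h := S.eq_zero_of_norm m _ hx
    ext i j
    have hij := congrFun (congrFun h i) j
    simp only [amplify, Matrix.map_apply, Matrix.zero_apply] at hij
    exact (map_eq_zero_iff u hu).mp hij

/-- The operator space structure of a linear subspace. -/
def OperatorSpace.restrict (S : OperatorSpace E) (V : Submodule ℂ E) : OperatorSpace V :=
  S.pullback V.subtype V.injective_subtype

/-- The supremum of a pointwise bounded family of matrix seminorms. -/
def MatrixSeminorm.sup {ι : Type*} (S : ι → MatrixSeminorm E)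
    (hS : ∀ m x, BddAbove (Set.range fun i => (S i).norm m x)) : MatrixSeminorm E where
  norm m x := ⨆ i, (S i).norm m x
  add_le m x y := by
    refine Real.iSup_le (fun i => ((S i).add_le m x y).trans
      (add_le_add (le_ciSup (hS m x) i) (le_ciSup (hS m y) i))) ?_
    exact add_nonneg (Real.iSup_nonneg fun i => (S i).norm_nonneg m x)
      (Real.iSup_nonneg fun i => (S i).norm_nonneg m y)
  smul_eq m c x := by
    rw [Real.mul_iSup_of_nonneg (_root_.norm_nonneg c)]
    exact iSup_congr fun i => (S i).smul_eq m c x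
  blockSum_le m k x y := by
    refine Real.iSup_le (fun i => ((S i).blockSum_le m k x y).trans
      (max_le_max (le_ciSup (hS m x) i) (le_ciSup (hS k y) i))) ?_
    exact le_max_of_le_left (Real.iSup_nonneg fun i => (S i).norm_nonneg m x)
  scalarMul_le k m α x β := by
    refine Real.iSup_le (fun i => ((S i).scalarMul_le k m α x β).trans ?_) ?_
    · have := le_ciSup (hS m x) i
      gcongr
    · have : 0 ≤ ⨆ i, (S i).norm m x := Real.iSup_nonneg fun i => (S i).norm_nonneg m x
      positivity

theorem MatrixSeminorm.le_sup {ι : Type*} (S : ι → MatrixSeminorm E)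
    (hS : ∀ m x, BddAbove (Set.range fun i => (S i).norm m x)) (i : ι) (m : ℕ)
    (x : Matrix (Fin m) (Fin m) E) : (S i).norm m x ≤ (MatrixSeminorm.sup S hS).norm m x :=
  le_ciSup (hS m x) i

/-- The quotient matrix seminorms on `F` given by a surjective linear map from `E` onto `F`:
`‖y‖` is the infimum of the norms of the liftings of `y`. -/
def MatrixSeminorm.quotient (S : MatrixSeminorm E) (u : E →ₗ[ℂ] F)
    (hu : Function.Surjective u) : MatrixSeminorm F :=
  have hne : ∀ m (y : Matrix (Fin m) (Fin m) F), Nonempty {x // amplify u m x = y} := by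
    intro m y
    choose g hg using hu
    exact ⟨y.map g, by ext; simp [amplify, hg]⟩
  have hbdd : ∀ m (y : Matrix (Fin m) (Fin m) F),
      BddBelow (Set.range fun x : {x // amplify u m x = y} => S.norm m x) := by
    intro m y
    exact ⟨0, by rintro _ ⟨x, rfl⟩; exact S.norm_nonneg m x⟩
  have hapx : ∀ m (y : Matrix (Fin m) (Fin m) F) (ε : ℝ), 0 < ε → ∃ x, amplify u m x = y ∧
      S.norm m x < (⨅ x : {x // amplify u m x = y}, S.norm m x) + ε := by
    intro m y ε hε
    have := hne m y
    obtain ⟨x, hx⟩ := exists_lt_of_ciInf_lt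
      (lt_add_of_pos_right (⨅ x : {x // amplify u m x = y}, S.norm m x) hε)
    exact ⟨x, x.2, hx⟩
  have hle : ∀ m (y : Matrix (Fin m) (Fin m) F) x, amplify u m x = y →
      (⨅ x : {x // amplify u m x = y}, S.norm m x) ≤ S.norm m x := by
    intro m y x hx
    exact ciInf_le (hbdd m y) ⟨x, hx⟩
  have hsmul : ∀ m (c : ℂ) (y : Matrix (Fin m) (Fin m) F),
      (⨅ x : {x // amplify u m x = c • y}, S.norm m x) ≤
        ‖c‖ * ⨅ x : {x // amplify u m x = y}, S.norm m x := by
    intro m c y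
    have := hne m y
    rw [Real.mul_iInf_of_nonneg (_root_.norm_nonneg c)]
    refine le_ciInf fun x => (hle m _ (c • x.1) (by rw [amplify_smul, x.2])).trans ?_
    rw [S.smul_eq]
  { norm := fun m y => ⨅ x : {x // amplify u m x = y}, S.norm m x
    add_le := by
      intro m y y'
      refine le_of_forall_pos_le_add fun ε hε => ?_
      obtain ⟨x, hx, hx'⟩ := hapx m y (ε / 2) (by linarith)
      obtain ⟨z, hz, hz'⟩ := hapx m y' (ε / 2) (by linarith)
      have h1 := hle m (y + y') (x + z) (by rw [amplify_add, hx, hz])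
      have h2 := S.add_le m x z
      linarith
    smul_eq := by
      intro m c y
      refine le_antisymm (hsmul m c y) ?_
      by_cases hc : c = 0
      · subst hc
        simp only [_root_.norm_zero, zero_mul]
        exact Real.iInf_nonneg fun x => S.norm_nonneg m _
      · have h := hsmul m c⁻¹ (c • y)
        rw [smul_smul, inv_mul_cancel₀ hc, one_smul, norm_inv] at h
        have hc' : 0 < ‖c‖ := norm_pos_iff.mpr hc
        calc _ ≤ ‖c‖ * (‖c‖⁻¹ * ⨅ x : {x // amplify u m x = c • y}, S.norm m x) := by gcongr
          _ = _ := by field_simp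
    blockSum_le := by
      intro m k y y'
      refine le_of_forall_pos_le_add fun ε hε => ?_
      obtain ⟨x, hx, hx'⟩ := hapx m y ε hε
      obtain ⟨z, hz, hz'⟩ := hapx k y' ε hε
      refine (hle _ _ (blockSum x z) (by rw [amplify_blockSum, hx, hz])).trans
        ((S.blockSum_le m k x z).trans ?_)
      rw [← max_add_add_right]
      exact max_le_max hx'.le hz'.le
    scalarMul_le := by
      intro k m α y β
      have := hne m y
      rw [mul_right_comm, Real.mul_iInf_of_nonneg (by positivity)]
      refine le_ciInf fun x => (hle k _ (scalarMul α x.1 β) (by rw [amplify_scalarMul, x.2])).trans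
        ((S.scalarMul_le k m α x.1 β).trans_eq (by ring)) }

end Constructions

/-- The operator space `M_{p,q} = B(ℓ₂^q, ℓ₂^p)`: a matrix in `M_m(M_{p,q})` is normed as an
`mp × mq` matrix. -/
def matrixSpace (p q : Type*) [Fintype p] [Fintype q] [DecidableEq q] :
    OperatorSpace (Matrix p q ℂ) where
  norm m x := ‖Matrix.comp (Fin m) (Fin m) p q ℂ x‖
  add_le m x y := norm_add_le (Matrix.comp (Fin m) (Fin m) p q ℂ x) (Matrix.comp _ _ _ _ _ y)
  smul_eq m c x := norm_smul c (Matrix.comp (Fin m) (Fin m) p q ℂ x)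
  blockSum_le m k x y := by
    refine le_trans (le_trans (le_of_eq ?_) (norm_submatrix_equiv_le
      (Matrix.fromBlocks (Matrix.comp (Fin m) (Fin m) p q ℂ x) 0 0
        (Matrix.comp (Fin k) (Fin k) p q ℂ y))
      ((finSumFinEquiv.symm.prodCongr (Equiv.refl p)).trans (Equiv.sumProdDistrib _ _ _))
      ((finSumFinEquiv.symm.prodCongr (Equiv.refl q)).trans (Equiv.sumProdDistrib _ _ _))))
      (norm_fromBlocks_diag_le _ _)
    congr 1
    ext ⟨i, a⟩ ⟨j, b⟩
    obtain ⟨i, rfl⟩ := finSumFinEquiv.surjective i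
    obtain ⟨j, rfl⟩ := finSumFinEquiv.surjective j
    rcases i with i | i <;> rcases j with j | j <;> simp [blockSum]
  scalarMul_le k m α x β := by
    classical
    have h : Matrix.comp (Fin k) (Fin k) p q ℂ (scalarMul α x β) =
        (α ⊗ₖ (1 : Matrix p p ℂ)) * Matrix.comp (Fin m) (Fin m) p q ℂ x *
          (β ⊗ₖ (1 : Matrix q q ℂ)) := by
      ext ⟨i, a⟩ ⟨j, b⟩
      simp [scalarMul, Matrix.mul_apply, Fintype.sum_prod_type, Matrix.one_apply, Matrix.sum_apply,
        Finset.sum_mul]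
      rw [Finset.sum_comm]
      refine Finset.sum_congr rfl fun c _ => Finset.sum_congr rfl fun d _ => by ring
    rw [h]
    refine (Matrix.l2_opNorm_mul _ _).trans ?_
    refine mul_le_mul ((Matrix.l2_opNorm_mul _ _).trans ?_) (norm_kronecker_one_le _)
      (norm_nonneg _) (by positivity)
    gcongr
    exact norm_kronecker_one_le _
  eq_zero_of_norm m x hx := by
    have h := norm_eq_zero.mp hx
    ext i j a b
    exact congrFun (congrFun h (i, a)) (j, b)

section OperatorNorms

variable {E F : Type*} [AddCommGroup E] [Module ℂ E] [AddCommGroup F] [Module ℂ F]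

/-- The norm `‖u_N‖` of `u_N : M_N(E) → M_N(F)`, with values in `[0, ∞]`. -/
def amplifyNorm (S : OperatorSpace E) (T : OperatorSpace F) (u : E →ₗ[ℂ] F) (N : ℕ) : ENNReal :=
  ⨆ (x : Matrix (Fin N) (Fin N) E) (_ : S.norm N x ≤ 1), ENNReal.ofReal (T.norm N (amplify u N x))

/-- The distance `d_N(E, F)`, which is `∞` if `E` and `F` are not isomorphic. -/
def matrixDist (S : OperatorSpace E) (T : OperatorSpace F) (N : ℕ) : ENNReal :=
  ⨅ u : E ≃ₗ[ℂ] F, amplifyNorm S T u.toLinearMap N * amplifyNorm T S u.symm.toLinearMap N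

/-- `u` is completely contractive. -/
def IsCompleteContraction (S : OperatorSpace E) (T : OperatorSpace F) (u : E →ₗ[ℂ] F) : Prop :=
  ∀ (m : ℕ) (x : Matrix (Fin m) (Fin m) E), T.norm m (amplify u m x) ≤ S.norm m x

/-- The direct sum `M_N ⊕ ⋯ ⊕ M_N` of `k` copies of `M_N`, with
`‖x‖ = max_i ‖x_i‖` in `M_m(M_N ⊕ ⋯ ⊕ M_N)`. -/
def directSum (k N : ℕ) : OperatorSpace (Fin k → Matrix (Fin N) (Fin N) ℂ) where
  toMatrixSeminorm := MatrixSeminorm.sup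
    (fun i : Fin k => (matrixSpace (Fin N) (Fin N)).toMatrixSeminorm.pullback (LinearMap.proj i))
    (fun _ _ => Set.finite_range _ |>.bddAbove)
  eq_zero_of_norm m x hx := by
    refine Matrix.ext fun a b => funext fun i => ?_
    have hle := (MatrixSeminorm.le_sup (fun i : Fin k =>
      (matrixSpace (Fin N) (Fin N)).toMatrixSeminorm.pullback (LinearMap.proj i))
      (fun _ _ => Set.finite_range _ |>.bddAbove) i m x).trans hx.le
    have h := (matrixSpace (Fin N) (Fin N)).eq_zero_of_norm m _
      (le_antisymm hle (MatrixSeminorm.norm_nonneg _ _ _))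
    exact congrFun (congrFun h a) b

/-- The number `k_E(N, C)`: the least `k` such that some linear subspace `V` of the direct sum of
`k` copies of `M_N` satisfies `d_N(E, V) ≤ C` (and `∞` if there is no such `k`). -/
def multiplicity (S : OperatorSpace E) (N : ℕ) (C : ℝ) : ℕ∞ :=
  ⨅ (k : ℕ) (_ : ∃ V : Submodule ℂ (Fin k → Matrix (Fin N) (Fin N) ℂ),
    matrixDist S ((directSum k N).restrict V) N ≤ ENNReal.ofReal C), (k : ℕ∞)

end OperatorNorms

section Maximal

theorem norm_single_le {m k : ℕ} (i : Fin m) (j : Fin k) :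
    ‖(Matrix.single i j 1 : Matrix (Fin m) (Fin k) ℂ)‖ ≤ 1 := by
  refine opNorm_le_of_sq zero_le_one fun v => ?_
  have h : ∀ a, ((Matrix.single i j 1 : Matrix (Fin m) (Fin k) ℂ).mulVec v) a =
      if a = i then v j else 0 := by
    intro a
    by_cases ha : a = i
    · subst ha; simp [Matrix.mulVec, dotProduct, Matrix.single_apply]
    · simp [Matrix.mulVec, dotProduct, ha, Ne.symm ha]
  simp only [h]
  rw [Finset.sum_eq_single i (by intro b _ hb; simp [hb]) (by simp)]
  simpa using Finset.single_le_sum (f := fun j => ‖v j‖ ^ 2) (fun _ _ => sq_nonneg _)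
    (Finset.mem_univ j)

theorem MatrixSeminorm.norm_le_sum {E : Type*} [AddCommGroup E] [Module ℂ E]
    (S : MatrixSeminorm E) (m : ℕ) (x : Matrix (Fin m) (Fin m) E) :
    S.norm m x ≤ ∑ i, ∑ j, S.norm 1 (fun _ _ => x i j) := by
  have hx : x = ∑ i, ∑ j, scalarMul (Matrix.single i 0 1) (fun _ _ : Fin 1 => x i j)
      (Matrix.single 0 j 1) := by
    ext a b
    simp [scalarMul, Matrix.sum_apply, Matrix.single_apply, ite_and]
  have hs : ∀ (s : Finset (Fin m)) (f : Fin m → Matrix (Fin m) (Fin m) E),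
      S.norm m (∑ i ∈ s, f i) ≤ ∑ i ∈ s, S.norm m (f i) := fun s f =>
    Finset.le_sum_of_subadditive (S.norm m) (S.norm_zero m).le (S.add_le m) s f
  conv_lhs => rw [hx]
  refine (hs _ _).trans (Finset.sum_le_sum fun i _ => (hs _ _).trans
    (Finset.sum_le_sum fun j _ => (S.scalarMul_le _ _ _ _ _).trans ?_))
  have h0 := S.norm_nonneg 1 (fun _ _ => x i j)
  calc _ ≤ 1 * S.norm 1 (fun _ _ => x i j) * 1 := by
        gcongr <;> exact norm_single_le _ _
    _ = _ := by ring

theorem matrixSpace_norm_one {p q : Type*} [Fintype p] [Fintype q] [DecidableEq q]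
    (A : Matrix p q ℂ) : (matrixSpace p q).norm 1 (fun _ _ => A) = ‖A‖ := by
  refine le_antisymm ?_ ?_
  · exact norm_submatrix_equiv_le A (Equiv.uniqueProd p (Fin 1)) (Equiv.uniqueProd q (Fin 1))
  · exact norm_submatrix_equiv_le (Matrix.comp (Fin 1) (Fin 1) p q ℂ fun _ _ => A)
      (Equiv.uniqueProd p (Fin 1)).symm (Equiv.uniqueProd q (Fin 1)).symm

/-- The maximal operator space structure of a normed space `E`: `‖x‖` is the supremum of
`‖u_m(x)‖` over all linear contractions `u : E → M_k = B(ℓ₂^k)` and all `k`. (Contractions into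
`B(H)` for infinite-dimensional `H` give the same supremum, since the norm of an operator matrix is
the supremum of the norms of its compressions to finite-dimensional subspaces of `H`.) -/
def maximalSpace (E : Type*) [NormedAddCommGroup E] [NormedSpace ℂ E] : OperatorSpace E :=
  have hbdd : ∀ m x, BddAbove (Set.range fun i : (k : ℕ) ×
      {u : E →ₗ[ℂ] Matrix (Fin k) (Fin k) ℂ // ∀ e, ‖u e‖ ≤ ‖e‖} =>
        ((matrixSpace (Fin i.1) (Fin i.1)).toMatrixSeminorm.pullback i.2.1).norm m x) := by
    intro m x
    refine ⟨∑ i, ∑ j, ‖x i j‖, ?_⟩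
    rintro _ ⟨⟨k, u, hu⟩, rfl⟩
    refine (MatrixSeminorm.norm_le_sum _ m _).trans
      (Finset.sum_le_sum fun i _ => Finset.sum_le_sum fun j _ => ?_)
    refine le_trans (le_of_eq ?_) (hu (x i j))
    exact matrixSpace_norm_one _
  { toMatrixSeminorm := MatrixSeminorm.sup _ hbdd
    eq_zero_of_norm := by
      intro m x hx
      ext a b
      change x a b = 0
      by_contra hab
      obtain ⟨f, hf, hfx⟩ := exists_dual_vector ℂ (x a b) (norm_ne_zero_iff.mpr hab)
      let u : E →ₗ[ℂ] Matrix (Fin 1) (Fin 1) ℂ :=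
        { toFun := fun e => Matrix.diagonal fun _ => f e
          map_add' := fun e e' => by ext i j; simp [Subsingleton.elim i j]
          map_smul' := fun c e => by ext i j; simp [Subsingleton.elim i j] }
      have hu : ∀ e, ‖u e‖ ≤ ‖e‖ := by
        intro e
        have h1 : u e = Matrix.diagonal fun _ => f e := rfl
        rw [h1, Matrix.l2_opNorm_diagonal]
        refine (pi_norm_le_iff_of_nonneg (norm_nonneg e)).mpr fun _ => ?_
        simpa [hf] using f.le_opNorm e
      have hle : (matrixSpace (Fin 1) (Fin 1)).norm m (amplify u m x) ≤ 0 :=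
        (le_ciSup (hbdd m x) ⟨1, u, hu⟩).trans hx.le
      have h := (matrixSpace (Fin 1) (Fin 1)).eq_zero_of_norm m _
        (le_antisymm hle (MatrixSeminorm.norm_nonneg _ _ _))
      have h2 : f (x a b) = 0 := by
        simpa [u, amplify] using congrFun (congrFun (congrFun (congrFun h a) b) 0) 0
      rw [hfx] at h2
      simp [hab] at h2 }

/-- The space `ℓ₁^n` with its maximal operator space structure. -/
def maxEllOne (n : ℕ) : OperatorSpace (PiLp 1 fun _ : Fin n => ℂ) :=
  maximalSpace (PiLp 1 fun _ : Fin n => ℂ)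

end Maximal

section RowPlusColumn

/-- The matrix norms of the operator space direct sum `E ⊕₁ F`: `‖(x, y)‖` is the supremum of
`‖u_m(x) + v_m(y)‖` over all pairs of complete contractions `u : E → M_k`, `v : F → M_k` and
all `k` (as for the maximal structure, nothing changes if `B(H)` is allowed instead of `M_k`). -/
def oneSum {E F : Type*} [AddCommGroup E] [Module ℂ E] [AddCommGroup F] [Module ℂ F]
    (S : OperatorSpace E) (T : OperatorSpace F) : MatrixSeminorm (E × F) :=
  MatrixSeminorm.sup
    (fun i : (k : ℕ) ×
        ({u : E →ₗ[ℂ] Matrix (Fin k) (Fin k) ℂ //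
            IsCompleteContraction S (matrixSpace (Fin k) (Fin k)) u} ×
          {v : F →ₗ[ℂ] Matrix (Fin k) (Fin k) ℂ //
            IsCompleteContraction T (matrixSpace (Fin k) (Fin k)) v}) =>
      (matrixSpace (Fin i.1) (Fin i.1)).toMatrixSeminorm.pullback (i.2.1.1.coprod i.2.2.1))
    (by
      intro m x
      refine ⟨S.norm m (amplify (LinearMap.fst ℂ E F) m x) +
        T.norm m (amplify (LinearMap.snd ℂ E F) m x), ?_⟩
      rintro _ ⟨⟨k, ⟨u, hu⟩, ⟨v, hv⟩⟩, rfl⟩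
      have h : amplify (u.coprod v) m x = amplify u m (amplify (LinearMap.fst ℂ E F) m x) +
          amplify v m (amplify (LinearMap.snd ℂ E F) m x) := by
        ext; simp [amplify]
      change (matrixSpace (Fin k) (Fin k)).norm m (amplify (u.coprod v) m x) ≤ _
      rw [h]
      exact (MatrixSeminorm.add_le _ _ _ _).trans (add_le_add (hu _ _) (hv _ _)))

theorem le_oneSum {E F : Type*} [AddCommGroup E] [Module ℂ E] [AddCommGroup F] [Module ℂ F]
    (S : OperatorSpace E) (T : OperatorSpace F) {k : ℕ} (u : E →ₗ[ℂ] Matrix (Fin k) (Fin k) ℂ)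
    (v : F →ₗ[ℂ] Matrix (Fin k) (Fin k) ℂ)
    (hu : IsCompleteContraction S (matrixSpace (Fin k) (Fin k)) u)
    (hv : IsCompleteContraction T (matrixSpace (Fin k) (Fin k)) v) (m : ℕ)
    (x : Matrix (Fin m) (Fin m) (E × F)) :
    (matrixSpace (Fin k) (Fin k)).norm m (amplify (u.coprod v) m x) ≤ (oneSum S T).norm m x :=
  MatrixSeminorm.le_sup (fun i : (k : ℕ) ×
        ({u : E →ₗ[ℂ] Matrix (Fin k) (Fin k) ℂ //
            IsCompleteContraction S (matrixSpace (Fin k) (Fin k)) u} ×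
          {v : F →ₗ[ℂ] Matrix (Fin k) (Fin k) ℂ //
            IsCompleteContraction T (matrixSpace (Fin k) (Fin k)) v}) =>
      (matrixSpace (Fin i.1) (Fin i.1)).toMatrixSeminorm.pullback (i.2.1.1.coprod i.2.2.1))
    _ ⟨k, ⟨u, hu⟩, ⟨v, hv⟩⟩ m x

/-- The row space `R_n`, where `∑ a_j e_j` is the `1 × n` matrix with entries `a_j`. -/
def rowSpace (n : ℕ) : OperatorSpace (Fin n → ℂ) :=
  (matrixSpace Unit (Fin n)).pullback
    { toFun := fun a => Matrix.replicateRow Unit a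
      map_add' := fun _ _ => rfl
      map_smul' := fun _ _ => rfl } (Matrix.replicateRow_injective)

/-- The column space `C_n`, where `∑ a_j e_j` is the `n × 1` matrix with entries `a_j`. -/
def columnSpace (n : ℕ) : OperatorSpace (Fin n → ℂ) :=
  (matrixSpace (Fin n) Unit).pullback
    { toFun := fun a => Matrix.replicateCol Unit a
      map_add' := fun _ _ => rfl
      map_smul' := fun _ _ => rfl } (Matrix.replicateCol_injective)

/-- The coordinate map `a ↦ a_j`, with values in `M_1`. -/
def coordMap (n : ℕ) (j : Fin n) : (Fin n → ℂ) →ₗ[ℂ] Matrix (Fin 1) (Fin 1) ℂ where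
  toFun a := Matrix.of fun _ _ => a j
  map_add' _ _ := rfl
  map_smul' _ _ := rfl

theorem coordMap_apply (n : ℕ) (j : Fin n) (a : Fin n → ℂ) (i i' : Fin 1) :
    coordMap n j a i i' = a j := rfl

theorem coordMap_rowSpace (n : ℕ) (j : Fin n) :
    IsCompleteContraction (rowSpace n) (matrixSpace (Fin 1) (Fin 1)) (coordMap n j) := by
  intro m x
  refine opNorm_le_of_sq (norm_nonneg _) fun v => ?_
  have h := sum_norm_mulVec_sq_le (Matrix.comp (Fin m) (Fin m) Unit (Fin n) ℂ
    (x.map fun a => Matrix.replicateRow Unit a)) (fun c => if c.2 = j then v (c.1, 0) else 0)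
  simp only [Fintype.sum_prod_type, Finset.univ_unique, Finset.sum_singleton] at h ⊢
  refine le_trans (le_of_eq ?_) (h.trans (le_of_eq ?_))
  · simp [Matrix.mulVec, dotProduct, Fintype.sum_prod_type, coordMap_apply, amplify]
  · congr 1
    refine Finset.sum_congr rfl fun a _ => ?_
    rw [Finset.sum_eq_single j (by intro b _ hb; simp [hb]) (by simp)]
    simp

theorem coordMap_columnSpace (n : ℕ) (j : Fin n) :
    IsCompleteContraction (columnSpace n) (matrixSpace (Fin 1) (Fin 1)) (coordMap n j) := by
  intro m x
  refine opNorm_le_of_sq (norm_nonneg _) fun v => ?_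
  have h := sum_norm_mulVec_sq_le (Matrix.comp (Fin m) (Fin m) (Fin n) Unit ℂ
    (x.map fun a => Matrix.replicateCol Unit a)) (fun c => v (c.1, 0))
  simp only [Fintype.sum_prod_type, Finset.univ_unique, Finset.sum_singleton] at h ⊢
  refine le_trans (Finset.sum_le_sum fun a _ => ?_) h
  refine le_trans (le_of_eq ?_) (Finset.single_le_sum (fun _ _ => sq_nonneg _)
    (Finset.mem_univ j))
  simp [Matrix.mulVec, dotProduct, Fintype.sum_prod_type, coordMap_apply, amplify]

/-- The operator space `R_n + C_n`: the quotient of `R_n ⊕₁ C_n` by the map `(a, b) ↦ a + b`. -/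
def rowPlusColumn (n : ℕ) : OperatorSpace (Fin n → ℂ) where
  toMatrixSeminorm := (oneSum (rowSpace n) (columnSpace n)).quotient
    (LinearMap.id.coprod LinearMap.id) (fun a => ⟨(a, 0), by simp⟩)
  eq_zero_of_norm m x hx := by
    have key : ∀ j, (matrixSpace (Fin 1) (Fin 1)).norm m (amplify (coordMap n j) m x) ≤ 0 := by
      intro j
      refine le_trans ?_ hx.le
      have hne : Nonempty {z : Matrix (Fin m) (Fin m) ((Fin n → ℂ) × (Fin n → ℂ)) //
          amplify (LinearMap.id.coprod LinearMap.id) m z = x} :=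
        ⟨x.map fun a => (a, 0), by ext; simp [amplify]⟩
      refine le_ciInf fun z => ?_
      have hz : amplify (coordMap n j) m x =
          amplify ((coordMap n j).coprod (coordMap n j)) m z.1 := by
        conv_lhs => rw [← z.2]
        ext; simp [amplify]
      rw [hz]
      exact le_oneSum (rowSpace n) (columnSpace n) _ _ (coordMap_rowSpace n j)
        (coordMap_columnSpace n j) m z.1
    ext a b j
    have h := (matrixSpace (Fin 1) (Fin 1)).eq_zero_of_norm m _
      (le_antisymm (key j) (MatrixSeminorm.norm_nonneg _ _ _))
    exact congrFun (congrFun (congrFun (congrFun h a) b) 0) 0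

end RowPlusColumn

section OperatorHilbert

/-- The matrix `∑_j x_j ⊗ conj(y_j)`. -/
def tensorConj {n : ℕ} {p q : Type*} (x : Fin n → Matrix p p ℂ) (y : Fin n → Matrix q q ℂ) :
    Matrix (p × q) (p × q) ℂ :=
  ∑ j, x j ⊗ₖ (y j).map (starRingEnd ℂ)

theorem norm_sum_mul_conj_le {ι : Type*} [Fintype ι] (a b : ι → ℂ) :
    ‖∑ i, a i * starRingEnd ℂ (b i)‖ ≤ √(∑ i, ‖a i‖ ^ 2) * √(∑ i, ‖b i‖ ^ 2) := by
  have h := norm_inner_le_norm (𝕜 := ℂ) (WithLp.toLp 2 b) (WithLp.toLp 2 a)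
  rw [EuclideanSpace.norm_eq, EuclideanSpace.norm_eq, mul_comm] at h
  simpa [PiLp.inner_apply] using h

section CauchySchwarz

open scoped ComplexOrder

variable {p q r : Type*} [Fintype p] [Fintype q] [Fintype r]

theorem trace_mul_conjTranspose (A B : Matrix p q ℂ) :
    (A * B.conjTranspose).trace = ∑ c : p × q, A c.1 c.2 * starRingEnd ℂ (B c.1 c.2) := by
  simp [Matrix.trace, Matrix.mul_apply, Fintype.sum_prod_type]

theorem trace_mul_conjTranspose_self (A : Matrix p q ℂ) :
    (A * A.conjTranspose).trace = ((∑ c : p × q, ‖A c.1 c.2‖ ^ 2 : ℝ) : ℂ) := by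
  rw [trace_mul_conjTranspose]
  push_cast
  exact Finset.sum_congr rfl fun c _ => Complex.mul_conj' _

theorem sum_norm_sq_of_diagonal [DecidableEq q] (A : Matrix p q ℂ) (t : q → ℝ)
    (hA : A.conjTranspose * A = Matrix.diagonal (fun i => ((t i ^ 2 : ℝ) : ℂ))) :
    (∑ c : p × p, ‖(A * A.conjTranspose) c.1 c.2‖ ^ 2) = ∑ i, t i ^ 4 := by
  have h1 := trace_mul_conjTranspose_self (A * A.conjTranspose)
  have h2 : (A * A.conjTranspose) * (A * A.conjTranspose).conjTranspose =
      A * ((A.conjTranspose * A) * A.conjTranspose) := by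
    simp [Matrix.mul_assoc]
  rw [h2, Matrix.trace_mul_comm, Matrix.mul_assoc, hA, Matrix.diagonal_mul_diagonal,
    Matrix.trace_diagonal] at h1
  have h3 : ∀ i, ((t i ^ 2 : ℝ) : ℂ) * ((t i ^ 2 : ℝ) : ℂ) = ((t i ^ 4 : ℝ) : ℂ) := by
    intro i
    push_cast
    ring
  simp only [h3] at h1
  exact_mod_cast h1.symm

theorem exists_factorization [DecidableEq q] (ξ : Matrix p q ℂ) :
    ∃ (P : Matrix p q ℂ) (Q : Matrix q q ℂ), ξ = P * Q.conjTranspose ∧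
      (∑ c : p × p, ‖(P * P.conjTranspose) c.1 c.2‖ ^ 2) = ∑ c : p × q, ‖ξ c.1 c.2‖ ^ 2 ∧
      (∑ c : q × q, ‖(Q * Q.conjTranspose) c.1 c.2‖ ^ 2) = ∑ c : p × q, ‖ξ c.1 c.2‖ ^ 2 := by
  have hH := Matrix.isHermitian_conjTranspose_mul_self ξ
  have hpos : ∀ i, 0 ≤ hH.eigenvalues i :=
    (Matrix.posSemidef_conjTranspose_mul_self ξ).eigenvalues_nonneg
  set d := hH.eigenvalues with hd
  set V : Matrix q q ℂ := hH.eigenvectorUnitary.1 with hV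
  have hVV : V.conjTranspose * V = 1 := Unitary.coe_star_mul_self hH.eigenvectorUnitary
  have hVV' : V * V.conjTranspose = 1 := Unitary.coe_mul_star_self hH.eigenvectorUnitary
  have hspec : ξ.conjTranspose * ξ = V * Matrix.diagonal (fun i => (d i : ℂ)) * V.conjTranspose := by
    have := hH.spectral_theorem
    rw [Unitary.conjStarAlgAut_apply] at this
    exact this
  have hW : (ξ * V).conjTranspose * (ξ * V) = Matrix.diagonal (fun i => (d i : ℂ)) := by
    calc _ = V.conjTranspose * (ξ.conjTranspose * ξ) * V := by
            simp only [Matrix.conjTranspose_mul, Matrix.mul_assoc]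
      _ = (V.conjTranspose * V) * Matrix.diagonal (fun i => (d i : ℂ)) *
            (V.conjTranspose * V) := by
            rw [hspec]; simp only [Matrix.mul_assoc]
      _ = _ := by rw [hVV]; simp
  set t : q → ℝ := fun i => √(√(d i)) with ht
  have ht4 : ∀ i, t i ^ 4 = d i := by
    intro i
    have h1 : t i ^ 2 = √(d i) := Real.sq_sqrt (Real.sqrt_nonneg _)
    calc t i ^ 4 = (t i ^ 2) ^ 2 := by ring
      _ = d i := by rw [h1, Real.sq_sqrt (hpos i)]
  have hzero : ∀ i, t i = 0 → ∀ a, (ξ * V) a i = 0 := by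
    intro i hi a
    have h := congrFun (congrFun hW i) i
    have hdi : d i = 0 := by rw [← ht4, hi]; simp
    rw [Matrix.diagonal_apply_eq, hdi, Matrix.mul_apply] at h
    have h2 : ∑ b, ‖(ξ * V) b i‖ ^ 2 = 0 := by
      have h3 : ((∑ b, ‖(ξ * V) b i‖ ^ 2 : ℝ) : ℂ) = 0 := by
        rw [Complex.ofReal_zero] at h
        rw [← h]
        push_cast
        refine Finset.sum_congr rfl fun b _ => ?_
        rw [Matrix.conjTranspose_apply, mul_comm]
        exact (Complex.mul_conj' _).symm
      exact_mod_cast h3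
    have h4 := (Finset.sum_eq_zero_iff_of_nonneg (fun b _ => sq_nonneg _)).mp h2 a
      (Finset.mem_univ a)
    simpa using h4
  set Q : Matrix q q ℂ := V * Matrix.diagonal (fun i => (t i : ℂ)) with hQ
  set P : Matrix p q ℂ := ξ * V * Matrix.diagonal (fun i => ((t i)⁻¹ : ℂ)) with hP
  have hdiag : ∀ f : q → ℝ, (Matrix.diagonal (fun i => (f i : ℂ))).conjTranspose =
      Matrix.diagonal (fun i => (f i : ℂ)) := by
    intro f
    rw [Matrix.diagonal_conjTranspose]
    congr 1
    ext i
    simp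
  have hPP : P.conjTranspose * P = Matrix.diagonal (fun i => ((t i ^ 2 : ℝ) : ℂ)) := by
    have h1 : (Matrix.diagonal (fun i => ((t i)⁻¹ : ℂ))).conjTranspose =
        Matrix.diagonal (fun i => ((t i)⁻¹ : ℂ)) := by
      simp
    calc _ = Matrix.diagonal (fun i => ((t i)⁻¹ : ℂ)) * ((ξ * V).conjTranspose * (ξ * V)) *
            Matrix.diagonal (fun i => ((t i)⁻¹ : ℂ)) := by
            rw [hP, Matrix.conjTranspose_mul, h1]; simp only [Matrix.mul_assoc]
      _ = _ := by
        rw [hW, Matrix.diagonal_mul_diagonal, Matrix.diagonal_mul_diagonal]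
        congr 1
        ext i
        rw [← ht4]
        by_cases h0 : t i = 0
        · simp [h0]
        · have : (t i : ℂ) ≠ 0 := by exact_mod_cast h0
          push_cast
          field_simp
  have hQQ : Q.conjTranspose * Q = Matrix.diagonal (fun i => ((t i ^ 2 : ℝ) : ℂ)) := by
    calc _ = Matrix.diagonal (fun i => (t i : ℂ)) * (V.conjTranspose * V) *
            Matrix.diagonal (fun i => (t i : ℂ)) := by
            rw [hQ, Matrix.conjTranspose_mul, hdiag]; simp only [Matrix.mul_assoc]
      _ = _ := by
        rw [hVV, Matrix.mul_one, Matrix.diagonal_mul_diagonal]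
        congr 1
        ext i
        push_cast
        ring
  have hsum : ∑ c : p × q, ‖ξ c.1 c.2‖ ^ 2 = ∑ i, d i := by
    have h1 := trace_mul_conjTranspose_self ξ
    rw [Matrix.trace_mul_comm, hspec, Matrix.trace_mul_comm, ← Matrix.mul_assoc, hVV,
      Matrix.one_mul, Matrix.trace_diagonal] at h1
    exact_mod_cast h1.symm
  refine ⟨P, Q, ?_, ?_, ?_⟩
  rotate_left
  · rw [sum_norm_sq_of_diagonal P t hPP, hsum]
    exact Finset.sum_congr rfl fun i _ => ht4 i
  · rw [sum_norm_sq_of_diagonal Q t hQQ, hsum]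
    exact Finset.sum_congr rfl fun i _ => ht4 i
  have h1 : ξ * V * Matrix.diagonal (fun i => ((t i)⁻¹ : ℂ) * (t i : ℂ)) = ξ * V := by
    ext a i
    rw [Matrix.mul_diagonal]
    by_cases h0 : t i = 0
    · rw [hzero i h0 a]; simp
    · have : (t i : ℂ) ≠ 0 := by exact_mod_cast h0
      rw [inv_mul_cancel₀ this, mul_one]
  calc ξ = ξ * V * V.conjTranspose := by rw [Matrix.mul_assoc, hVV', Matrix.mul_one]
    _ = _ := by
      rw [hP, hQ, Matrix.conjTranspose_mul, hdiag]
      conv_lhs => rw [← h1, ← Matrix.diagonal_mul_diagonal]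
      simp only [Matrix.mul_assoc]

theorem tensorConj_mulVec {n : ℕ} (x : Fin n → Matrix p p ℂ) (y : Fin n → Matrix q q ℂ)
    (ξ : Matrix p q ℂ) (c : p × q) :
    ((tensorConj x y).mulVec fun c => ξ c.1 c.2) c =
      (∑ j, x j * ξ * (y j).conjTranspose) c.1 c.2 := by
  simp only [tensorConj, Matrix.sum_mulVec, Finset.sum_apply, Matrix.sum_apply]
  refine Finset.sum_congr rfl fun j _ => ?_
  simp only [Matrix.mulVec, dotProduct, Fintype.sum_prod_type, Matrix.kroneckerMap_apply,
    Matrix.map_apply, Matrix.mul_apply, Finset.sum_mul, Matrix.conjTranspose_apply]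
  rw [Finset.sum_comm]
  refine Finset.sum_congr rfl fun a _ => Finset.sum_congr rfl fun b _ => ?_
  simp only [starRingEnd_apply]
  ring

variable [DecidableEq p] [DecidableEq q] {n : ℕ}

theorem trace_sum_le (x : Fin n → Matrix p p ℂ) (P : Matrix p r ℂ) (R : Matrix p r ℂ) :
    ∑ j, ∑ c : r × r, ‖(R.conjTranspose * x j * P) c.1 c.2‖ ^ 2 ≤
      ‖tensorConj x x‖ * √(∑ c : p × p, ‖(P * P.conjTranspose) c.1 c.2‖ ^ 2) *
        √(∑ c : p × p, ‖(R * R.conjTranspose) c.1 c.2‖ ^ 2) := by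
  have h1 : ((∑ j, ∑ c : r × r, ‖(R.conjTranspose * x j * P) c.1 c.2‖ ^ 2 : ℝ) : ℂ) =
      ∑ c : p × p, ((tensorConj x x).mulVec fun c => (P * P.conjTranspose) c.1 c.2) c *
        starRingEnd ℂ ((R * R.conjTranspose) c.1 c.2) := by
    simp only [tensorConj_mulVec]
    rw [← trace_mul_conjTranspose, Matrix.sum_mul, Matrix.trace_sum, Complex.ofReal_sum]
    refine Finset.sum_congr rfl fun j _ => ?_
    rw [← trace_mul_conjTranspose_self]
    have h2 : R.conjTranspose * x j * P * (R.conjTranspose * x j * P).conjTranspose =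
        R.conjTranspose * (x j * P * P.conjTranspose * (x j).conjTranspose * R) := by
      simp [Matrix.mul_assoc]
    rw [h2, Matrix.trace_mul_comm]
    congr 1
    simp [Matrix.mul_assoc]
  have h0 : 0 ≤ ∑ j, ∑ c : r × r, ‖(R.conjTranspose * x j * P) c.1 c.2‖ ^ 2 :=
    Finset.sum_nonneg fun j _ => Finset.sum_nonneg fun c _ => sq_nonneg _
  have h3 := congrArg norm h1
  rw [Complex.norm_real, Real.norm_of_nonneg h0] at h3
  rw [h3]
  refine (norm_sum_mul_conj_le _ _).trans ?_
  gcongr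
  rw [← Real.sqrt_sq (norm_nonneg (tensorConj x x)), ← Real.sqrt_mul (sq_nonneg _)]
  exact Real.sqrt_le_sqrt (sum_norm_mulVec_sq_le _ _)

/-- Haagerup's Cauchy-Schwarz inequality. -/
theorem norm_tensorConj_le (x : Fin n → Matrix p p ℂ) (y : Fin n → Matrix q q ℂ) :
    ‖tensorConj x y‖ ≤ √‖tensorConj x x‖ * √‖tensorConj y y‖ := by
  have key : ∀ ξ η : Matrix p q ℂ,
      ‖∑ c : p × q, (∑ j, x j * ξ * (y j).conjTranspose) c.1 c.2 * starRingEnd ℂ (η c.1 c.2)‖ ≤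
      √‖tensorConj x x‖ * √‖tensorConj y y‖ * √(∑ c : p × q, ‖ξ c.1 c.2‖ ^ 2) *
        √(∑ c : p × q, ‖η c.1 c.2‖ ^ 2) := by
    intro ξ η
    obtain ⟨P, Q, hξ, hP, hQ⟩ := exists_factorization ξ
    obtain ⟨R, Z, hη, hR, hZ⟩ := exists_factorization η
    have h1 := trace_sum_le x P R
    have h2 := trace_sum_le y Q Z
    rw [hP, hR] at h1
    rw [hQ, hZ] at h2
    set s := √(∑ c : p × q, ‖ξ c.1 c.2‖ ^ 2) with hs
    set t := √(∑ c : p × q, ‖η c.1 c.2‖ ^ 2) with ht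
    have h3 : ∑ c : p × q, (∑ j, x j * ξ * (y j).conjTranspose) c.1 c.2 *
        starRingEnd ℂ (η c.1 c.2) =
        ∑ i : Fin n × (q × q), (R.conjTranspose * x i.1 * P) i.2.1 i.2.2 *
          starRingEnd ℂ ((Z.conjTranspose * y i.1 * Q) i.2.1 i.2.2) := by
      rw [← trace_mul_conjTranspose, Matrix.sum_mul, Matrix.trace_sum, Fintype.sum_prod_type]
      refine Finset.sum_congr rfl fun j _ => ?_
      refine Eq.trans ?_ (trace_mul_conjTranspose (R.conjTranspose * x j * P)
        (Z.conjTranspose * y j * Q))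
      have h4 : x j * ξ * (y j).conjTranspose * η.conjTranspose =
          (x j * P * Q.conjTranspose * (y j).conjTranspose * Z) * R.conjTranspose := by
        rw [hξ, hη]; simp [Matrix.mul_assoc]
      rw [h4, Matrix.trace_mul_comm]
      congr 1
      simp [Matrix.mul_assoc]
    rw [h3]
    refine (norm_sum_mul_conj_le _ _).trans ?_
    rw [Fintype.sum_prod_type, Fintype.sum_prod_type]
    have hst : 0 ≤ s * t := by positivity
    calc _ ≤ √(‖tensorConj x x‖ * s * t) * √(‖tensorConj y y‖ * s * t) :=
          mul_le_mul (Real.sqrt_le_sqrt h1) (Real.sqrt_le_sqrt h2) (Real.sqrt_nonneg _)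
            (Real.sqrt_nonneg _)
      _ = _ := by
        rw [mul_assoc, mul_assoc, Real.sqrt_mul (norm_nonneg _), Real.sqrt_mul (norm_nonneg _),
          mul_mul_mul_comm, Real.mul_self_sqrt hst]
        ring
  refine opNorm_le_of_sq (by positivity) fun v => ?_
  set w : p × q → ℂ := (tensorConj x y).mulVec v with hw
  set ξ : Matrix p q ℂ := Matrix.of fun a b => v (a, b) with hξ
  set η : Matrix p q ℂ := Matrix.of fun a b => w (a, b) with hη
  have hwξ : ∀ c, (∑ j, x j * ξ * (y j).conjTranspose) c.1 c.2 = w c := by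
    intro c
    rw [← tensorConj_mulVec]
    rfl
  have h := key ξ η
  simp only [hwξ] at h
  have h1 : ∑ c : p × q, w c * starRingEnd ℂ (η c.1 c.2) = ((∑ c, ‖w c‖ ^ 2 : ℝ) : ℂ) := by
    push_cast
    exact Finset.sum_congr rfl fun c _ => Complex.mul_conj' _
  have hw0 : 0 ≤ ∑ c, ‖w c‖ ^ 2 := Finset.sum_nonneg fun c _ => sq_nonneg _
  have hv0 : 0 ≤ ∑ c, ‖v c‖ ^ 2 := Finset.sum_nonneg fun c _ => sq_nonneg _
  rw [h1, Complex.norm_real, Real.norm_of_nonneg hw0] at h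
  change ∑ c, ‖w c‖ ^ 2 ≤ _ * √(∑ c, ‖v c‖ ^ 2) * √(∑ c, ‖w c‖ ^ 2) at h
  rw [← Real.sq_sqrt hw0, ← Real.sq_sqrt hv0, ← mul_pow]
  set a := √(∑ c, ‖w c‖ ^ 2) with ha
  rw [← Real.sq_sqrt hw0, ← ha] at h
  have ha0 : 0 ≤ a := Real.sqrt_nonneg _
  refine pow_le_pow_left₀ ha0 ?_ 2
  rcases ha0.eq_or_lt with h0 | h0
  · rw [← h0]; positivity
  · rw [sq] at h
    exact le_of_mul_le_mul_right h h0

end CauchySchwarz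

/-- The coefficients `x_j ∈ M_m` of `x = ∑ x_j ⊗ e_j ∈ M_m(ℂ^n)`. -/
def coeff {n m : ℕ} (x : Matrix (Fin m) (Fin m) (EuclideanSpace ℂ (Fin n))) :
    Fin n → Matrix (Fin m) (Fin m) ℂ :=
  fun j => x.map fun a => a j

/-- The linear map `ℓ₂^n → M_k` that sends `e_j` to `conj(y_j)`. -/
def conjMap {n k : ℕ} (y : Fin n → Matrix (Fin k) (Fin k) ℂ) :
    EuclideanSpace ℂ (Fin n) →ₗ[ℂ] Matrix (Fin k) (Fin k) ℂ where
  toFun a := ∑ j, a j • (y j).map (starRingEnd ℂ)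
  map_add' a b := by simp [add_smul, Finset.sum_add_distrib]
  map_smul' c a := by simp [mul_smul, Finset.smul_sum]

theorem matrixSpace_conjMap {n k m : ℕ} (y : Fin n → Matrix (Fin k) (Fin k) ℂ)
    (x : Matrix (Fin m) (Fin m) (EuclideanSpace ℂ (Fin n))) :
    (matrixSpace (Fin k) (Fin k)).norm m (amplify (conjMap y) m x) =
      ‖tensorConj (coeff x) y‖ := by
  change ‖Matrix.comp (Fin m) (Fin m) (Fin k) (Fin k) ℂ (amplify (conjMap y) m x)‖ = _
  congr 1
  ext ⟨i, a⟩ ⟨j, b⟩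
  simp [tensorConj, coeff, amplify, conjMap, Matrix.sum_apply]

theorem conjMap_bdd (n m : ℕ) (x : Matrix (Fin m) (Fin m) (EuclideanSpace ℂ (Fin n))) :
    ∀ i : (k : ℕ) × {y : Fin n → Matrix (Fin k) (Fin k) ℂ // ‖tensorConj y y‖ ≤ 1},
      ((matrixSpace (Fin i.1) (Fin i.1)).toMatrixSeminorm.pullback (conjMap i.2.1)).norm m x ≤
        √‖tensorConj (coeff x) (coeff x)‖ := by
  rintro ⟨k, y, hy⟩
  refine (matrixSpace_conjMap y x).trans_le ((norm_tensorConj_le _ _).trans ?_)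
  exact mul_le_of_le_one_right (Real.sqrt_nonneg _) (Real.sqrt_le_one.mpr hy)

/-- The supremum of `‖∑ x_j ⊗ conj(y_j)‖` over all `y` with `‖∑ y_j ⊗ conj(y_j)‖ ≤ 1`. -/
def operatorHilbertAux (n : ℕ) : MatrixSeminorm (EuclideanSpace ℂ (Fin n)) :=
  MatrixSeminorm.sup
    (fun i : (k : ℕ) × {y : Fin n → Matrix (Fin k) (Fin k) ℂ // ‖tensorConj y y‖ ≤ 1} =>
      (matrixSpace (Fin i.1) (Fin i.1)).toMatrixSeminorm.pullback (conjMap i.2.1))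
    (fun m x => ⟨_, by rintro _ ⟨i, rfl⟩; exact conjMap_bdd n m x i⟩)

theorem tensorConj_smul_smul {n : ℕ} {p q : Type*} (c d : ℝ) (x : Fin n → Matrix p p ℂ)
    (y : Fin n → Matrix q q ℂ) :
    tensorConj ((c : ℂ) • x) ((d : ℂ) • y) = ((c * d : ℝ) : ℂ) • tensorConj x y := by
  ext i j
  simp [tensorConj, Matrix.sum_apply, Finset.mul_sum]
  exact Finset.sum_congr rfl fun _ _ => by ring

theorem operatorHilbertAux_norm (n m : ℕ)
    (x : Matrix (Fin m) (Fin m) (EuclideanSpace ℂ (Fin n))) :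
    (operatorHilbertAux n).norm m x = √‖tensorConj (coeff x) (coeff x)‖ := by
  refine le_antisymm (Real.iSup_le (conjMap_bdd n m x) (Real.sqrt_nonneg _)) ?_
  set c := √‖tensorConj (coeff x) (coeff x)‖ with hc
  rcases (Real.sqrt_nonneg ‖tensorConj (coeff x) (coeff x)‖).eq_or_lt with h0 | h0
  · rw [hc, ← h0]; exact MatrixSeminorm.norm_nonneg _ _ _
  · have hcc : ‖tensorConj (coeff x) (coeff x)‖ = c * c := (Real.mul_self_sqrt (norm_nonneg _)).symm
    have hc0 : 0 < c := h0
    have hy : ‖tensorConj (((c⁻¹ : ℝ) : ℂ) • coeff x) (((c⁻¹ : ℝ) : ℂ) • coeff x)‖ ≤ 1 := by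
      rw [tensorConj_smul_smul, norm_smul, hcc, Complex.norm_real,
        Real.norm_of_nonneg (by positivity)]
      field_simp
      rfl
    have h := MatrixSeminorm.le_sup
      (fun i : (k : ℕ) × {y : Fin n → Matrix (Fin k) (Fin k) ℂ // ‖tensorConj y y‖ ≤ 1} =>
        (matrixSpace (Fin i.1) (Fin i.1)).toMatrixSeminorm.pullback (conjMap i.2.1))
      (fun m x => ⟨_, by rintro _ ⟨i, rfl⟩; exact conjMap_bdd n m x i⟩) ⟨m, _, hy⟩ m x
    refine le_trans (le_of_eq ?_) h
    refine Eq.trans ?_ (matrixSpace_conjMap _ x).symm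
    have h2 := tensorConj_smul_smul 1 c⁻¹ (coeff x) (coeff x)
    rw [Complex.ofReal_one, one_smul] at h2
    rw [h2, norm_smul, hcc, Complex.norm_real, Real.norm_of_nonneg (by positivity)]
    field_simp

/-- The `n`-dimensional operator Hilbert space `OH_n`:
`‖∑ x_j ⊗ e_j‖ = ‖∑ x_j ⊗ conj(x_j)‖^{1/2}` for all `x_j ∈ M_m`, where `(e_j)` is the orthonormal
basis of `ℓ₂^n`. -/
def operatorHilbert (n : ℕ) : OperatorSpace (EuclideanSpace ℂ (Fin n)) where
  norm m x := √‖tensorConj (coeff x) (coeff x)‖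
  add_le m x y := by
    simp only [← operatorHilbertAux_norm]; exact (operatorHilbertAux n).add_le m x y
  smul_eq m c x := by
    simp only [← operatorHilbertAux_norm]; exact (operatorHilbertAux n).smul_eq m c x
  blockSum_le m k x y := by
    simp only [← operatorHilbertAux_norm]; exact (operatorHilbertAux n).blockSum_le m k x y
  scalarMul_le k m α x β := by
    simp only [← operatorHilbertAux_norm]; exact (operatorHilbertAux n).scalarMul_le k m α x β
  eq_zero_of_norm m x hx := by
    have h := norm_eq_zero.mp ((Real.sqrt_eq_zero (norm_nonneg _)).mp hx)
    ext a b j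
    have h1 := congrFun (congrFun h (a, a)) (b, b)
    have h2 : ((∑ j, ‖x a b j‖ ^ 2 : ℝ) : ℂ) = 0 := by
      rw [← Matrix.zero_apply (a, a) (b, b), ← h1]
      simp only [tensorConj, coeff, Matrix.sum_apply, Matrix.kroneckerMap_apply, Matrix.map_apply]
      push_cast
      exact Finset.sum_congr rfl fun c _ => (Complex.mul_conj' _).symm
    have h3 : ∑ j, ‖x a b j‖ ^ 2 = 0 := by exact_mod_cast h2
    have h4 := (Finset.sum_eq_zero_iff_of_nonneg (fun b _ => sq_nonneg _)).mp h3 j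
      (Finset.mem_univ j)
    simpa using h4

end OperatorHilbert

end MatricialMultiplicity

end

/-! Suppose `E` is nearly isometric at level `N` to a subspace of a direct sum of `k` copies of
`M_N`. The coordinates give `k` maps `w_i : E → M_N`, contractive at level `N`, and for every `x` in
`M_N(E)` some `w_i` almost attains the norm of `x` (`exists_norming_maps`). Apply this to `x = ∑ u_j
⊗ e_j` with `u_j` unitary. All three spaces have the property `NormsUnitaries`: after rescaling,
`w_i` becomes a tuple `z_i` with `‖∑ z_j ⊗ conj(z_j)‖ ≤ n`, and almost attaining the norm of `x`
means that `‖∑ u_j ⊗ conj(z_j)‖` is almost `n`, the largest value allowed by Haagerup's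
Cauchy-Schwarz inequality. It therefore suffices to find `exp(b n N²)` tuples `u` such that no
single `z` almost norms two of them (`exists_separated_tuples`). The pigeonhole principle then
bounds `k` from below (`le_multiplicity`).

Separation comes from rigidity. Let a fixed proportion of the entries of `u` be equal to `1`, and
likewise for each matrix of a quantum expander: three unitaries for which a matrix almost commuting
with all of them is close to a scalar, with a constant independent of `N`. Near equality in
Haagerup's inequality, attained at `ξ` and `η`, forces the `u_j` to intertwine `|ξ^*|` and `|η^*|`
approximately on average (`sum_hsSq_intertwine_le`). The copies of `1` make these two matrices close
to each other. The expander then makes both close to scalars, so `ξ` and `η` are close to multiples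
of unitaries, and `z` is close to `u` up to left and right multiplication by unitaries
(`exists_unitary_close`). If `z` almost norms both `u` and `v`, then `v_j ≈ g u_j h` on average. The
common entries `1` and `w_k` force `h^* ≈ g` and `g` close to a scalar, hence `u ≈ v`
(`sum_hsSq_sub_le_of_common`). The entries not used by the expander can thus be taken from any well
separated set of tuples of unitaries.

Such sets can be exponentially large (`exists_packing`). Paired with random sign matrices, the best
tuple of unitaries gains a trace norm of order `N^{3/2}` per entry, whereas one fixed tuple gives
only a subgaussian variable. A set that is dense among all tuples of unitaries must therefore have
`exp(c K N²)` elements, where `K` is the length of the tuples.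

The expander is explicit: a clock matrix, a quadratic phase and the Fourier matrix. Conjugation by
them acts on Weyl coefficients through a character, a shear and a rotation of the discrete torus,
and the gap follows from a combinatorial argument there (`sum_sq_le_of_almost_invariant`). -/

noncomputable section

namespace MatricialMultiplicity

open scoped Matrix.Norms.L2Operator Kronecker

/-! ### Hilbert-Schmidt norms and inner products. -/

section HilbertSchmidt

variable {p q r : Type*} [Fintype p] [Fintype q] [Fintype r]

/-- The square of the Hilbert-Schmidt norm. -/
def hsSq (A : Matrix p q ℂ) : ℝ := ∑ c : p × q, ‖A c.1 c.2‖ ^ 2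

theorem hsSq_eq_sum (A : Matrix p q ℂ) : hsSq A = ∑ i, ∑ j, ‖A i j‖ ^ 2 := by
  rw [hsSq, Fintype.sum_prod_type]

theorem hsSq_nonneg (A : Matrix p q ℂ) : 0 ≤ hsSq A :=
  Finset.sum_nonneg fun _ _ => sq_nonneg _

theorem ofReal_hsSq (A : Matrix p q ℂ) : ((hsSq A : ℝ) : ℂ) = (A * A.conjTranspose).trace :=
  (trace_mul_conjTranspose_self A).symm

theorem hsSq_conjTranspose (A : Matrix p q ℂ) : hsSq A.conjTranspose = hsSq A := by
  rw [hsSq_eq_sum, hsSq_eq_sum, Finset.sum_comm]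
  simp

theorem ofReal_hsSq' (A : Matrix p q ℂ) : ((hsSq A : ℝ) : ℂ) = (A.conjTranspose * A).trace := by
  rw [ofReal_hsSq, Matrix.trace_mul_comm]

theorem hsSq_neg (A : Matrix p q ℂ) : hsSq (-A) = hsSq A := by
  simp [hsSq]

theorem hsSq_sub_comm (A B : Matrix p q ℂ) : hsSq (A - B) = hsSq (B - A) := by
  rw [← hsSq_neg, neg_sub]

theorem hsSq_smul (c : ℂ) (A : Matrix p q ℂ) : hsSq (c • A) = ‖c‖ ^ 2 * hsSq A := by
  simp [hsSq, mul_pow, Finset.mul_sum]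

theorem hsSq_one [DecidableEq p] : hsSq (1 : Matrix p p ℂ) = Fintype.card p := by
  rw [hsSq_eq_sum]
  simp [Matrix.one_apply, apply_ite, ite_pow]

theorem hsSq_add_le (A B : Matrix p q ℂ) : hsSq (A + B) ≤ 2 * hsSq A + 2 * hsSq B := by
  unfold hsSq
  rw [Finset.mul_sum, Finset.mul_sum, ← Finset.sum_add_distrib]
  refine Finset.sum_le_sum fun c _ => ?_
  have h := norm_add_le (A c.1 c.2) (B c.1 c.2)
  have h' := pow_le_pow_left₀ (norm_nonneg _) h 2
  rw [Matrix.add_apply]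
  nlinarith [sq_nonneg (‖A c.1 c.2‖ - ‖B c.1 c.2‖)]

/-- The triangle inequality for `hsSq`, in the form `‖A - C‖² ≤ 2 ‖A - B‖² + 2 ‖B - C‖²`. -/
theorem hsSq_sub_le (A B C : Matrix p q ℂ) :
    hsSq (A - C) ≤ 2 * hsSq (A - B) + 2 * hsSq (B - C) := by
  have := hsSq_add_le (A - B) (B - C)
  rwa [sub_add_sub_cancel] at this

theorem hsSq_mul_left [DecidableEq p] {U : Matrix p p ℂ} (hU : U.conjTranspose * U = 1)
    (A : Matrix p q ℂ) : hsSq (U * A) = hsSq A := by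
  have h : ((hsSq (U * A) : ℝ) : ℂ) = hsSq A := by
    rw [ofReal_hsSq', ofReal_hsSq', Matrix.conjTranspose_mul, Matrix.mul_assoc,
      ← Matrix.mul_assoc _ U, hU, Matrix.one_mul]
  exact_mod_cast h

theorem hsSq_mul_right [DecidableEq q] {U : Matrix q q ℂ} (hU : U * U.conjTranspose = 1)
    (A : Matrix p q ℂ) : hsSq (A * U) = hsSq A := by
  rw [← hsSq_conjTranspose, Matrix.conjTranspose_mul, hsSq_mul_left (by simpa using hU),
    hsSq_conjTranspose]

/-- The Hilbert-Schmidt inner product, linear in the first variable. -/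
def hsInner (A B : Matrix p q ℂ) : ℂ := ∑ c : p × q, A c.1 c.2 * starRingEnd ℂ (B c.1 c.2)

theorem hsInner_eq_trace (A B : Matrix p q ℂ) : hsInner A B = (A * B.conjTranspose).trace :=
  (trace_mul_conjTranspose A B).symm

theorem hsInner_self (A : Matrix p q ℂ) : hsInner A A = hsSq A := by
  rw [hsInner_eq_trace, ofReal_hsSq]

theorem norm_hsInner_le (A B : Matrix p q ℂ) : ‖hsInner A B‖ ≤ √(hsSq A) * √(hsSq B) :=
  norm_sum_mul_conj_le _ _

theorem hsInner_sub_left (A B C : Matrix p q ℂ) :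
    hsInner (A - B) C = hsInner A C - hsInner B C := by
  simp [hsInner, sub_mul]

theorem hsInner_sub_right (A B C : Matrix p q ℂ) :
    hsInner A (B - C) = hsInner A B - hsInner A C := by
  simp [hsInner, mul_sub]

theorem hsSq_sub (A B : Matrix p q ℂ) :
    hsSq (A - B) = hsSq A + hsSq B - 2 * (hsInner A B).re := by
  simp only [hsSq, hsInner, Complex.re_sum, Finset.mul_sum, ← Finset.sum_add_distrib,
    ← Finset.sum_sub_distrib]
  refine Finset.sum_congr rfl fun c _ => ?_
  rw [Matrix.sub_apply, ← Complex.normSq_eq_norm_sq, ← Complex.normSq_eq_norm_sq,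
    ← Complex.normSq_eq_norm_sq, Complex.normSq_sub]

theorem hsSq_diagonal [DecidableEq p] (d : p → ℂ) :
    hsSq (Matrix.diagonal d) = ∑ i, ‖d i‖ ^ 2 := by
  rw [hsSq_eq_sum]
  refine Finset.sum_congr rfl fun i _ => ?_
  rw [Finset.sum_eq_single i (by intro j _ hj; simp [Matrix.diagonal_apply_ne _ hj.symm]) (by simp)]
  simp

end HilbertSchmidt

/-! ### Singular value decomposition. -/

section SingularValues

variable {p : Type*} [Fintype p] [DecidableEq p]

/-- A square matrix whose columns are pairwise orthogonal is the product of a unitary and a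
nonnegative diagonal matrix. -/
theorem exists_unitary_mul_diagonal (B : Matrix p p ℂ) (d : p → ℝ)
    (hB : B.conjTranspose * B = Matrix.diagonal (fun i => ((d i ^ 2 : ℝ) : ℂ))) :
    ∃ U : Matrix p p ℂ, U.conjTranspose * U = 1 ∧ B = U * Matrix.diagonal (fun i => (d i : ℂ)) := by
  -- The normalized columns of `B`. Where `d i = 0` the column of `B` vanishes, so `U` may have any
  -- column there; the extension to an orthonormal basis supplies it.
  let v : p → EuclideanSpace ℂ p := fun i => WithLp.toLp 2 fun a => ((d i)⁻¹ : ℂ) * B a i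
  have hinner : ∀ i j, inner ℂ (v i) (v j) =
      ((d i)⁻¹ : ℂ) * (d j)⁻¹ * (B.conjTranspose * B) i j := by
    intro i j
    simp only [v, PiLp.inner_apply, RCLike.inner_apply, Matrix.mul_apply, Finset.mul_sum,
      Matrix.conjTranspose_apply]
    refine Finset.sum_congr rfl fun a _ => ?_
    simp
    ring
  have hon : Orthonormal ℂ ({i | d i ≠ 0}.domRestrict v) := by
    rw [orthonormal_iff_ite]
    rintro ⟨i, hi⟩ ⟨j, hj⟩
    simp only [Set.domRestrict_apply, hinner, hB, Subtype.mk.injEq, Matrix.diagonal_apply]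
    split_ifs with h
    · subst h
      have : (d i : ℂ) ≠ 0 := by exact_mod_cast hi
      push_cast
      field_simp
    · simp
  obtain ⟨b, hb⟩ := hon.exists_orthonormalBasis_extension_of_card_eq (by simp)
  refine ⟨Matrix.of fun a i => b i a, ?_, ?_⟩
  · ext i j
    have := orthonormal_iff_ite.mp b.orthonormal i j
    rw [Matrix.one_apply, ← this]
    simp [PiLp.inner_apply, Matrix.mul_apply, mul_comm]
  · ext a i
    rw [Matrix.mul_diagonal, Matrix.of_apply]
    by_cases h : d i = 0
    · have h1 := congrFun (congrFun hB i) i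
      rw [Matrix.diagonal_apply_eq, h, Matrix.mul_apply] at h1
      have h3 : ((∑ c, ‖B c i‖ ^ 2 : ℝ) : ℂ) = 0 := by
        push_cast
        simp only [← Complex.conj_mul']
        simpa using h1
      have h4 : ∑ c, ‖B c i‖ ^ 2 = 0 := by exact_mod_cast h3
      have h5 := (Finset.sum_eq_zero_iff_of_nonneg (fun b _ => sq_nonneg _)).mp h4 a
        (Finset.mem_univ a)
      simpa [h] using h5
    · have hc : (d i : ℂ) ≠ 0 := by exact_mod_cast h
      rw [hb i h]
      simp only [v]
      field_simp

/-- The singular value decomposition. -/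
theorem exists_svd (A : Matrix p p ℂ) :
    ∃ (U V : Matrix p p ℂ) (s : p → ℝ), U.conjTranspose * U = 1 ∧ V.conjTranspose * V = 1 ∧
      (∀ i, 0 ≤ s i) ∧ A = U * Matrix.diagonal (fun i => (s i : ℂ)) * V.conjTranspose := by
  have hH := Matrix.isHermitian_conjTranspose_mul_self A
  have hpos : ∀ i, 0 ≤ hH.eigenvalues i := by
    open scoped ComplexOrder in
    exact (Matrix.posSemidef_conjTranspose_mul_self A).eigenvalues_nonneg
  set d := hH.eigenvalues with hd
  set V : Matrix p p ℂ := hH.eigenvectorUnitary.1 with hV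
  have hVV : V.conjTranspose * V = 1 := Unitary.coe_star_mul_self hH.eigenvectorUnitary
  have hVV' : V * V.conjTranspose = 1 := Unitary.coe_mul_star_self hH.eigenvectorUnitary
  have hspec : A.conjTranspose * A =
      V * Matrix.diagonal (fun i => (d i : ℂ)) * V.conjTranspose := by
    have := hH.spectral_theorem
    rw [Unitary.conjStarAlgAut_apply] at this
    exact this
  have hW : (A * V).conjTranspose * (A * V) =
      Matrix.diagonal (fun i => ((√(d i) ^ 2 : ℝ) : ℂ)) := by
    calc _ = V.conjTranspose * (A.conjTranspose * A) * V := by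
            simp only [Matrix.conjTranspose_mul, Matrix.mul_assoc]
      _ = (V.conjTranspose * V) * Matrix.diagonal (fun i => (d i : ℂ)) *
            (V.conjTranspose * V) := by
            rw [hspec]; simp only [Matrix.mul_assoc]
      _ = _ := by
        rw [hVV, Matrix.mul_one, Matrix.one_mul]
        congr 1
        ext i
        rw [Real.sq_sqrt (hpos i)]
  obtain ⟨U, hU, hUA⟩ := exists_unitary_mul_diagonal (A * V) (fun i => √(d i)) hW
  refine ⟨U, V, fun i => √(d i), hU, hVV, fun i => Real.sqrt_nonneg _, ?_⟩
  rw [← hUA, Matrix.mul_assoc, hVV', Matrix.mul_one]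

end SingularValues

/-! ### Almost invariant functions on the discrete torus. -/

section QuantumExpander

/-- Pointwise, `(s - d)² ≤ s² + s²/40 + 41 d²` with `s = φ (σ v)` and `d = φ (σ v) - φ v`. The
weight `40` makes the error a small enough part of the total mass to be absorbed at the end of
`sum_sq_le_of_almost_invariant`. -/
theorem sum_sq_le_sum_map_add {α : Type*} [Fintype α] (φ : α → ℝ) (σ : α ≃ α) {e : ℝ}
    (h : ∑ v, (φ (σ v) - φ v) ^ 2 ≤ e) (P : Finset α) :
    ∑ v ∈ P, φ v ^ 2 ≤
      ∑ v ∈ P.map σ.toEmbedding, φ v ^ 2 + ((∑ v, φ v ^ 2) / 40 + 41 * e) := by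
  rw [Finset.sum_map]
  have h1 : ∀ v, φ v ^ 2 ≤ φ (σ v) ^ 2 + (φ (σ v) ^ 2 / 40 + 41 * (φ (σ v) - φ v) ^ 2) := by
    intro v
    nlinarith [sq_nonneg (φ (σ v) / 40 + (φ (σ v) - φ v))]
  have h2 : ∑ v ∈ P, (φ (σ v) ^ 2 / 40 + 41 * (φ (σ v) - φ v) ^ 2) ≤
      ∑ v, (φ (σ v) ^ 2 / 40 + 41 * (φ (σ v) - φ v) ^ 2) :=
    Finset.sum_le_sum_of_subset_of_nonneg (Finset.subset_univ _) fun v _ _ => by positivity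
  have h4 : ∑ v, (φ (σ v) ^ 2 / 40 + 41 * (φ (σ v) - φ v) ^ 2) ≤ (∑ v, φ v ^ 2) / 40 + 41 * e := by
    rw [Finset.sum_add_distrib, ← Finset.mul_sum, ← Finset.sum_div, σ.sum_comp (fun v => φ v ^ 2)]
    linarith
  have h3 := Finset.sum_le_sum fun v (_ : v ∈ P) => h1 v
  rw [Finset.sum_add_distrib] at h3
  simp only [Equiv.coe_toEmbedding]
  linarith

variable {N : ℕ} [NeZero N]

/-- `|exp(2πij/N) - 1| = 2 |sin(πj/N)| ≥ 4 |j|/N` by Jordan's inequality, since `|j| ≤ N/2`. -/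
theorem two_fifths_le_norm_stdAddChar_sub_one {a : ZMod N} (ha : N ≤ 10 * a.valMinAbs.natAbs) :
    2 / 5 ≤ ‖ZMod.stdAddChar a - 1‖ := by
  have hN : (0 : ℝ) < N := by exact_mod_cast Nat.pos_of_ne_zero (NeZero.ne N)
  set j := a.valMinAbs with hj
  have h1 : (ZMod.stdAddChar a : ℂ) = Complex.exp (Complex.I * ((2 * Real.pi * j / N : ℝ) : ℂ)) := by
    conv_lhs => rw [← ZMod.coe_valMinAbs a, ZMod.stdAddChar_coe]
    congr 1
    push_cast
    ring
  rw [h1, Complex.norm_exp_I_mul_ofReal_sub_one, Real.norm_eq_abs, abs_mul, abs_two]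
  have h2 : (|j| : ℝ) ≤ N / 2 := by
    have := a.natAbs_valMinAbs_le
    have h3 : j.natAbs * 2 ≤ N := by omega
    have h4 : (j.natAbs : ℝ) * 2 ≤ N := by exact_mod_cast h3
    rw [Nat.cast_natAbs, Int.cast_abs] at h4
    linarith
  have h3 : (N : ℝ) ≤ 10 * |(j : ℝ)| := by
    rw [← Int.cast_abs, ← Nat.cast_natAbs]
    exact_mod_cast ha
  have h4 : |Real.sin (2 * Real.pi * j / N / 2)| = |Real.sin (Real.pi * |(j : ℝ)| / N)| := by
    rcases abs_cases (j : ℝ) with ⟨h, _⟩ | ⟨h, _⟩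
    · rw [h]; congr 2; ring
    · rw [h, ← abs_neg, ← Real.sin_neg]; congr 2; ring
  have h5 : 2 / Real.pi * (Real.pi * |(j : ℝ)| / N) ≤ Real.sin (Real.pi * |(j : ℝ)| / N) := by
    refine Real.mul_le_sin (by positivity) ?_
    rw [div_le_iff₀ hN]
    nlinarith [Real.pi_pos]
  have h6 : 2 / Real.pi * (Real.pi * |(j : ℝ)| / N) = 2 * |(j : ℝ)| / N := by
    field_simp
  have h7 : 1 / 5 ≤ 2 * |(j : ℝ)| / N := by
    rw [le_div_iff₀ hN]; linarith
  rw [h4]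
  have := le_abs_self (Real.sin (Real.pi * |(j : ℝ)| / N))
  linarith

/-- The shear `(a, b) ↦ (a, b - 4 a)`. -/
def shear (N : ℕ) : ZMod N × ZMod N ≃ ZMod N × ZMod N where
  toFun v := (v.1, v.2 - 4 * v.1)
  invFun v := (v.1, v.2 + 4 * v.1)
  left_inv v := by simp
  right_inv v := by simp

/-- The rotation `(a, b) ↦ (b, -a)`. -/
def rotation (N : ℕ) : ZMod N × ZMod N ≃ ZMod N × ZMod N where
  toFun v := (v.2, -v.1)
  invFun v := (-v.2, v.1)
  left_inv v := by simp
  right_inv v := by simp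

/-- No wraparound occurs, because `|b| + 4 |a| < N/2`. This is what fixes the threshold `N/10`. -/
theorem valMinAbs_add_four_mul {a b : ZMod N} (ha : 10 * a.valMinAbs.natAbs < N)
    (hb : 10 * b.valMinAbs.natAbs < N) :
    (b + 4 * a).valMinAbs = b.valMinAbs + 4 * a.valMinAbs := by
  rw [ZMod.valMinAbs_spec]
  refine ⟨by simp, ?_⟩
  rw [Set.mem_Ioc]
  omega

theorem valMinAbs_sub_four_mul {a b : ZMod N} (ha : 10 * a.valMinAbs.natAbs < N)
    (hb : 10 * b.valMinAbs.natAbs < N) :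
    (b - 4 * a).valMinAbs = b.valMinAbs - 4 * a.valMinAbs := by
  rw [ZMod.valMinAbs_spec]
  refine ⟨by simp, ?_⟩
  rw [Set.mem_Ioc]
  omega

/-- A function on the discrete torus that vanishes at the origin, is nearly invariant under a shear
and a rotation and is concentrated near the line `a = 0` is small. -/
theorem sum_sq_le_of_almost_invariant (φ : ZMod N × ZMod N → ℝ) (h0 : φ 0 = 0) {e : ℝ}
    (hmul : ∑ v, ‖ZMod.stdAddChar v.1 - 1‖ ^ 2 * φ v ^ 2 ≤ e)
    (hshear : ∑ v, (φ (shear N v) - φ v) ^ 2 ≤ e)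
    (hrot : ∑ v, (φ (rotation N v) - φ v) ^ 2 ≤ e) :
    ∑ v, φ v ^ 2 ≤ 600 * e := by
  set M := ∑ v, φ v ^ 2 with hM
  set ε := M / 40 + 41 * e with hε
  have hshear' : ∑ v, (φ ((shear N).symm v) - φ v) ^ 2 ≤ e := by
    refine le_trans (le_of_eq ?_) hshear
    rw [← (shear N).sum_comp]
    refine Finset.sum_congr rfl fun v _ => ?_
    rw [Equiv.symm_apply_apply]; ring
  have mono : ∀ {P Q : Finset (ZMod N × ZMod N)}, P ⊆ Q → ∑ v ∈ P, φ v ^ 2 ≤ ∑ v ∈ Q, φ v ^ 2 :=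
    fun h => Finset.sum_le_sum_of_subset_of_nonneg h fun v _ _ => sq_nonneg _
  -- `A` and `B` consist of the points whose first or second coordinate is far from `0`; the
  -- character controls `A`, and the rotation sends `B` into `A`. `L` and `L'` are wedges around the
  -- two axes near the origin, and the rotation sends `L'` into `L`. The four sets cover everything
  -- except the origin.
  let A : Finset (ZMod N × ZMod N) := {v | N ≤ 10 * v.1.valMinAbs.natAbs}
  let B : Finset (ZMod N × ZMod N) := {v | N ≤ 10 * v.2.valMinAbs.natAbs}
  let L : Finset (ZMod N × ZMod N) := {v | 10 * v.1.valMinAbs.natAbs < N ∧ 10 * v.2.valMinAbs.natAbs < N ∧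
    v.2.valMinAbs.natAbs ≤ v.1.valMinAbs.natAbs ∧ v.1.valMinAbs ≠ 0}
  let L' : Finset (ZMod N × ZMod N) := {v | 10 * v.1.valMinAbs.natAbs < N ∧ 10 * v.2.valMinAbs.natAbs < N ∧
    v.1.valMinAbs.natAbs ≤ v.2.valMinAbs.natAbs ∧ v.2.valMinAbs ≠ 0}
  have hA : ∑ v ∈ A, φ v ^ 2 ≤ 25 / 4 * e := by
    have h1 : ∑ v ∈ A, 4 / 25 * φ v ^ 2 ≤ e := by
      refine le_trans (Finset.sum_le_sum fun v hv => ?_) ((Finset.sum_le_sum_of_subset_of_nonneg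
        (Finset.subset_univ A) fun v _ _ => ?_).trans hmul)
      · have := two_fifths_le_norm_stdAddChar_sub_one (Finset.mem_filter.mp hv).2
        have h2 : (4 / 25 : ℝ) ≤ ‖ZMod.stdAddChar v.1 - 1‖ ^ 2 := by nlinarith
        gcongr
      · positivity
    rw [← Finset.mul_sum] at h1
    linarith
  have hB : ∑ v ∈ B, φ v ^ 2 ≤ 25 / 4 * e + ε := by
    refine (sum_sq_le_sum_map_add φ _ hrot B).trans ?_
    gcongr
    refine (mono ?_).trans hA
    intro v hv
    obtain ⟨w, hw, rfl⟩ := Finset.mem_map.mp hv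
    simpa [A, B, rotation] using hw
  have hL' : ∑ v ∈ L', φ v ^ 2 ≤ ∑ v ∈ L, φ v ^ 2 + ε := by
    refine (sum_sq_le_sum_map_add φ _ hrot L').trans ?_
    gcongr ?_ + _
    refine mono ?_
    intro v hv
    obtain ⟨w, hw, rfl⟩ := Finset.mem_map.mp hv
    simp only [L, L', rotation, Finset.mem_filter, Finset.mem_univ, true_and,
      Equiv.coe_toEmbedding, Equiv.coe_fn_mk, ZMod.natAbs_valMinAbs_neg] at hw ⊢
    tauto
  -- A common point would give `b - 4a = b' + 4a` with `|b|, |b'| ≤ |a|` and `a ≠ 0`, so `8 |a| ≤ 2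
  -- |a|`.
  have hdisj : Disjoint (L.map (shear N).toEmbedding) (L.map (shear N).symm.toEmbedding) := by
    rw [Finset.disjoint_left]
    intro v hv hv'
    obtain ⟨w, hw, rfl⟩ := Finset.mem_map.mp hv
    obtain ⟨w', hw', h⟩ := Finset.mem_map.mp hv'
    simp only [L, shear, Finset.mem_filter, Finset.mem_univ, true_and,
      Equiv.coe_toEmbedding, Equiv.coe_fn_mk, Equiv.coe_fn_symm_mk, Prod.mk.injEq] at hw hw' h
    obtain ⟨h1, h2⟩ := h
    have h3 := valMinAbs_sub_four_mul hw.1 hw.2.1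
    rw [← h2, valMinAbs_add_four_mul hw'.1 hw'.2.1, h1] at h3
    rw [h1] at hw'
    have h4 := hw.2.2.1
    have h5 := hw'.2.2.1
    have h6 := hw.2.2.2
    omega
  -- `|b ± 4a| ≥ 3 |a| > |a|`: both shears push `L` out of its wedge. Two disjoint almost-copies of
  -- the mass of `L` therefore lie in `L' ∪ A ∪ B`, although `L'` carries hardly more mass than `L`.
  have hsub : L.map (shear N).toEmbedding ∪ L.map (shear N).symm.toEmbedding ⊆ L' ∪ (A ∪ B) := by
    intro v hv
    have hv1 : v.1.valMinAbs.natAbs < v.2.valMinAbs.natAbs := by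
      rcases Finset.mem_union.mp hv with hv | hv
      all_goals
        obtain ⟨w, hw, rfl⟩ := Finset.mem_map.mp hv
        simp only [L, shear, Finset.mem_filter, Finset.mem_univ, true_and,
          Equiv.coe_toEmbedding, Equiv.coe_fn_mk, Equiv.coe_fn_symm_mk] at hw ⊢
        have h4 := hw.2.2.1
        have h6 := hw.2.2.2
        first
        | rw [valMinAbs_sub_four_mul hw.1 hw.2.1]; omega
        | rw [valMinAbs_add_four_mul hw.1 hw.2.1]; omega
    simp only [L', A, B, Finset.mem_union, Finset.mem_filter, Finset.mem_univ, true_and]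
    omega
  have hsum : ∀ P Q : Finset (ZMod N × ZMod N),
      ∑ v ∈ P ∪ Q, φ v ^ 2 ≤ ∑ v ∈ P, φ v ^ 2 + ∑ v ∈ Q, φ v ^ 2 := by
    intro P Q
    have h := Finset.sum_union_inter (s₁ := P) (s₂ := Q) (f := fun v => φ v ^ 2)
    have : 0 ≤ ∑ v ∈ P ∩ Q, φ v ^ 2 := Finset.sum_nonneg fun v _ => sq_nonneg _
    linarith
  have hcover : M ≤ ∑ v ∈ L ∪ (L' ∪ (A ∪ B)), φ v ^ 2 := by
    refine le_of_eq (Finset.sum_subset (Finset.subset_univ _) fun v _ hv => ?_).symm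
    have hv0 : v = 0 := by
      simp only [L, L', A, B, Finset.mem_union, Finset.mem_filter, Finset.mem_univ,
        true_and] at hv
      have h1 : v.1.valMinAbs = 0 ∧ v.2.valMinAbs = 0 := by omega
      exact Prod.ext ((ZMod.valMinAbs_eq_zero _).mp h1.1) ((ZMod.valMinAbs_eq_zero _).mp h1.2)
    rw [hv0, h0]; simp
  -- With `A`, `B`, `L`, `L'` also denoting masses, `2L ≤ L' + A + B + 2ε` and `L' ≤ L + ε` give `L
  -- ≤ A + B + 3ε`. Hence `M ≤ 3(A + B) + 7ε ≤ 37.5 e + 10ε`, and `10ε = M/4 + 410 e`, so `M ≤ 600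
  -- e`.
  have h1 := sum_sq_le_sum_map_add φ _ hshear L
  have h2 := sum_sq_le_sum_map_add φ _ hshear' L
  have h3 := mono hsub
  rw [Finset.sum_union hdisj] at h3
  have h4 := hsum L' (A ∪ B)
  have h5 := hsum A B
  have h6 := hsum L (L' ∪ (A ∪ B))
  have h7 : 0 ≤ e := le_trans (Finset.sum_nonneg fun v _ => sq_nonneg _) hrot
  linarith

end QuantumExpander

/-! ### Weyl coefficients and an explicit quantum expander. -/

section QuantumExpander

variable {N : ℕ} [NeZero N]

theorem conj_stdAddChar (a : ZMod N) :
    starRingEnd ℂ (ZMod.stdAddChar a) = ZMod.stdAddChar (-a) :=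
  (AddChar.map_neg_eq_conj _ _).symm

theorem norm_stdAddChar (a : ZMod N) : ‖(ZMod.stdAddChar a : ℂ)‖ = 1 :=
  AddChar.norm_apply _ _

theorem sum_stdAddChar_mul (b : ZMod N) :
    ∑ x : ZMod N, (ZMod.stdAddChar (x * b) : ℂ) = if b = 0 then (N : ℂ) else 0 := by
  rw [AddChar.sum_mulShift b (ZMod.isPrimitive_stdAddChar N), ZMod.card]
  simp

/-- The unitary matrix of the discrete Fourier transform. -/
def fourierMatrix (N : ℕ) [NeZero N] : Matrix (ZMod N) (ZMod N) ℂ :=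
  Matrix.of fun x y => ((√N : ℝ) : ℂ)⁻¹ * ZMod.stdAddChar (x * y)

theorem ofReal_sqrt_mul_self (N : ℕ) : ((√N : ℝ) : ℂ) * ((√N : ℝ) : ℂ) = N := by
  rw [← Complex.ofReal_mul, Real.mul_self_sqrt (Nat.cast_nonneg N)]
  simp

theorem fourierMatrix_apply (x y : ZMod N) :
    fourierMatrix N x y = ((√N : ℝ) : ℂ)⁻¹ * ZMod.stdAddChar (x * y) := rfl

theorem fourierMatrix_conjTranspose_apply (x y : ZMod N) :
    (fourierMatrix N).conjTranspose x y = ((√N : ℝ) : ℂ)⁻¹ * ZMod.stdAddChar (-(y * x)) := by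
  rw [Matrix.conjTranspose_apply, fourierMatrix_apply, ← starRingEnd_apply, map_mul, map_inv₀,
    conj_stdAddChar, Complex.conj_ofReal]

theorem fourierMatrix_mul_conjTranspose :
    fourierMatrix N * (fourierMatrix N).conjTranspose = 1 := by
  ext x y
  have hN : (N : ℂ) ≠ 0 := by exact_mod_cast NeZero.ne N
  simp only [Matrix.mul_apply, fourierMatrix_conjTranspose_apply, fourierMatrix_apply]
  have h : ∀ t : ZMod N, ((√N : ℝ) : ℂ)⁻¹ * ZMod.stdAddChar (x * t) *
      (((√N : ℝ) : ℂ)⁻¹ * ZMod.stdAddChar (-(y * t))) =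
      (N : ℂ)⁻¹ * ZMod.stdAddChar (t * (x - y)) := by
    intro t
    rw [show t * (x - y) = x * t + -(y * t) by ring, AddChar.map_add_eq_mul,
      ← ofReal_sqrt_mul_self, mul_inv]
    ring
  simp only [h]
  rw [← Finset.mul_sum, sum_stdAddChar_mul, Matrix.one_apply]
  simp only [sub_eq_zero]
  split_ifs
  · exact inv_mul_cancel₀ hN
  · simp

theorem fourierMatrix_conjTranspose_mul :
    (fourierMatrix N).conjTranspose * fourierMatrix N = 1 :=
  mul_eq_one_comm.mp fourierMatrix_mul_conjTranspose

/-- The coefficients of a matrix in the basis of Weyl operators. -/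
def weylCoeff (A : Matrix (ZMod N) (ZMod N) ℂ) (v : ZMod N × ZMod N) : ℂ :=
  (N : ℂ)⁻¹ * ∑ x, ZMod.stdAddChar (-(v.2 * x)) * A (x + v.1) x

theorem weylCoeff_sub (A B : Matrix (ZMod N) (ZMod N) ℂ) (v : ZMod N × ZMod N) :
    weylCoeff (A - B) v = weylCoeff A v - weylCoeff B v := by
  simp [weylCoeff, mul_sub]

/-- Parseval on each cyclic diagonal: the matrix `B` in the proof has the diagonals of `A` as
columns, and the coefficients are its Fourier transform, up to the factor `N^{-1/2}`. -/
theorem sum_norm_weylCoeff_sq (A : Matrix (ZMod N) (ZMod N) ℂ) :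
    ∑ v, ‖weylCoeff A v‖ ^ 2 = (N : ℝ)⁻¹ * hsSq A := by
  have hN : (0 : ℝ) < N := by exact_mod_cast Nat.pos_of_ne_zero (NeZero.ne N)
  set B : Matrix (ZMod N) (ZMod N) ℂ := Matrix.of fun x a => A (x + a) x with hB
  have h1 : hsSq B = hsSq A := by
    rw [hsSq_eq_sum, hsSq_eq_sum, Finset.sum_comm (f := fun i j => ‖A i j‖ ^ 2)]
    refine Finset.sum_congr rfl fun x _ => ?_
    exact Equiv.sum_comp (Equiv.addLeft x) (fun y => ‖A y x‖ ^ 2)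
  have h2 : ∀ a b, weylCoeff A (a, b) =
      ((√N : ℝ) : ℂ)⁻¹ * ((fourierMatrix N).conjTranspose * B) b a := by
    intro a b
    simp only [weylCoeff, Matrix.mul_apply, fourierMatrix_conjTranspose_apply, hB,
      Matrix.of_apply, Finset.mul_sum]
    refine Finset.sum_congr rfl fun x _ => ?_
    rw [← ofReal_sqrt_mul_self, mul_inv, mul_comm b x]
    ring
  rw [Fintype.sum_prod_type, Finset.sum_comm, ← h1,
    ← hsSq_mul_left (U := (fourierMatrix N).conjTranspose)
      (by simpa using fourierMatrix_mul_conjTranspose) B, hsSq_eq_sum, Finset.mul_sum]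
  refine Finset.sum_congr rfl fun b _ => ?_
  rw [Finset.mul_sum]
  refine Finset.sum_congr rfl fun a _ => ?_
  rw [h2, norm_mul, mul_pow, norm_inv, Complex.norm_real, Real.norm_of_nonneg (Real.sqrt_nonneg _),
    inv_pow, Real.sq_sqrt hN.le]

theorem weylCoeff_diagonal_conj (g : ZMod N → ZMod N) (A : Matrix (ZMod N) (ZMod N) ℂ)
    (v : ZMod N × ZMod N) :
    weylCoeff (Matrix.diagonal (fun x => (ZMod.stdAddChar (g x) : ℂ)) * A *
      (Matrix.diagonal (fun x => (ZMod.stdAddChar (g x) : ℂ))).conjTranspose) v =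
    (N : ℂ)⁻¹ * ∑ x, ZMod.stdAddChar (g (x + v.1) - g x - v.2 * x) * A (x + v.1) x := by
  unfold weylCoeff
  congr 1
  refine Finset.sum_congr rfl fun x _ => ?_
  rw [Matrix.diagonal_conjTranspose, Matrix.mul_diagonal, Matrix.diagonal_mul, Pi.star_apply,
    ← starRingEnd_apply, conj_stdAddChar, sub_eq_add_neg, sub_eq_add_neg, AddChar.map_add_eq_mul,
    AddChar.map_add_eq_mul]
  ring

/-- The first of three Clifford relations: conjugation by each expander matrix permutes the Weyl
coefficients up to phases. Here the permutation is trivial and the phase is what detects `v.1 ≠ 0`.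
-/
theorem weylCoeff_clock_conj (A : Matrix (ZMod N) (ZMod N) ℂ) (v : ZMod N × ZMod N) :
    weylCoeff (Matrix.diagonal (fun x => (ZMod.stdAddChar x : ℂ)) * A *
      (Matrix.diagonal (fun x => (ZMod.stdAddChar x : ℂ))).conjTranspose) v =
    ZMod.stdAddChar v.1 * weylCoeff A v := by
  rw [weylCoeff_diagonal_conj (fun x => x), weylCoeff, mul_left_comm (ZMod.stdAddChar v.1 : ℂ)]
  congr 1
  rw [Finset.mul_sum]
  refine Finset.sum_congr rfl fun x _ => ?_
  rw [show x + v.1 - x - v.2 * x = v.1 + -(v.2 * x) by ring, AddChar.map_add_eq_mul, mul_assoc]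

/-- `2(x + a)² - 2x²` is affine in `x` with slope `4a`, which shifts the frequency by `4a`. -/
theorem weylCoeff_quadratic_conj (A : Matrix (ZMod N) (ZMod N) ℂ) (v : ZMod N × ZMod N) :
    weylCoeff (Matrix.diagonal (fun x => (ZMod.stdAddChar (2 * x ^ 2) : ℂ)) * A *
      (Matrix.diagonal (fun x => (ZMod.stdAddChar (2 * x ^ 2) : ℂ))).conjTranspose) v =
    ZMod.stdAddChar (2 * v.1 ^ 2) * weylCoeff A (shear N v) := by
  rw [weylCoeff_diagonal_conj (fun x => 2 * x ^ 2), weylCoeff,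
    mul_left_comm (ZMod.stdAddChar (2 * v.1 ^ 2) : ℂ)]
  congr 1
  rw [Finset.mul_sum]
  refine Finset.sum_congr rfl fun x _ => ?_
  rw [show 2 * (x + v.1) ^ 2 - 2 * x ^ 2 - v.2 * x = 2 * v.1 ^ 2 + -((v.2 - 4 * v.1) * x) by ring,
    AddChar.map_add_eq_mul, mul_assoc]
  rfl

/-- The Fourier transform exchanges translations and modulations. -/
theorem weylCoeff_fourier_conj (A : Matrix (ZMod N) (ZMod N) ℂ) (v : ZMod N × ZMod N) :
    weylCoeff (fourierMatrix N * A * (fourierMatrix N).conjTranspose) v =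
    ZMod.stdAddChar (v.1 * v.2) * weylCoeff A (rotation N v) := by
  have hN : (N : ℂ) ≠ 0 := by exact_mod_cast NeZero.ne N
  have h1 : ∀ x : ZMod N, ZMod.stdAddChar (-(v.2 * x)) *
      (fourierMatrix N * A * (fourierMatrix N).conjTranspose) (x + v.1) x =
      ∑ t, ∑ s, (N : ℂ)⁻¹ * (ZMod.stdAddChar (v.1 * s) * A s t) *
        ZMod.stdAddChar (x * (s - (t + v.2))) := by
    intro x
    simp only [Matrix.mul_apply, fourierMatrix_conjTranspose_apply, fourierMatrix_apply,
      Finset.sum_mul, Finset.mul_sum]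
    refine Finset.sum_congr rfl fun t _ => Finset.sum_congr rfl fun s _ => ?_
    have h2 : (ZMod.stdAddChar (v.1 * s) : ℂ) * ZMod.stdAddChar (x * (s - (t + v.2))) =
        ZMod.stdAddChar (-(v.2 * x)) * ZMod.stdAddChar ((x + v.1) * s) *
          ZMod.stdAddChar (-(x * t)) := by
      rw [← AddChar.map_add_eq_mul, ← AddChar.map_add_eq_mul, ← AddChar.map_add_eq_mul]
      congr 1
      ring
    rw [← ofReal_sqrt_mul_self, mul_inv]
    linear_combination -(((√N : ℝ) : ℂ)⁻¹ * ((√N : ℝ) : ℂ)⁻¹ * A s t) * h2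
  have h3 : ∑ x : ZMod N, ZMod.stdAddChar (-(v.2 * x)) *
      (fourierMatrix N * A * (fourierMatrix N).conjTranspose) (x + v.1) x =
      ∑ t, ZMod.stdAddChar (v.1 * (t + v.2)) * A (t + v.2) t := by
    simp only [h1]
    rw [Finset.sum_comm]
    refine Finset.sum_congr rfl fun t _ => ?_
    rw [Finset.sum_comm]
    simp only [← Finset.mul_sum, sum_stdAddChar_mul, sub_eq_zero]
    rw [Finset.sum_eq_single (t + v.2) (by intro b _ hb; simp [hb]) (by simp)]
    simp only [if_true]
    field_simp
  rw [weylCoeff, h3, weylCoeff, mul_left_comm (ZMod.stdAddChar (v.1 * v.2) : ℂ)]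
  congr 1
  rw [Finset.mul_sum]
  refine Finset.sum_congr rfl fun x _ => ?_
  rw [← mul_assoc, ← AddChar.map_add_eq_mul]
  simp only [rotation, Equiv.coe_fn_mk]
  congr 2
  ring

theorem hsSq_commutator {p : Type*} [Fintype p] [DecidableEq p] {w : Matrix p p ℂ}
    (hw : w.conjTranspose * w = 1) (A : Matrix p p ℂ) :
    hsSq (w * A - A * w) = hsSq (w * A * w.conjTranspose - A) := by
  rw [← hsSq_mul_right (U := w.conjTranspose) (by simpa using hw) (w * A - A * w),
    Matrix.sub_mul, Matrix.mul_assoc A, mul_eq_one_comm.mp hw, Matrix.mul_one]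

theorem diagonal_stdAddChar_unitary (g : ZMod N → ZMod N) :
    (Matrix.diagonal (fun x => (ZMod.stdAddChar (g x) : ℂ))).conjTranspose *
      Matrix.diagonal (fun x => (ZMod.stdAddChar (g x) : ℂ)) = 1 := by
  rw [Matrix.diagonal_conjTranspose, Matrix.diagonal_mul_diagonal, ← Matrix.diagonal_one]
  congr 1
  ext x
  rw [Pi.star_apply, ← starRingEnd_apply, Complex.conj_mul', norm_stdAddChar]
  simp

/-- The clock matrix, the quadratic phase matrix and the Fourier matrix form a quantum expander. -/
def expander (N : ℕ) [NeZero N] : Fin 3 → Matrix (ZMod N) (ZMod N) ℂ :=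
  ![Matrix.diagonal (fun x => (ZMod.stdAddChar x : ℂ)),
    Matrix.diagonal (fun x => (ZMod.stdAddChar (2 * x ^ 2) : ℂ)), fourierMatrix N]

theorem expander_unitary (k : Fin 3) : (expander N k).conjTranspose * expander N k = 1 := by
  fin_cases k
  · exact diagonal_stdAddChar_unitary fun x => x
  · exact diagonal_stdAddChar_unitary fun x => 2 * x ^ 2
  · exact fourierMatrix_conjTranspose_mul

theorem weylCoeff_one (v : ZMod N × ZMod N) :
    weylCoeff (1 : Matrix (ZMod N) (ZMod N) ℂ) v = if v = 0 then 1 else 0 := by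
  have hN : (N : ℂ) ≠ 0 := by exact_mod_cast NeZero.ne N
  obtain ⟨a, b⟩ := v
  by_cases ha : a = 0
  · subst ha
    have h := sum_stdAddChar_mul (-b)
    have h' : ∀ x : ZMod N, (ZMod.stdAddChar (-(b * x)) : ℂ) *
        (1 : Matrix (ZMod N) (ZMod N) ℂ) (x + 0) x = ZMod.stdAddChar (x * -b) := by
      intro x
      rw [add_zero, Matrix.one_apply_eq, mul_one, show -(b * x) = x * -b by ring]
    simp only [weylCoeff, h', h, Prod.mk_eq_zero, true_and, neg_eq_zero]
    split_ifs <;> simp [hN]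
  · have : (a, b) ≠ 0 := by simp [ha]
    simp [weylCoeff, this, ha]

/-- Take `c` to be the normalized trace, the Weyl coefficient at the origin. Removing it changes no
commutator, and the moduli of the remaining coefficients satisfy the hypotheses of
`sum_sq_le_of_almost_invariant`. -/
theorem expander_gap (A : Matrix (ZMod N) (ZMod N) ℂ) :
    ∃ c : ℂ, hsSq (A - c • 1) ≤
      600 * ∑ k, hsSq (expander N k * A - A * expander N k) := by
  have hN : (0 : ℝ) < N := by exact_mod_cast Nat.pos_of_ne_zero (NeZero.ne N)
  refine ⟨weylCoeff A 0, ?_⟩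
  set B := A - weylCoeff A 0 • (1 : Matrix (ZMod N) (ZMod N) ℂ) with hB
  have hcomm : ∀ k, hsSq (expander N k * A - A * expander N k) =
      hsSq (expander N k * B * (expander N k).conjTranspose - B) := by
    intro k
    rw [← hsSq_commutator (expander_unitary k)]
    congr 1
    simp [hB, mul_sub, sub_mul]
  simp only [hcomm]
  have hB0 : weylCoeff B 0 = 0 := by
    have : weylCoeff (weylCoeff A 0 • (1 : Matrix (ZMod N) (ZMod N) ℂ)) 0 =
        weylCoeff A 0 * weylCoeff (1 : Matrix (ZMod N) (ZMod N) ℂ) 0 := by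
      simp only [weylCoeff, Matrix.smul_apply, smul_eq_mul, Finset.mul_sum]
      refine Finset.sum_congr rfl fun x _ => by ring
    rw [hB, weylCoeff_sub, this, weylCoeff_one]
    simp
  set e := ∑ k, hsSq (expander N k * B * (expander N k).conjTranspose - B) with he
  have hk : ∀ k, ∑ v, ‖weylCoeff (expander N k * B * (expander N k).conjTranspose) v -
      weylCoeff B v‖ ^ 2 ≤ (N : ℝ)⁻¹ * e := by
    intro k
    simp only [← weylCoeff_sub]
    rw [sum_norm_weylCoeff_sq]
    gcongr
    exact Finset.single_le_sum
      (f := fun k => hsSq (expander N k * B * (expander N k).conjTranspose - B))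
      (fun k _ => hsSq_nonneg _) (Finset.mem_univ k)
  have key := sum_sq_le_of_almost_invariant (fun v => ‖weylCoeff B v‖) (by simp [hB0])
    (e := (N : ℝ)⁻¹ * e) ?_ ?_ ?_
  · rw [sum_norm_weylCoeff_sq, mul_left_comm] at key
    exact le_of_mul_le_mul_left key (by positivity)
  · refine le_trans (le_of_eq (Finset.sum_congr rfl fun v _ => ?_)) (hk 0)
    rw [show expander N 0 = Matrix.diagonal (fun x => (ZMod.stdAddChar x : ℂ)) from rfl,
      weylCoeff_clock_conj, ← mul_pow, ← norm_mul, sub_mul, one_mul]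
  · refine le_trans (Finset.sum_le_sum fun v _ => ?_) (hk 1)
    rw [show expander N 1 = Matrix.diagonal (fun x => (ZMod.stdAddChar (2 * x ^ 2) : ℂ)) from rfl,
      weylCoeff_quadratic_conj, ← sq_abs]
    gcongr
    -- The phases disappear when passing to moduli, by the reverse triangle inequality.
    have h := abs_norm_sub_norm_le (ZMod.stdAddChar (2 * v.1 ^ 2) * weylCoeff B (shear N v))
      (weylCoeff B v)
    rwa [norm_mul, norm_stdAddChar, one_mul] at h
  · refine le_trans (Finset.sum_le_sum fun v _ => ?_) (hk 2)
    rw [show expander N 2 = fourierMatrix N from rfl, weylCoeff_fourier_conj, ← sq_abs]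
    gcongr
    have h := abs_norm_sub_norm_le (ZMod.stdAddChar (v.1 * v.2) * weylCoeff B (rotation N v))
      (weylCoeff B v)
    rwa [norm_mul, norm_stdAddChar, one_mul] at h

theorem hsSq_submatrix_equiv {p q : Type*} [Fintype p] [Fintype q] (e : q ≃ p)
    (A : Matrix p p ℂ) : hsSq (A.submatrix e e) = hsSq A :=
  (e.prodCongr e).sum_comp fun c => ‖A c.1 c.2‖ ^ 2

/-- Quantum expanders with three unitaries and a uniform spectral gap exist in all dimensions. -/
theorem exists_expander (N : ℕ) (hN : 1 ≤ N) :
    ∃ w : Fin 3 → Matrix (Fin N) (Fin N) ℂ, (∀ k, (w k).conjTranspose * w k = 1) ∧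
      ∀ A : Matrix (Fin N) (Fin N) ℂ, ∃ c : ℂ,
        hsSq (A - c • 1) ≤ 600 * ∑ k, hsSq (w k * A - A * w k) := by
  have : NeZero N := ⟨by omega⟩
  let e : Fin N ≃ ZMod N := Fintype.equivOfCardEq (by simp)
  refine ⟨fun k => (expander N k).submatrix e e, fun k => ?_, fun A => ?_⟩
  · rw [Matrix.conjTranspose_submatrix, Matrix.submatrix_mul_equiv, expander_unitary,
      Matrix.submatrix_one_equiv]
  · obtain ⟨c, hc⟩ := expander_gap (A.submatrix e.symm e.symm)
    refine ⟨c, ?_⟩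
    have hA : A = (A.submatrix e.symm e.symm).submatrix e e := by simp
    have h1 : A - c • 1 = (A.submatrix e.symm e.symm - c • 1).submatrix e e := by
      ext i j; simp [Matrix.one_apply]
    rw [h1, hsSq_submatrix_equiv]
    refine hc.trans (le_of_eq ?_)
    congr 1
    refine Finset.sum_congr rfl fun k _ => ?_
    rw [← hsSq_submatrix_equiv e]
    congr 1
    conv_rhs => rw [hA]
    rw [Matrix.submatrix_mul_equiv, Matrix.submatrix_mul_equiv]
    rfl

end QuantumExpander

/-! ### Moments of random sign matrices. -/

section RandomSigns

variable {α : Type*} [Fintype α] [DecidableEq α]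

/-- The sign `±1` given by a truth value. -/
def boolSign (b : Bool) : ℝ := if b then 1 else -1

theorem boolSign_not (b : Bool) : boolSign (!b) = -boolSign b := by
  cases b <;> simp [boolSign]

theorem boolSign_sq (b : Bool) : boolSign b ^ 2 = 1 := by
  cases b <;> simp [boolSign]

/-- Subgaussian bound: independence factors the sum, and `cosh a ≤ exp(a²/2)`. -/
theorem sum_exp_boolSign_le (a : α → ℝ) :
    ∑ ω : α → Bool, Real.exp (∑ i, boolSign (ω i) * a i) ≤
      2 ^ Fintype.card α * Real.exp ((∑ i, a i ^ 2) / 2) := by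
  have h : ∀ i, ∑ b : Bool, Real.exp (boolSign b * a i) ≤ 2 * Real.exp (a i ^ 2 / 2) := by
    intro i
    have h1 := Real.cosh_le_exp_half_sq (a i)
    rw [Real.cosh_eq] at h1
    simp [boolSign]
    linarith
  calc ∑ ω : α → Bool, Real.exp (∑ i, boolSign (ω i) * a i)
      = ∏ i, ∑ b : Bool, Real.exp (boolSign b * a i) := by
        rw [Finset.prod_univ_sum, Fintype.piFinset_univ]
        exact Finset.sum_congr rfl fun ω _ => Real.exp_sum _ _
    _ ≤ ∏ i, (2 * Real.exp (a i ^ 2 / 2)) :=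
        Finset.prod_le_prod (fun i _ => Finset.sum_nonneg fun b _ => (Real.exp_pos _).le)
          fun i _ => h i
    _ = _ := by
        rw [Finset.prod_mul_distrib, ← Real.exp_sum, Finset.sum_div]
        simp

/-- Flipping the sign at `i` is an involution that negates every summand. -/
theorem sum_boolSign_mul_eq_zero (i : α) (f : (α → Bool) → ℝ)
    (hf : ∀ ω b, f (Function.update ω i b) = f ω) :
    ∑ ω : α → Bool, boolSign (ω i) * f ω = 0 := by
  let e : (α → Bool) ≃ (α → Bool) :=
    { toFun := fun ω => Function.update ω i (!ω i)
      invFun := fun ω => Function.update ω i (!ω i)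
      left_inv := fun ω => by simp
      right_inv := fun ω => by simp }
  have h := e.sum_comp fun ω => boolSign (ω i) * f ω
  have h1 : ∀ ω, boolSign (e ω i) * f (e ω) = -(boolSign (ω i) * f ω) := by
    intro ω
    have h2 : e ω = Function.update ω i (!ω i) := rfl
    rw [h2, hf, Function.update_self, boolSign_not]
    ring
  simp only [h1, Finset.sum_neg_distrib] at h
  linarith

/-- Jensen's inequality for `exp`, by its tangent line at `m`. -/
theorem card_mul_exp_le_sum_exp {β : Type*} [Fintype β] (x : β → ℝ) {m : ℝ}
    (h : Fintype.card β * m ≤ ∑ i, x i) :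
    Fintype.card β * Real.exp m ≤ ∑ i, Real.exp (x i) := by
  have h1 : ∀ i, Real.exp m * (1 + (x i - m)) ≤ Real.exp (x i) := by
    intro i
    have h2 := Real.add_one_le_exp (x i - m)
    calc Real.exp m * (1 + (x i - m)) ≤ Real.exp m * Real.exp (x i - m) := by
          gcongr; linarith
      _ = _ := by rw [← Real.exp_add]; congr 1; ring
  refine le_trans ?_ (Finset.sum_le_sum fun i _ => h1 i)
  rw [← Finset.mul_sum, Finset.sum_add_distrib, Finset.sum_sub_distrib]
  simp only [Finset.sum_const, Finset.card_univ, nsmul_eq_mul, mul_one]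
  have := Real.exp_pos m
  nlinarith

/-- The sign matrix in position `j` of a family of sign matrices. -/
def signMatrix {J : Type*} {N : ℕ} (ω : J × Fin N × Fin N → Bool) (j : J) :
    Matrix (Fin N) (Fin N) ℂ :=
  Matrix.of fun a b => (boolSign (ω (j, a, b)) : ℂ)

variable {J : Type*} {N : ℕ}

theorem hsSq_signMatrix (ω : J × Fin N × Fin N → Bool) (j : J) :
    hsSq (signMatrix ω j) = (N : ℝ) ^ 2 := by
  rw [hsSq_eq_sum]
  have : ∀ a b, ‖signMatrix ω j a b‖ ^ 2 = 1 := by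
    intro a b
    rw [signMatrix, Matrix.of_apply, Complex.norm_real, Real.norm_eq_abs, sq_abs, boolSign_sq]
  simp [this, sq]

theorem hsSq_signMatrix_mul (ω : J × Fin N × Fin N → Bool) (j : J) :
    hsSq (signMatrix ω j * (signMatrix ω j).conjTranspose) =
      ∑ a, ∑ c, ∑ b, ∑ d, boolSign (ω (j, a, b)) * (boolSign (ω (j, c, b)) *
        boolSign (ω (j, a, d)) * boolSign (ω (j, c, d))) := by
  rw [hsSq_eq_sum]
  refine Finset.sum_congr rfl fun a _ => Finset.sum_congr rfl fun c _ => ?_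
  have h : (signMatrix ω j * (signMatrix ω j).conjTranspose) a c =
      ((∑ b, boolSign (ω (j, a, b)) * boolSign (ω (j, c, b)) : ℝ) : ℂ) := by
    rw [Matrix.mul_apply]
    push_cast
    refine Finset.sum_congr rfl fun b _ => ?_
    simp [signMatrix]
  rw [h, Complex.norm_real, Real.norm_eq_abs, sq_abs, sq, Finset.sum_mul_sum]
  refine Finset.sum_congr rfl fun b _ => Finset.sum_congr rfl fun d _ => by ring

variable [Fintype J] [DecidableEq J]

/-- If `a ≠ c` and `b ≠ d`, the sign at `(a, b)` occurs only once and the mean vanishes. At most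
`2N³` quadruples have `a = c` or `b = d`, and each contributes at most `1`. -/
theorem sum_hsSq_signMatrix_mul_le (j : J) :
    ∑ ω : J × Fin N × Fin N → Bool, hsSq (signMatrix ω j * (signMatrix ω j).conjTranspose) ≤
      Fintype.card (J × Fin N × Fin N → Bool) * (2 * (N : ℝ) ^ 3) := by
  set Q := Fintype.card (J × Fin N × Fin N → Bool) with hQ
  have key : ∀ a c b d : Fin N, ∑ ω : J × Fin N × Fin N → Bool, boolSign (ω (j, a, b)) *
      (boolSign (ω (j, c, b)) * boolSign (ω (j, a, d)) * boolSign (ω (j, c, d))) ≤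
      Q * ((if a = c then (1 : ℝ) else 0) + if b = d then 1 else 0) := by
    intro a c b d
    by_cases h : a ≠ c ∧ b ≠ d
    · rw [sum_boolSign_mul_eq_zero]
      · positivity
      · intro ω t
        rw [Function.update_of_ne, Function.update_of_ne, Function.update_of_ne] <;>
        · simp only [ne_eq, Prod.mk.injEq, true_and, not_and]
          tauto
    · have h1 : (1 : ℝ) ≤ (if a = c then (1 : ℝ) else 0) + if b = d then 1 else 0 := by
        by_cases ha : a = c
        · rw [if_pos ha]; split_ifs <;> norm_num
        · rw [if_neg ha, if_pos (by tauto : b = d), zero_add]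
      have h2 : ∀ ω : J × Fin N × Fin N → Bool, boolSign (ω (j, a, b)) *
          (boolSign (ω (j, c, b)) * boolSign (ω (j, a, d)) * boolSign (ω (j, c, d))) ≤ 1 := by
        intro ω
        cases ω (j, a, b) <;> cases ω (j, c, b) <;> cases ω (j, a, d) <;> cases ω (j, c, d)
        all_goals norm_num [boolSign]
      refine (Finset.sum_le_sum fun ω _ => h2 ω).trans ?_
      rw [Finset.sum_const, Finset.card_univ, ← hQ, nsmul_eq_mul]
      gcongr
  simp only [hsSq_signMatrix_mul]
  rw [Finset.sum_comm]
  calc _ ≤ ∑ a : Fin N, ∑ c : Fin N, ∑ b : Fin N, ∑ d : Fin N,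
        Q * ((if a = c then (1 : ℝ) else 0) + if b = d then 1 else 0) := by
        refine Finset.sum_le_sum fun a _ => ?_
        rw [Finset.sum_comm]
        refine Finset.sum_le_sum fun c _ => ?_
        rw [Finset.sum_comm]
        refine Finset.sum_le_sum fun b _ => ?_
        rw [Finset.sum_comm]
        exact Finset.sum_le_sum fun d _ => key a c b d
    _ = _ := by
        simp only [← Finset.mul_sum, Finset.sum_add_distrib, Finset.sum_ite_eq, Finset.mem_univ,
          if_true, Finset.sum_const, Finset.card_univ, Fintype.card_fin, nsmul_eq_mul, mul_one]
        ring

end RandomSigns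

/-! ### Exponentially large separated sets of tuples of unitaries. -/

section Packing

variable {N : ℕ}

theorem conjTranspose_diagonal_ofReal {p : Type*} [DecidableEq p] (s : p → ℝ) :
    (Matrix.diagonal (fun i => (s i : ℂ))).conjTranspose =
      Matrix.diagonal (fun i => (s i : ℂ)) := by
  rw [Matrix.diagonal_conjTranspose]
  congr 1
  ext i
  simp

/-- A lower bound for the trace norm, which is the supremum of `Re ⟨u, G⟩` over all unitaries. -/
theorem exists_unitary_le_re_hsInner (G : Matrix (Fin N) (Fin N) ℂ) :
    ∃ u : Matrix (Fin N) (Fin N) ℂ, u.conjTranspose * u = 1 ∧ ∀ l : ℝ, 0 < l →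
      (3 * hsSq G / l - hsSq (G * G.conjTranspose) / l ^ 3) / 2 ≤ (hsInner u G).re := by
  obtain ⟨U, V, s, hU, hV, hs, hG⟩ := exists_svd G
  have hU' := mul_eq_one_comm.mp hU
  have hV' := mul_eq_one_comm.mp hV
  -- The unitary polar factor of `G`: its pairing with `G` is the sum of the singular values.
  refine ⟨U * V.conjTranspose, ?_, fun l hl => ?_⟩
  · rw [Matrix.conjTranspose_mul, Matrix.conjTranspose_conjTranspose, Matrix.mul_assoc,
      ← Matrix.mul_assoc _ U, hU, Matrix.one_mul, hV']
  have h1 : hsSq G = ∑ i, s i ^ 2 := by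
    rw [hG, hsSq_mul_right (by simpa using hV), hsSq_mul_left hU, hsSq_diagonal]
    simp
  have h2 : hsSq (G * G.conjTranspose) = ∑ i, s i ^ 4 := by
    have : G * G.conjTranspose =
        U * Matrix.diagonal (fun i => ((s i ^ 2 : ℝ) : ℂ)) * U.conjTranspose := by
      rw [hG, Matrix.conjTranspose_mul, Matrix.conjTranspose_mul, conjTranspose_diagonal_ofReal,
        Matrix.conjTranspose_conjTranspose]
      calc _ = U * (Matrix.diagonal (fun i => (s i : ℂ)) * (V.conjTranspose * V) *
            Matrix.diagonal (fun i => (s i : ℂ))) * U.conjTranspose := by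
            simp only [Matrix.mul_assoc]
        _ = _ := by
          rw [hV, Matrix.mul_one, Matrix.diagonal_mul_diagonal]
          congr 3
          ext i
          push_cast
          ring
    rw [this, hsSq_mul_right (by simpa using hU), hsSq_mul_left hU, hsSq_diagonal]
    refine Finset.sum_congr rfl fun i _ => ?_
    rw [Complex.norm_real, Real.norm_eq_abs, sq_abs]
    ring
  have h3 : (hsInner (U * V.conjTranspose) G).re = ∑ i, s i := by
    have : hsInner (U * V.conjTranspose) G = ((∑ i, s i : ℝ) : ℂ) := by
      rw [hsInner_eq_trace, hG, Matrix.conjTranspose_mul, Matrix.conjTranspose_mul,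
        conjTranspose_diagonal_ofReal, Matrix.conjTranspose_conjTranspose, Matrix.mul_assoc,
        ← Matrix.mul_assoc _ V, hV, Matrix.one_mul, Matrix.trace_mul_comm, Matrix.mul_assoc, hU,
        Matrix.mul_one, Matrix.trace_diagonal]
      push_cast
      rfl
    rw [this, Complex.ofReal_re]
  rw [h1, h2, h3, Finset.mul_sum, Finset.sum_div, Finset.sum_div, ← Finset.sum_sub_distrib,
    Finset.sum_div]
  refine Finset.sum_le_sum fun i _ => ?_
  have h4 : (3 * s i ^ 2 / l - s i ^ 4 / l ^ 3) / 2 = (3 * l ^ 2 * s i ^ 2 - s i ^ 4) / (2 * l ^ 3) := by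
    field_simp
  rw [h4, div_le_iff₀ (by positivity)]
  -- Expanding, `s (s - l)² (s + 2l) = s⁴ - 3l²s² + 2l³s`. This bounds the first moment of the
  -- singular values below by the second and fourth.
  have h5 : 0 ≤ s i * ((s i - l) ^ 2 * (s i + 2 * l)) := by
    have := hs i
    positivity
  nlinarith

theorem sum_norm_hsInner_le {J p q : Type*} [Fintype J] [Fintype p] [Fintype q]
    (x y : J → Matrix p q ℂ) :
    ‖∑ j, hsInner (x j) (y j)‖ ≤ √(∑ j, hsSq (x j)) * √(∑ j, hsSq (y j)) := by
  have h := norm_sum_mul_conj_le (fun i : J × p × q => x i.1 i.2.1 i.2.2)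
    (fun i => y i.1 i.2.1 i.2.2)
  simpa only [Fintype.sum_prod_type (α₁ := J), hsInner, hsSq] using h

theorem hsSq_of_unitary {u : Matrix (Fin N) (Fin N) ℂ} (hu : u.conjTranspose * u = 1) :
    hsSq u = N := by
  have := hsSq_mul_left hu (1 : Matrix (Fin N) (Fin N) ℂ)
  rwa [Matrix.mul_one, hsSq_one, Fintype.card_fin] at this

variable {J : Type*} [Fintype J] [DecidableEq J]

/-- A set of tuples of unitaries from which no tuple of unitaries is far has many elements. -/
theorem exp_le_card_of_dense (T : Finset (J → Matrix (Fin N) (Fin N) ℂ))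
    (hT : ∀ t ∈ T, ∀ j, (t j).conjTranspose * t j = 1)
    (hdense : ∀ u : J → Matrix (Fin N) (Fin N) ℂ, (∀ j, (u j).conjTranspose * u j = 1) →
      ∃ t ∈ T, ∑ j, hsSq (u j - t j) ≤ Fintype.card J * N / 4) :
    Real.exp (Fintype.card J * (N : ℝ) ^ 2 / 50) ≤ T.card := by
  -- For `N = 0` the claim is only that `T` is nonempty.
  rcases Nat.eq_zero_or_pos N with rfl | hN
  · obtain ⟨t, ht, _⟩ := hdense (fun _ => 1) (by simp)
    have : 1 ≤ T.card := Finset.card_pos.mpr ⟨t, ht⟩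
    simpa using this
  set K : ℝ := (Fintype.card J : ℝ) with hK
  set r : ℝ := √N with hr
  have hr2 : r ^ 2 = N := Real.sq_sqrt (Nat.cast_nonneg N)
  have hr0 : 0 < r := Real.sqrt_pos.mpr (by exact_mod_cast hN)
  -- This `l` maximizes `3N²/l - 2N³/l³`, the bound available on average. It gives a mean trace norm
  -- of at least `N^{3/2}/√2 ≥ (7/10) N^{3/2}`.
  set l : ℝ := √2 * r with hl
  have hl0 : 0 < l := by positivity
  have hl2 : l ^ 2 = 2 * N := by rw [hl, mul_pow, Real.sq_sqrt (by norm_num), hr2]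
  set Q := Fintype.card (J × Fin N × Fin N → Bool) with hQ
  have hQ0 : (0 : ℝ) < Q := by exact_mod_cast Fintype.card_pos
  let X : (J → Matrix (Fin N) (Fin N) ℂ) → (J × Fin N × Fin N → Bool) → ℝ :=
    fun t ω => (∑ j, hsInner (t j) (signMatrix ω j)).re
  let Φ : (J × Fin N × Fin N → Bool) → ℝ := fun ω =>
    ∑ j, (3 * (N : ℝ) ^ 2 / l - hsSq (signMatrix ω j * (signMatrix ω j).conjTranspose) / l ^ 3) / 2
  have hXexp : ∀ t ω, X t ω = ∑ i, boolSign (ω i) * (t i.1 i.2.1 i.2.2).re := by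
    intro t ω
    simp only [X, hsInner, Complex.re_sum]
    rw [Fintype.sum_prod_type (f := fun i => boolSign (ω i) * (t i.1 i.2.1 i.2.2).re)]
    refine Finset.sum_congr rfl fun j _ => Finset.sum_congr rfl fun c _ => ?_
    simp [signMatrix, mul_comm]
  -- Replacing the optimal tuple by a nearby `t ∈ T` costs at most `√(KN/4) √(KN²) = K r³/2`,
  -- leaving a mean gain of at least `(7/10 - 1/2) K r³ = K r³/5`.
  have hΦ : ∀ ω, ∃ t ∈ T, Φ ω - K * r ^ 3 / 2 ≤ X t ω := by
    intro ω
    choose u hu hu' using fun j => exists_unitary_le_re_hsInner (signMatrix ω j)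
    obtain ⟨t, ht, htu⟩ := hdense u hu
    refine ⟨t, ht, ?_⟩
    have h1 : Φ ω ≤ (∑ j, hsInner (u j) (signMatrix ω j)).re := by
      rw [Complex.re_sum]
      refine Finset.sum_le_sum fun j _ => ?_
      have := hu' j l hl0
      rwa [hsSq_signMatrix] at this
    have h2 := sum_norm_hsInner_le (fun j => u j - t j) (signMatrix ω)
    have h3 : √(∑ j, hsSq (u j - t j)) * √(∑ j, hsSq (signMatrix ω j)) ≤ K * r ^ 3 / 2 := by
      simp only [hsSq_signMatrix, Finset.sum_const, Finset.card_univ, nsmul_eq_mul]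
      rw [← Real.sqrt_mul (Finset.sum_nonneg fun j _ => hsSq_nonneg _)]
      refine Real.sqrt_le_iff.mpr ⟨by positivity, ?_⟩
      calc _ ≤ (K * N / 4) * (K * (N : ℝ) ^ 2) := by gcongr
        _ = _ := by rw [← hr2]; ring
    have h4 : (∑ j, hsInner (u j - t j) (signMatrix ω j)).re =
        (∑ j, hsInner (u j) (signMatrix ω j)).re - X t ω := by
      simp only [X, hsInner_sub_left, Finset.sum_sub_distrib, Complex.sub_re]
    have h5 := Complex.re_le_norm (∑ j, hsInner (u j - t j) (signMatrix ω j))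
    linarith
  have hmean : Q * (7 / 10 * (K * r ^ 3)) ≤ ∑ ω, Φ ω := by
    have h1 : ∑ ω, Φ ω = ∑ j : J, (Q * (3 * (N : ℝ) ^ 2 / l) - (∑ ω : J × Fin N × Fin N → Bool,
        hsSq (signMatrix ω j * (signMatrix ω j).conjTranspose)) / l ^ 3) / 2 := by
      simp only [Φ]
      rw [Finset.sum_comm]
      refine Finset.sum_congr rfl fun j _ => ?_
      rw [← Finset.sum_div, Finset.sum_sub_distrib, Finset.sum_const, Finset.card_univ, ← hQ,
        nsmul_eq_mul, ← Finset.sum_div]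
    have h2 : ∀ j : J, Q * (7 / 10 * r ^ 3) ≤ (Q * (3 * (N : ℝ) ^ 2 / l) -
        (∑ ω : J × Fin N × Fin N → Bool,
          hsSq (signMatrix ω j * (signMatrix ω j).conjTranspose)) / l ^ 3) / 2 := by
      intro j
      have h3 := sum_hsSq_signMatrix_mul_le (N := N) j
      rw [← hQ] at h3
      have h4 : (Q * (3 * (N : ℝ) ^ 2 / l) - Q * (2 * (N : ℝ) ^ 3) / l ^ 3) / 2 =
          Q * (r ^ 3 / √2) := by
        have h5 : l ^ 3 = l ^ 2 * l := by ring
        rw [h5, hl2, hl, ← hr2]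
        field_simp
        ring
      have h6 : (7 / 10 : ℝ) * r ^ 3 ≤ r ^ 3 / √2 := by
        rw [le_div_iff₀ (by positivity)]
        have h7 : √2 ≤ 10 / 7 := Real.sqrt_le_iff.mpr ⟨by norm_num, by norm_num⟩
        have : 0 < r ^ 3 := by positivity
        nlinarith
      calc _ ≤ Q * (r ^ 3 / √2) := by gcongr
        _ = _ := h4.symm
        _ ≤ _ := by gcongr
    rw [h1]
    refine le_trans (le_of_eq ?_) (Finset.sum_le_sum fun j _ => h2 j)
    rw [Finset.sum_const, Finset.card_univ, nsmul_eq_mul]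
    ring
  -- The optimal exponent: the lower bound `θ K r³/5 = KN²/25` exceeds the subgaussian cost `θ² KN/2
  -- = KN²/50` of each `t` by `KN²/50`.
  set θ : ℝ := r / 5 with hθ
  have h1 : Q * Real.exp (θ * (K * r ^ 3 / 5)) ≤ ∑ ω, Real.exp (θ * (Φ ω - K * r ^ 3 / 2)) := by
    refine card_mul_exp_le_sum_exp _ ?_
    rw [← Finset.mul_sum, Finset.sum_sub_distrib, Finset.sum_const, Finset.card_univ, ← hQ,
      nsmul_eq_mul]
    have : 0 < θ := by positivity
    calc _ = θ * (Q * (7 / 10 * (K * r ^ 3)) - Q * (K * r ^ 3 / 2)) := by ring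
      _ ≤ _ := by gcongr
  have h2 : ∀ t ∈ T, ∑ ω, Real.exp (θ * X t ω) ≤ Q * Real.exp (θ ^ 2 * (K * N) / 2) := by
    intro t ht
    have h3 := sum_exp_boolSign_le (fun i : J × Fin N × Fin N => θ * (t i.1 i.2.1 i.2.2).re)
    have h4 : (Q : ℝ) = 2 ^ Fintype.card (J × Fin N × Fin N) := by
      rw [hQ, Fintype.card_fun, Fintype.card_bool]
      push_cast
      rfl
    rw [h4]
    refine le_trans (le_of_eq ?_) (h3.trans ?_)
    · refine Finset.sum_congr rfl fun ω _ => ?_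
      rw [hXexp, Finset.mul_sum]
      congr 1
      exact Finset.sum_congr rfl fun i _ => by ring
    · gcongr
      have h5 : ∑ j, hsSq (t j) = K * N := by
        rw [Finset.sum_congr rfl fun j _ => hsSq_of_unitary (hT t ht j), Finset.sum_const,
          Finset.card_univ, nsmul_eq_mul]
      rw [← h5, Finset.mul_sum, Fintype.sum_prod_type]
      refine Finset.sum_le_sum fun j _ => ?_
      rw [hsSq, Finset.mul_sum]
      refine Finset.sum_le_sum fun c _ => ?_
      rw [mul_pow]
      refine mul_le_mul_of_nonneg_left ?_ (sq_nonneg _)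
      rw [← sq_abs]
      exact pow_le_pow_left₀ (abs_nonneg _) (Complex.abs_re_le_norm _) 2
  have h3 : ∑ ω, Real.exp (θ * (Φ ω - K * r ^ 3 / 2)) ≤ ∑ ω, ∑ t ∈ T, Real.exp (θ * X t ω) := by
    refine Finset.sum_le_sum fun ω _ => ?_
    obtain ⟨t, ht, h⟩ := hΦ ω
    refine le_trans ?_ (Finset.single_le_sum (fun t _ => (Real.exp_pos (θ * X t ω)).le) ht)
    gcongr
  rw [Finset.sum_comm] at h3
  have h4 := h1.trans (h3.trans (Finset.sum_le_sum h2))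
  rw [Finset.sum_const, nsmul_eq_mul, mul_left_comm] at h4
  have h5 := le_of_mul_le_mul_left h4 hQ0
  have h6 : θ * (K * r ^ 3 / 5) = K * (N : ℝ) ^ 2 / 50 + θ ^ 2 * (K * N) / 2 := by
    rw [hθ, ← hr2]; ring
  rw [h6, Real.exp_add] at h5
  exact le_of_mul_le_mul_right h5 (Real.exp_pos _)

/-- There are exponentially many well separated tuples of unitaries. -/
theorem exists_packing (J : Type*) [Fintype J] (N : ℕ) :
    ∃ T : Finset (J → Matrix (Fin N) (Fin N) ℂ),
      (∀ t ∈ T, ∀ j, (t j).conjTranspose * t j = 1) ∧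
      (∀ t ∈ T, ∀ t' ∈ T, t ≠ t' → Fintype.card J * N / 4 < ∑ j, hsSq (t j - t' j)) ∧
      Real.exp (Fintype.card J * (N : ℝ) ^ 2 / 50) ≤ T.card := by
  classical
  set B := Real.exp (Fintype.card J * (N : ℝ) ^ 2 / 50) with hB
  -- A separated set with fewer than `B` elements is not dense, by `exp_le_card_of_dense`, so a far
  -- tuple can be added. Growing to `⌈B⌉₊` elements makes a maximal separated set unnecessary.
  have key : ∀ k : ℕ, ∃ T : Finset (J → Matrix (Fin N) (Fin N) ℂ),
      (∀ t ∈ T, ∀ j, (t j).conjTranspose * t j = 1) ∧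
      (∀ t ∈ T, ∀ t' ∈ T, t ≠ t' → Fintype.card J * N / 4 < ∑ j, hsSq (t j - t' j)) ∧
      (k ≤ T.card ∨ B ≤ T.card) := by
    intro k
    induction k with
    | zero => exact ⟨∅, by simp, by simp, by simp⟩
    | succ k ih =>
      obtain ⟨T, hT, hsep, hcard⟩ := ih
      by_cases hBT : B ≤ T.card
      · exact ⟨T, hT, hsep, Or.inr hBT⟩
      have hk : k ≤ T.card := hcard.resolve_right hBT
      have h1 : ¬ ∀ u : J → Matrix (Fin N) (Fin N) ℂ, (∀ j, (u j).conjTranspose * u j = 1) →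
          ∃ t ∈ T, ∑ j, hsSq (u j - t j) ≤ Fintype.card J * N / 4 :=
        fun h => hBT (exp_le_card_of_dense T hT h)
      push Not at h1
      obtain ⟨u, hu, hfar⟩ := h1
      have huT : u ∉ T := by
        intro h
        have := hfar u h
        simp only [sub_self] at this
        have h0 : ∑ j : J, hsSq (0 : Matrix (Fin N) (Fin N) ℂ) = 0 := by simp [hsSq]
        rw [h0] at this
        have : (0 : ℝ) ≤ Fintype.card J * N / 4 := by positivity
        linarith
      refine ⟨insert u T, ?_, ?_, Or.inl ?_⟩
      · intro t ht
        rcases Finset.mem_insert.mp ht with rfl | ht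
        · exact hu
        · exact hT t ht
      · intro t ht t' ht' hne
        rcases Finset.mem_insert.mp ht with rfl | ht₁ <;>
          rcases Finset.mem_insert.mp ht' with rfl | ht₂
        · exact absurd rfl hne
        · exact hfar t' ht₂
        · simp only [hsSq_sub_comm (t _)]
          exact hfar t ht₁
        · exact hsep t ht₁ t' ht₂ hne
      · rw [Finset.card_insert_of_notMem huT]
        omega
  obtain ⟨T, hT, hsep, hcard⟩ := key ⌈B⌉₊
  refine ⟨T, hT, hsep, hcard.elim (fun h => ?_) id⟩
  exact (Nat.le_ceil B).trans (by exact_mod_cast h)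

end Packing

/-! ### Norm bounds for tensor products of contractions. -/

section Contractions

theorem norm_map_conj_le {p q : Type*} [Fintype p] [Fintype q] [DecidableEq q]
    (A : Matrix p q ℂ) : ‖A.map (starRingEnd ℂ)‖ ≤ ‖A‖ := by
  refine opNorm_le_of_sq (norm_nonneg _) fun v => ?_
  have h := sum_norm_mulVec_sq_le A fun j => starRingEnd ℂ (v j)
  have h1 : ∀ i, (A.map (starRingEnd ℂ)).mulVec v i =
      starRingEnd ℂ (A.mulVec (fun j => starRingEnd ℂ (v j)) i) := by
    intro i
    simp [Matrix.mulVec, dotProduct]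
  simpa [h1] using h

variable {n : ℕ} {p q : Type*} [Fintype p] [Fintype q] [DecidableEq p] [DecidableEq q]

theorem norm_kronecker_le (A : Matrix p p ℂ) (B : Matrix q q ℂ) : ‖A ⊗ₖ B‖ ≤ ‖A‖ * ‖B‖ := by
  have h1 : A ⊗ₖ B = (A ⊗ₖ (1 : Matrix q q ℂ)) * ((1 : Matrix p p ℂ) ⊗ₖ B) := by
    rw [← Matrix.mul_kronecker_mul, Matrix.mul_one, Matrix.one_mul]
  have h2 : (1 : Matrix p p ℂ) ⊗ₖ B =
      (B ⊗ₖ (1 : Matrix p p ℂ)).submatrix (Equiv.prodComm p q) (Equiv.prodComm p q) := by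
    ext ⟨a, b⟩ ⟨c, d⟩
    simp [mul_comm]
  rw [h1]
  refine (Matrix.l2_opNorm_mul _ _).trans (mul_le_mul (norm_kronecker_one_le A) ?_
    (norm_nonneg _) (norm_nonneg _))
  rw [h2]
  exact (norm_submatrix_equiv_le _ _ _).trans (norm_kronecker_one_le B)

theorem norm_tensorConj_self_le {x : Fin n → Matrix p p ℂ} (hx : ∀ j, ‖x j‖ ≤ 1) :
    ‖tensorConj x x‖ ≤ n := by
  refine (norm_sum_le _ _).trans ?_
  have h : ∀ j ∈ Finset.univ, ‖x j ⊗ₖ (x j).map (starRingEnd ℂ)‖ ≤ 1 := fun j _ =>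
    (norm_kronecker_le _ _).trans (mul_le_one₀ (hx j) (norm_nonneg _)
      ((norm_map_conj_le _).trans (hx j)))
  simpa using Finset.sum_le_card_nsmul _ _ _ h

theorem norm_le_one_of_unitary {u : Matrix p p ℂ} (hu : u.conjTranspose * u = 1) : ‖u‖ ≤ 1 := by
  refine opNorm_le_of_sq zero_le_one fun v => ?_
  have h := hsSq_mul_left hu (Matrix.replicateCol Unit v)
  rw [hsSq_eq_sum, hsSq_eq_sum] at h
  simp only [Finset.univ_unique, Finset.sum_singleton] at h
  rw [one_pow, one_mul]
  exact h.le

end Contractions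

/-! ### Near equality in Haagerup's inequality. -/

section Rigidity

variable {n N : ℕ}

/-- The action `ξ ↦ ∑ x_j ξ y_j^*` of `∑ x_j ⊗ conj(y_j)` on Hilbert-Schmidt matrices. -/
def tensorAct (x y : Fin n → Matrix (Fin N) (Fin N) ℂ) (ξ : Matrix (Fin N) (Fin N) ℂ) :
    Matrix (Fin N) (Fin N) ℂ :=
  ∑ j, x j * ξ * (y j).conjTranspose

theorem tensorAct_sub (x y : Fin n → Matrix (Fin N) (Fin N) ℂ) (ξ η : Matrix (Fin N) (Fin N) ℂ) :
    tensorAct x y (ξ - η) = tensorAct x y ξ - tensorAct x y η := by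
  simp [tensorAct, Matrix.mul_sub, Matrix.sub_mul]

theorem tensorAct_smul (x y : Fin n → Matrix (Fin N) (Fin N) ℂ) (c : ℂ)
    (ξ : Matrix (Fin N) (Fin N) ℂ) : tensorAct x y (c • ξ) = c • tensorAct x y ξ := by
  simp [tensorAct, Finset.smul_sum]

theorem hsInner_tensorAct (x y : Fin n → Matrix (Fin N) (Fin N) ℂ)
    (ξ η : Matrix (Fin N) (Fin N) ℂ) :
    hsInner (tensorAct x y ξ) η = ∑ j, hsInner (x j * ξ * (y j).conjTranspose) η := by
  simp only [hsInner_eq_trace, tensorAct, Matrix.sum_mul, Matrix.trace_sum]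

theorem hsInner_smul_left (c : ℂ) (A B : Matrix (Fin N) (Fin N) ℂ) :
    hsInner (c • A) B = c * hsInner A B := by
  simp [hsInner, Finset.mul_sum, mul_assoc]

theorem hsInner_smul_right (c : ℝ) (A B : Matrix (Fin N) (Fin N) ℂ) :
    hsInner A ((c : ℂ) • B) = c * hsInner A B := by
  simp [hsInner, Finset.mul_sum, mul_left_comm]

theorem hsSq_tensorAct_le (x y : Fin n → Matrix (Fin N) (Fin N) ℂ)
    (ξ : Matrix (Fin N) (Fin N) ℂ) :
    hsSq (tensorAct x y ξ) ≤ ‖tensorConj x y‖ ^ 2 * hsSq ξ := by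
  have h := sum_norm_mulVec_sq_le (tensorConj x y) (fun c => ξ c.1 c.2)
  simp only [tensorConj_mulVec] at h
  exact h

theorem norm_hsInner_tensorAct_le (x y : Fin n → Matrix (Fin N) (Fin N) ℂ)
    (ξ η : Matrix (Fin N) (Fin N) ℂ) :
    ‖hsInner (tensorAct x y ξ) η‖ ≤ ‖tensorConj x y‖ * √(hsSq ξ) * √(hsSq η) := by
  refine (norm_hsInner_le _ _).trans ?_
  gcongr
  rw [← Real.sqrt_sq (norm_nonneg (tensorConj x y)), ← Real.sqrt_mul (sq_nonneg _)]
  exact Real.sqrt_le_sqrt (hsSq_tensorAct_le x y ξ)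

/-- `‖tensorConj x y‖` is the norm of `tensorAct x y` on Hilbert-Schmidt matrices. A unit `ξ` almost
attaining it is paired with the normalized image `η`. -/
theorem exists_hsInner_tensorAct_gt {x y : Fin n → Matrix (Fin N) (Fin N) ℂ} {c : ℝ}
    (hc : 0 ≤ c) (h : c < ‖tensorConj x y‖) :
    ∃ ξ η : Matrix (Fin N) (Fin N) ℂ, hsSq ξ = 1 ∧ hsSq η = 1 ∧
      c < (hsInner (tensorAct x y ξ) η).re := by
  obtain ⟨ζ, hζ⟩ : ∃ ζ : Matrix (Fin N) (Fin N) ℂ, c ^ 2 * hsSq ζ < hsSq (tensorAct x y ζ) := by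
    by_contra! hcon
    refine absurd (opNorm_le_of_sq hc fun v => ?_) (not_le.mpr h)
    have h1 := hcon (Matrix.of fun a b => v (a, b))
    have h2 : hsSq (tensorAct x y (Matrix.of fun a b => v (a, b))) =
        ∑ i, ‖((tensorConj x y).mulVec v) i‖ ^ 2 := by
      unfold hsSq tensorAct
      simp only [← tensorConj_mulVec]
      rfl
    rw [h2] at h1
    exact h1
  have h0 : 0 < hsSq (tensorAct x y ζ) :=
    lt_of_le_of_lt (mul_nonneg (sq_nonneg _) (hsSq_nonneg _)) hζ
  have h1 : 0 < hsSq ζ := by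
    refine lt_of_le_of_ne (hsSq_nonneg _) fun h => ?_
    have := hsSq_tensorAct_le x y ζ
    rw [← h, mul_zero] at this
    linarith
  set a := √(hsSq ζ) with ha
  set b := √(hsSq (tensorAct x y ζ)) with hb
  have ha0 : 0 < a := Real.sqrt_pos.mpr h1
  have hb0 : 0 < b := Real.sqrt_pos.mpr h0
  have ha2 : a ^ 2 = hsSq ζ := Real.sq_sqrt h1.le
  have hb2 : b ^ 2 = hsSq (tensorAct x y ζ) := Real.sq_sqrt h0.le
  refine ⟨((a⁻¹ : ℝ) : ℂ) • ζ, ((b⁻¹ : ℝ) : ℂ) • tensorAct x y ζ, ?_, ?_, ?_⟩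
  · rw [hsSq_smul, Complex.norm_real, Real.norm_eq_abs, sq_abs, ← ha2]
    field_simp
  · rw [hsSq_smul, Complex.norm_real, Real.norm_eq_abs, sq_abs, ← hb2]
    field_simp
  · rw [tensorAct_smul, hsInner_smul_left, hsInner_smul_right, hsInner_self, ← hb2,
      ← Complex.ofReal_mul, ← Complex.ofReal_mul, Complex.ofReal_re]
    have h2 : a⁻¹ * (b⁻¹ * b ^ 2) = b / a := by field_simp
    rw [h2, lt_div_iff₀ ha0]
    refine lt_of_pow_lt_pow_left₀ 2 hb0.le ?_
    rw [mul_pow, ha2, hb2]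
    exact hζ

/-- If a unit vector `s` with nonnegative entries is close to a multiple of `(1, …, 1)`, then it is
close to `N^{-1/2} (1, …, 1)`. -/
theorem sum_sub_sq_le_of_close {s : Fin N → ℝ} (hs : ∀ i, 0 ≤ s i) (h1 : ∑ i, s i ^ 2 = 1)
    {c : ℂ} {δ : ℝ} (h : ∑ i, ‖(s i : ℂ) - c‖ ^ 2 ≤ δ) {r : ℝ} (hr : 0 ≤ r)
    (hrN : N * r ^ 2 = 1) : ∑ i, (s i - r) ^ 2 ≤ 2 * δ := by
  set S := ∑ i, s i with hS
  have hS0 : 0 ≤ S := Finset.sum_nonneg fun i _ => hs i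
  have e1 : ∑ i, (s i - r) ^ 2 = 2 - 2 * (r * S) := by
    have : ∀ i, (s i - r) ^ 2 = s i ^ 2 - 2 * r * s i + r ^ 2 := fun i => by ring
    simp only [this, Finset.sum_add_distrib, Finset.sum_sub_distrib, ← Finset.mul_sum,
      Finset.sum_const, Finset.card_univ, Fintype.card_fin, nsmul_eq_mul, h1, hrN]
    ring
  have e2 : ∑ i, (s i - c.re) ^ 2 = 1 - 2 * c.re * S + N * c.re ^ 2 := by
    have : ∀ i, (s i - c.re) ^ 2 = s i ^ 2 - 2 * c.re * s i + c.re ^ 2 := fun i => by ring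
    simp only [this, Finset.sum_add_distrib, Finset.sum_sub_distrib, ← Finset.mul_sum,
      Finset.sum_const, Finset.card_univ, Fintype.card_fin, nsmul_eq_mul, h1, hS]
  have e3 : ∑ i, (s i - c.re) ^ 2 ≤ δ := by
    refine le_trans (Finset.sum_le_sum fun i _ => ?_) h
    have := Complex.abs_re_le_norm ((s i : ℂ) - c)
    rw [Complex.sub_re, Complex.ofReal_re] at this
    rw [← sq_abs]
    exact pow_le_pow_left₀ (abs_nonneg _) this 2
  have e4 : 0 ≤ ∑ i, (s i - r) ^ 2 := Finset.sum_nonneg fun i _ => sq_nonneg _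
  have e5 : 0 ≤ r * S := mul_nonneg hr hS0
  have e6 : (r * S) ^ 2 - 2 * c.re * S + N * c.re ^ 2 = 
      N * (c.re - r ^ 2 * S) ^ 2 + (1 - N * r ^ 2) * (r ^ 2 * S ^ 2 - 2 * c.re * S) := by ring
  rw [hrN, sub_self, zero_mul, add_zero] at e6
  have e7 : (0 : ℝ) ≤ N * (c.re - r ^ 2 * S) ^ 2 := by positivity
  -- `r S` is the inner product of `s` with the constant unit vector, so `1 - (r S)²` is the squared
  -- distance from `s` to the constants. As `0 ≤ r S ≤ 1`, it dominates `1 - r S`, which is half the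
  -- desired sum.
  have e8 : 1 - (r * S) ^ 2 ≤ δ := by linarith
  nlinarith

/-- A bound on average over all `n` indices becomes, up to a factor `10`, a bound on the common
value on a class containing a tenth of them. This extracts information on `1` and on each `w_k`. -/
theorem mul_le_of_sum_le {f : Fin n → ℝ} (hf : ∀ j, 0 ≤ f j) {B c : ℝ} (hB : ∑ j, f j ≤ B)
    {I : Finset (Fin n)} (hI : n ≤ 10 * I.card) (hc : 0 ≤ c) (hfc : ∀ j ∈ I, f j = c) :
    n * c ≤ 10 * B := by
  have h1 : ∑ j ∈ I, f j ≤ ∑ j, f j :=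
    Finset.sum_le_sum_of_subset_of_nonneg (Finset.subset_univ _) fun j _ _ => hf j
  rw [Finset.sum_congr rfl hfc, Finset.sum_const, nsmul_eq_mul] at h1
  have h2 : (n : ℝ) ≤ 10 * I.card := by exact_mod_cast hI
  nlinarith

theorem unitary_mul_conjTranspose {U V : Matrix (Fin N) (Fin N) ℂ}
    (hU : U.conjTranspose * U = 1) (hV : V.conjTranspose * V = 1) :
    (U * V.conjTranspose).conjTranspose * (U * V.conjTranspose) = 1 := by
  rw [Matrix.conjTranspose_mul, Matrix.conjTranspose_conjTranspose, Matrix.mul_assoc,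
    ← Matrix.mul_assoc _ U, hU, Matrix.one_mul, mul_eq_one_comm.mp hV]

theorem diagonal_sqrt_mul_self {s : Fin N → ℝ} (hs : ∀ i, 0 ≤ s i) :
    Matrix.diagonal (fun i => ((√(s i) : ℝ) : ℂ)) * Matrix.diagonal (fun i => ((√(s i) : ℝ) : ℂ)) =
      Matrix.diagonal (fun i => (s i : ℂ)) := by
  rw [Matrix.diagonal_mul_diagonal]
  congr 1
  ext i
  rw [← Complex.ofReal_mul, Real.mul_self_sqrt (hs i)]

/-- Near equality in Haagerup's Cauchy-Schwarz inequality: if `∑ u_j ⊗ conj(z_j)` nearly attains its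
norm at `P Q^*` and `R Z^*`, then the `u_j` nearly intertwine `P P^*` and `R R^*`. -/
theorem sum_hsSq_intertwine_le {u z : Fin n → Matrix (Fin N) (Fin N) ℂ}
    (hu : ∀ j, (u j).conjTranspose * u j = 1) (hz : ‖tensorConj z z‖ ≤ n)
    {P Q R Z : Matrix (Fin N) (Fin N) ℂ} (hP : hsSq (P * P.conjTranspose) = 1)
    (hQ : hsSq (Q * Q.conjTranspose) = 1) (hR : hsSq (R * R.conjTranspose) = 1)
    (hZ : hsSq (Z * Z.conjTranspose) = 1) {ε : ℝ} (hε : ε ≤ 1)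
    (h : (1 - ε) * n < (hsInner (tensorAct u z (P * Q.conjTranspose)) (R * Z.conjTranspose)).re) :
    ∑ j, hsSq (u j * (P * P.conjTranspose) - R * R.conjTranspose * u j) ≤ 4 * ε * n := by
  obtain ⟨X, hX⟩ : ∃ X, X = ∑ j, hsSq (R.conjTranspose * u j * P) := ⟨_, rfl⟩
  have hX0 : 0 ≤ X := hX ▸ Finset.sum_nonneg fun j _ => hsSq_nonneg _
  have hpair : hsInner (tensorAct u z (P * Q.conjTranspose)) (R * Z.conjTranspose) =
      ∑ j, hsInner (R.conjTranspose * u j * P) (Z.conjTranspose * z j * Q) := by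
    rw [hsInner_tensorAct]
    refine Finset.sum_congr rfl fun j _ => ?_
    rw [hsInner_eq_trace, hsInner_eq_trace]
    have h4 : u j * (P * Q.conjTranspose) * (z j).conjTranspose * (R * Z.conjTranspose).conjTranspose =
        (u j * P * Q.conjTranspose * (z j).conjTranspose * Z) * R.conjTranspose := by
      simp [Matrix.mul_assoc]
    rw [h4, Matrix.trace_mul_comm]
    congr 1
    simp [Matrix.mul_assoc]
  have hzsum : ∑ j, hsSq (Z.conjTranspose * z j * Q) ≤ n := by
    have h2 := trace_sum_le z Q Z
    change ∑ j, hsSq (Z.conjTranspose * z j * Q) ≤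
      ‖tensorConj z z‖ * √(hsSq (Q * Q.conjTranspose)) * √(hsSq (Z * Z.conjTranspose)) at h2
    rw [hQ, hZ, Real.sqrt_one, mul_one, mul_one] at h2
    exact h2.trans hz
  have hn : (0 : ℝ) ≤ n := Nat.cast_nonneg n
  -- Cauchy-Schwarz gives `(1 - ε) n ≤ √X √n`, so `X ≥ (1 - ε)² n ≥ (1 - 2ε) n`.
  have hXn : (1 - 2 * ε) * n ≤ X := by
    have h2 := sum_norm_hsInner_le
      (fun j => R.conjTranspose * u j * P) (fun j => Z.conjTranspose * z j * Q)
    rw [← hpair, ← hX] at h2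
    have h5 : √X * √(∑ j, hsSq (Z.conjTranspose * z j * Q)) ≤ √X * √n :=
      mul_le_mul_of_nonneg_left (Real.sqrt_le_sqrt hzsum) (Real.sqrt_nonneg _)
    have h3 : (1 - ε) * n ≤ √X * √n :=
      h.le.trans ((Complex.re_le_norm _).trans (h2.trans h5))
    have h4 : ((1 - ε) * n) ^ 2 ≤ X * n := by
      have := pow_le_pow_left₀ (mul_nonneg (by linarith) hn) h3 2
      rwa [mul_pow (√X), Real.sq_sqrt hX0, Real.sq_sqrt hn] at this
    rcases hn.eq_or_lt with h0 | h0
    · rw [← h0, mul_zero]; exact hX0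
    · nlinarith [mul_nonneg (mul_nonneg hn hn) (sq_nonneg ε)]
  -- Both terms have norm one, and their inner product is `‖R^* u_j P‖²` in Hilbert-Schmidt norm, so
  -- a large `X` forces approximate intertwining.
  have hterm : ∀ j, hsSq (u j * (P * P.conjTranspose) - R * R.conjTranspose * u j) =
      2 - 2 * hsSq (R.conjTranspose * u j * P) := by
    intro j
    rw [hsSq_sub, hsSq_mul_left (hu j), hsSq_mul_right (mul_eq_one_comm.mp (hu j)), hP, hR]
    have h2 : hsInner (u j * (P * P.conjTranspose)) (R * R.conjTranspose * u j) =
        hsSq (R.conjTranspose * u j * P) := by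
      rw [hsInner_eq_trace, ofReal_hsSq]
      have h4 : u j * (P * P.conjTranspose) * (R * R.conjTranspose * u j).conjTranspose =
          (u j * P * P.conjTranspose * (u j).conjTranspose * R) * R.conjTranspose := by
        simp [Matrix.mul_assoc]
      rw [h4, Matrix.trace_mul_comm]
      congr 1
      simp [Matrix.mul_assoc]
    rw [h2, Complex.ofReal_re]
    ring
  simp only [hterm]
  rw [Finset.sum_sub_distrib, ← Finset.mul_sum, ← hX, Finset.sum_const, Finset.card_univ,
    Fintype.card_fin, nsmul_eq_mul]
  linarith

/-- Split the singular values evenly, `P = U √D` and `Q = V √D`. Keeping `U`, `V` and `s` explicit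
allows information on `P P^* = U D U^*` to be carried back to `U D V^*`. -/
theorem exists_factor_of_svd {U V : Matrix (Fin N) (Fin N) ℂ} {s : Fin N → ℝ}
    (hU : U.conjTranspose * U = 1) (hV : V.conjTranspose * V = 1) (hs : ∀ i, 0 ≤ s i)
    (h1 : ∑ i, s i ^ 2 = 1) :
    ∃ P Q : Matrix (Fin N) (Fin N) ℂ,
      U * Matrix.diagonal (fun i => (s i : ℂ)) * V.conjTranspose = P * Q.conjTranspose ∧
      U * Matrix.diagonal (fun i => (s i : ℂ)) * U.conjTranspose = P * P.conjTranspose ∧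
      hsSq (P * P.conjTranspose) = 1 ∧ hsSq (Q * Q.conjTranspose) = 1 := by
  set D := Matrix.diagonal (fun i => ((√(s i) : ℝ) : ℂ)) with hD
  have hDD : D.conjTranspose = D := conjTranspose_diagonal_ofReal _
  have hfac : ∀ A B : Matrix (Fin N) (Fin N) ℂ,
      A * Matrix.diagonal (fun i => (s i : ℂ)) * B.conjTranspose =
        (A * D) * (B * D).conjTranspose := by
    intro A B
    rw [Matrix.conjTranspose_mul, hDD, ← diagonal_sqrt_mul_self hs]
    simp only [Matrix.mul_assoc, hD]
  have hsq : ∀ A : Matrix (Fin N) (Fin N) ℂ, A.conjTranspose * A = 1 →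
      hsSq ((A * D) * (A * D).conjTranspose) = 1 := by
    intro A hA
    rw [← hfac, hsSq_mul_right (by simpa using hA), hsSq_mul_left hA, hsSq_diagonal]
    simpa using h1
  exact ⟨U * D, V * D, hfac _ _, hfac _ _, hsq U hU, hsq V hV⟩

theorem hsSq_conj_diagonal_sub {U V : Matrix (Fin N) (Fin N) ℂ} {s : Fin N → ℝ}
    (hU : U.conjTranspose * U = 1) (hV : V.conjTranspose * V = 1) (c : ℂ) :
    hsSq (U * Matrix.diagonal (fun i => (s i : ℂ)) * V.conjTranspose -
      c • (U * V.conjTranspose)) = ∑ i, ‖(s i : ℂ) - c‖ ^ 2 := by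
  have h : U * Matrix.diagonal (fun i => (s i : ℂ)) * V.conjTranspose - c • (U * V.conjTranspose) =
      U * Matrix.diagonal (fun i => (s i : ℂ) - c) * V.conjTranspose := by
    have h2 : Matrix.diagonal (fun i => (s i : ℂ) - c) =
        Matrix.diagonal (fun i => (s i : ℂ)) - c • 1 := by
      rw [Matrix.smul_one_eq_diagonal, Matrix.diagonal_sub]
    rw [h2, Matrix.mul_sub, Matrix.sub_mul]
    simp
  rw [h, hsSq_mul_right (by simpa using hV), hsSq_mul_left hU, hsSq_diagonal]

/-- The gap inequality of a quantum expander. -/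
def HasGap (w : Fin 3 → Matrix (Fin N) (Fin N) ℂ) : Prop :=
  (∀ k, (w k).conjTranspose * w k = 1) ∧ ∀ A : Matrix (Fin N) (Fin N) ℂ, ∃ c : ℂ,
    hsSq (A - c • 1) ≤ 600 * ∑ k, hsSq (w k * A - A * w k)

/-- The tuple `u` contains many copies of `1` and of each of the matrices `w_k`. -/
def Contains (u : Fin n → Matrix (Fin N) (Fin N) ℂ) (w : Fin 3 → Matrix (Fin N) (Fin N) ℂ)
    (I₀ : Finset (Fin n)) (I : Fin 3 → Finset (Fin n)) : Prop :=
  (∀ j ∈ I₀, u j = 1) ∧ (∀ k, ∀ j ∈ I k, u j = w k) ∧ n ≤ 10 * I₀.card ∧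
    ∀ k, n ≤ 10 * (I k).card

/-- At an almost maximizing pair `ξ`, `η`, the matrices `A = |ξ^*|` and `B = |η^*|` are almost
intertwined by the `u_j`. The copies of `1` give `A ≈ B`, so `A` almost commutes with each `w_k` and
is close to a scalar. All singular values of `ξ` and `η` are then close to `r = N^{-1/2}` in `ℓ₂`,
and `V`, `W` are the unitary polar factors. -/
theorem exists_unitary_near_maximizer {u z : Fin n → Matrix (Fin N) (Fin N) ℂ}
    {w : Fin 3 → Matrix (Fin N) (Fin N) ℂ} (hw : HasGap w) {I₀ : Finset (Fin n)}
    {I : Fin 3 → Finset (Fin n)} (huw : Contains u w I₀ I) (hn : 1 ≤ n) (hN : 1 ≤ N)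
    (hu : ∀ j, (u j).conjTranspose * u j = 1) (hz : ‖tensorConj z z‖ ≤ n)
    {κ : ℝ} (hκ : 0 ≤ κ) (hκ1 : κ ≤ 1) (huz : (1 - κ ^ 2) * n < ‖tensorConj u z‖) :
    ∃ (W V ξ η : Matrix (Fin N) (Fin N) ℂ) (r : ℝ), W.conjTranspose * W = 1 ∧
      V.conjTranspose * V = 1 ∧ N * r ^ 2 = 1 ∧ hsSq ξ = 1 ∧ hsSq η = 1 ∧
      (1 - κ ^ 2) * n < (hsInner (tensorAct u z ξ) η).re ∧
      hsSq (ξ - (r : ℂ) • V) ≤ (760 * κ) ^ 2 ∧ hsSq (η - (r : ℂ) • W) ≤ (1320 * κ) ^ 2 := by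
  have hκ2 : κ ^ 2 ≤ 1 := by nlinarith
  have hn0 : (0 : ℝ) < n := by exact_mod_cast hn
  have hN0 : (0 : ℝ) < N := by exact_mod_cast hN
  obtain ⟨ξ, η, hξ1, hη1, hξη⟩ := exists_hsInner_tensorAct_gt
    (mul_nonneg (by linarith) hn0.le) huz
  obtain ⟨U, V, s, hU, hV, hs, hξ⟩ := exists_svd ξ
  obtain ⟨U', V', s', hU', hV', hs', hη⟩ := exists_svd η
  have hs1 : ∑ i, s i ^ 2 = 1 := by
    rw [← hξ1, hξ, hsSq_mul_right (by simpa using hV), hsSq_mul_left hU, hsSq_diagonal]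
    simp
  have hs1' : ∑ i, s' i ^ 2 = 1 := by
    rw [← hη1, hη, hsSq_mul_right (by simpa using hV'), hsSq_mul_left hU', hsSq_diagonal]
    simp
  obtain ⟨P, Q, hPQ, hPP, hP, hQ⟩ := exists_factor_of_svd hU hV hs hs1
  obtain ⟨R, Z, hRZ, hRR, hR, hZ⟩ := exists_factor_of_svd hU' hV' hs' hs1'
  have hint := sum_hsSq_intertwine_le hu hz hP hQ hR hZ hκ2 (by
    rw [← hPQ, ← hRZ, ← hξ, ← hη]; exact hξη)
  set A := P * P.conjTranspose with hA
  set B := R * R.conjTranspose with hB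
  have hclass : ∀ (I : Finset (Fin n)) (g : Matrix (Fin N) (Fin N) ℂ), n ≤ 10 * I.card →
      (∀ j ∈ I, u j = g) → hsSq (g * A - B * g) ≤ 40 * κ ^ 2 := by
    intro I g hI hg
    have := mul_le_of_sum_le (fun j => hsSq_nonneg _) hint hI (hsSq_nonneg (g * A - B * g))
      fun j hj => by rw [hg j hj]
    refine le_of_mul_le_mul_left ?_ hn0
    linarith
  have hAB : hsSq (A - B) ≤ 40 * κ ^ 2 := by
    simpa using hclass I₀ 1 huw.2.2.1 huw.1
  have hcomm : ∀ k, hsSq (w k * A - A * w k) ≤ 160 * κ ^ 2 := by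
    intro k
    have h1 := hsSq_sub_le (w k * A) (B * w k) (A * w k)
    have h2 := hclass (I k) (w k) (huw.2.2.2 k) (huw.2.1 k)
    rw [← Matrix.sub_mul, hsSq_mul_right (mul_eq_one_comm.mp (hw.1 k)), hsSq_sub_comm B] at h1
    linarith
  obtain ⟨c, hc⟩ := hw.2 A
  -- `288000 = 600 · 3 · 160`.
  have hAc : hsSq (A - c • 1) ≤ 288000 * κ ^ 2 := by
    rw [Fin.sum_univ_three] at hc
    linarith [hcomm 0, hcomm 1, hcomm 2]
  have hBc : hsSq (B - c • 1) ≤ 864000 * κ ^ 2 := by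
    have h1 := hsSq_sub_le B A (c • 1)
    rw [hsSq_sub_comm B A] at h1
    linarith [sq_nonneg κ]
  set r : ℝ := (√N)⁻¹ with hr
  have hr0 : 0 ≤ r := by positivity
  have hrN : N * r ^ 2 = 1 := by
    rw [hr, inv_pow, Real.sq_sqrt hN0.le, mul_inv_cancel₀ hN0.ne']
  -- `sum_sub_sq_le_of_close` doubles the distance to scalars, and `2 · 288000 ≤ 760²`. Similarly `2
  -- · 864000 ≤ 1320²` for `η`.
  have hsr : ∑ i, (s i - r) ^ 2 ≤ (760 * κ) ^ 2 := by
    have h1 : ∑ i, ‖(s i : ℂ) - c‖ ^ 2 ≤ 288000 * κ ^ 2 := by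
      rw [← hsSq_conj_diagonal_sub hU hU, hPP, mul_eq_one_comm.mp hU]
      exact hAc
    have h2 := sum_sub_sq_le_of_close hs hs1 h1 hr0 hrN
    nlinarith [sq_nonneg κ]
  have hsr' : ∑ i, (s' i - r) ^ 2 ≤ (1320 * κ) ^ 2 := by
    have h1 : ∑ i, ‖(s' i : ℂ) - c‖ ^ 2 ≤ 864000 * κ ^ 2 := by
      rw [← hsSq_conj_diagonal_sub hU' hU', hRR, mul_eq_one_comm.mp hU']
      exact hBc
    have h2 := sum_sub_sq_le_of_close hs' hs1' h1 hr0 hrN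
    nlinarith [sq_nonneg κ]
  refine ⟨U' * V'.conjTranspose, U * V.conjTranspose, ξ, η, r, unitary_mul_conjTranspose hU' hV',
    unitary_mul_conjTranspose hU hV, hrN, hξ1, hη1, hξη, ?_, ?_⟩
  · rw [hξ, hsSq_conj_diagonal_sub hU hV]
    simp only [← Complex.ofReal_sub, Complex.norm_real, Real.norm_eq_abs, sq_abs]
    exact hsr
  · rw [hη, hsSq_conj_diagonal_sub hU' hV']
    simp only [← Complex.ofReal_sub, Complex.norm_real, Real.norm_eq_abs, sq_abs]
    exact hsr'

/-- If `∑ u_j ⊗ conj(z_j)` has nearly the largest possible norm, where the tuple `u` of unitaries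
contains a quantum expander, then `z` is close to `u` up to multiplication by unitaries. -/
theorem exists_unitary_close {u z : Fin n → Matrix (Fin N) (Fin N) ℂ}
    {w : Fin 3 → Matrix (Fin N) (Fin N) ℂ} (hw : HasGap w) {I₀ : Finset (Fin n)}
    {I : Fin 3 → Finset (Fin n)} (huw : Contains u w I₀ I) (hn : 1 ≤ n) (hN : 1 ≤ N)
    (hu : ∀ j, (u j).conjTranspose * u j = 1) (hz : ‖tensorConj z z‖ ≤ n)
    {κ : ℝ} (hκ : 0 ≤ κ) (hκ1 : κ ≤ 1) (huz : (1 - κ ^ 2) * n < ‖tensorConj u z‖) :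
    ∃ W V : Matrix (Fin N) (Fin N) ℂ, W.conjTranspose * W = 1 ∧ V.conjTranspose * V = 1 ∧
      ∑ j, hsSq (u j - W * z j * V.conjTranspose) ≤ 4200 * κ * (n * N) := by
  have hn0 : (0 : ℝ) < n := by exact_mod_cast hn
  have hN0 : (0 : ℝ) < N := by exact_mod_cast hN
  obtain ⟨W₀, V₀, ξ, η, r, hW₀u, hV₀u, hrN, hξ1, hη1, hξη, hξr, hηr⟩ :=
    exists_unitary_near_maximizer hw huw hn hN hu hz hκ hκ1 huz
  have hV₀1 : hsSq ((r : ℂ) • V₀) = 1 := by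
    rw [hsSq_smul, hsSq_of_unitary hV₀u, Complex.norm_real, Real.norm_eq_abs, sq_abs, mul_comm, hrN]
  have hT : ‖tensorConj u z‖ ≤ n := by
    refine (norm_tensorConj_le u z).trans ?_
    have h1 : ‖tensorConj u u‖ ≤ n :=
      norm_tensorConj_self_le fun j => norm_le_one_of_unitary (hu j)
    calc √‖tensorConj u u‖ * √‖tensorConj z z‖ ≤ √n * √n :=
          mul_le_mul (Real.sqrt_le_sqrt h1) (Real.sqrt_le_sqrt hz) (Real.sqrt_nonneg _)
            (Real.sqrt_nonneg _)
      _ = n := Real.mul_self_sqrt hn0.le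
  -- Replacing `ξ` and `η` by multiples of unitaries loses at most `(760 + 1320) κ n`; with `κ² ≤ κ`
  -- the total loss is below `2100 κ n`.
  have hpert : (1 - 2100 * κ) * n ≤
      (hsInner (tensorAct u z ((r : ℂ) • V₀)) ((r : ℂ) • W₀)).re := by
    have e1 := norm_hsInner_tensorAct_le u z (ξ - (r : ℂ) • V₀) η
    have e2 := norm_hsInner_tensorAct_le u z ((r : ℂ) • V₀) (η - (r : ℂ) • W₀)
    rw [hη1, Real.sqrt_one, mul_one] at e1
    rw [hV₀1, Real.sqrt_one, mul_one] at e2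
    have e3 : ‖tensorConj u z‖ * √(hsSq (ξ - (r : ℂ) • V₀)) ≤ n * (760 * κ) :=
      mul_le_mul hT (Real.sqrt_le_iff.mpr ⟨by positivity, hξr⟩) (Real.sqrt_nonneg _) hn0.le
    have e4 : ‖tensorConj u z‖ * √(hsSq (η - (r : ℂ) • W₀)) ≤ n * (1320 * κ) :=
      mul_le_mul hT (Real.sqrt_le_iff.mpr ⟨by positivity, hηr⟩) (Real.sqrt_nonneg _) hn0.le
    have e5 := (Complex.re_le_norm
      (hsInner (tensorAct u z (ξ - (r : ℂ) • V₀)) η)).trans (e1.trans e3)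
    have e6 := (Complex.re_le_norm
      (hsInner (tensorAct u z ((r : ℂ) • V₀)) (η - (r : ℂ) • W₀))).trans (e2.trans e4)
    rw [tensorAct_sub, hsInner_sub_left, Complex.sub_re] at e5
    rw [hsInner_sub_right, Complex.sub_re] at e6
    have e7 : κ ^ 2 * n ≤ κ * n := mul_le_mul_of_nonneg_right (by nlinarith) hn0.le
    linarith
  have hinner : (1 - 2100 * κ) * (n * N) ≤
      ∑ j, (hsInner (u j) (W₀ * z j * V₀.conjTranspose)).re := by
    rw [tensorAct_smul, hsInner_smul_left, hsInner_smul_right, hsInner_tensorAct, ← mul_assoc,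
      ← Complex.ofReal_mul, Complex.re_ofReal_mul, ← sq, Complex.re_sum] at hpert
    have e1 : ∀ j, hsInner (u j * V₀ * (z j).conjTranspose) W₀ =
        hsInner (u j) (W₀ * z j * V₀.conjTranspose) := by
      intro j
      rw [hsInner_eq_trace, hsInner_eq_trace]
      simp [Matrix.mul_assoc]
    simp only [e1] at hpert
    have e2 := mul_le_mul_of_nonneg_left hpert hN0.le
    rw [← mul_assoc (N : ℝ) (r ^ 2), hrN, one_mul] at e2
    linarith
  -- Testing `∑ z_j ⊗ conj(z_j)` on the identity. Expanding the squared distance then gives at most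
  -- `nN + nN - 2 (1 - 2100 κ) nN = 4200 κ nN`.
  have hzsq : ∑ j, hsSq (z j) ≤ n * N := by
    have e1 := (Complex.re_le_norm (hsInner (tensorAct z z 1) 1)).trans
      (norm_hsInner_tensorAct_le z z (1 : Matrix (Fin N) (Fin N) ℂ) 1)
    rw [hsInner_tensorAct, hsSq_one, Fintype.card_fin, mul_assoc, Real.mul_self_sqrt hN0.le,
      Complex.re_sum] at e1
    have e2 : ∀ j, hsInner (z j * 1 * (z j).conjTranspose) (1 : Matrix (Fin N) (Fin N) ℂ) =
        hsSq (z j) := by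
      intro j
      rw [hsInner_eq_trace, ofReal_hsSq]
      simp
    simp only [e2, Complex.ofReal_re] at e1
    exact e1.trans (mul_le_mul_of_nonneg_right hz hN0.le)
  refine ⟨W₀, V₀, hW₀u, hV₀u, ?_⟩
  have hterm : ∀ j, hsSq (u j - W₀ * z j * V₀.conjTranspose) =
      N + hsSq (z j) - 2 * (hsInner (u j) (W₀ * z j * V₀.conjTranspose)).re := by
    intro j
    rw [hsSq_sub, hsSq_of_unitary (hu j), hsSq_mul_right (by simpa using hV₀u), hsSq_mul_left hW₀u]
  simp only [hterm]
  rw [Finset.sum_sub_distrib, Finset.sum_add_distrib, ← Finset.mul_sum, Finset.sum_const,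
    Finset.card_univ, Fintype.card_fin, nsmul_eq_mul]
  linarith

end Rigidity

/-! ### Tuples of unitaries that no common tuple almost norms. -/

section Separation

variable {n N : ℕ}

/-- Two tuples of unitaries that contain the same quantum expander and are close up to
multiplication by unitaries are close. -/
theorem sum_hsSq_sub_le_of_equivalent {u v : Fin n → Matrix (Fin N) (Fin N) ℂ}
    {w : Fin 3 → Matrix (Fin N) (Fin N) ℂ} (hw : HasGap w) {I₀ : Finset (Fin n)}
    {I : Fin 3 → Finset (Fin n)} (huw : Contains u w I₀ I) (hvw : Contains v w I₀ I)
    (hn : 1 ≤ n) (hN : 1 ≤ N) (hu : ∀ j, (u j).conjTranspose * u j = 1)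
    (hv : ∀ j, (v j).conjTranspose * v j = 1) {g h : Matrix (Fin N) (Fin N) ℂ}
    (hg : g.conjTranspose * g = 1) (hh : h.conjTranspose * h = 1) {δ : ℝ} (hδ0 : 0 ≤ δ)
    (hδ : δ ≤ 1 / 1152000) (hclose : ∑ j, hsSq (g * u j * h - v j) ≤ 4 * δ * (n * N)) :
    ∑ j, hsSq (u j - v j) ≤ 12000000 * δ * (n * N) := by
  have hn0 : (0 : ℝ) < n := by exact_mod_cast hn
  have hN0 : (0 : ℝ) < N := by exact_mod_cast hN
  have hh' := mul_eq_one_comm.mp hh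
  have hmove : ∀ a b : Matrix (Fin N) (Fin N) ℂ,
      hsSq (g * a - b * h.conjTranspose) = hsSq (g * a * h - b) := by
    intro a b
    rw [← hsSq_mul_right hh' (g * a - b * h.conjTranspose), Matrix.sub_mul,
      Matrix.mul_assoc b, hh, Matrix.mul_one]
  have hclass : ∀ (I : Finset (Fin n)) (a : Matrix (Fin N) (Fin N) ℂ), n ≤ 10 * I.card →
      (∀ j ∈ I, u j = a) → (∀ j ∈ I, v j = a) →
      hsSq (g * a - a * h.conjTranspose) ≤ 40 * δ * N := by
    intro I a hI hua hva
    rw [hmove]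
    have := mul_le_of_sum_le (fun j => hsSq_nonneg _) hclose hI (hsSq_nonneg (g * a * h - a))
      fun j hj => by rw [hua j hj, hva j hj]
    refine le_of_mul_le_mul_left ?_ hn0
    linarith
  -- The copies of `1` in both tuples give `g h ≈ 1`; those of `w_k` then show that `g` almost
  -- commutes with the expander.
  have hgh : hsSq (h.conjTranspose - g) ≤ 40 * δ * N := by
    rw [hsSq_sub_comm]
    simpa using hclass I₀ 1 huw.2.2.1 huw.1 hvw.1
  have hcomm : ∀ k, hsSq (w k * g - g * w k) ≤ 160 * δ * N := by
    intro k
    have h1 := hsSq_sub_le (g * w k) (w k * h.conjTranspose) (w k * g)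
    have h2 := hclass (I k) (w k) (huw.2.2.2 k) (huw.2.1 k) (hvw.2.1 k)
    rw [← Matrix.mul_sub, hsSq_mul_left (hw.1 k), hsSq_sub_comm (g * w k) (w k * g)] at h1
    linarith
  obtain ⟨c, hc⟩ := hw.2 g
  have hgc : hsSq (g - c • 1) ≤ 288000 * δ * N := by
    rw [Fin.sum_univ_three] at hc
    linarith [hcomm 0, hcomm 1, hcomm 2]
  -- The scalar cannot be small because `g` is unitary: `N ≤ 2 · N/4 + 2 ‖c‖² N`. This is the source
  -- of the upper bound on `δ`.
  have hcsq : 1 / 4 ≤ ‖c‖ ^ 2 := by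
    have h1 := hsSq_add_le (g - c • 1) (c • 1)
    rw [sub_add_cancel, hsSq_of_unitary hg, hsSq_smul, hsSq_one, Fintype.card_fin] at h1
    have h2 : 288000 * δ * N ≤ N / 4 := by nlinarith
    refine le_of_mul_le_mul_right ?_ hN0
    linarith
  -- The chain `c u_j ≈ g u_j ≈ v_j h^* ≈ v_j g ≈ c v_j`.
  have hterm : ∀ j, ‖c‖ ^ 2 * hsSq (u j - v j) ≤
      2880320 * δ * N + 4 * hsSq (g * u j * h - v j) := by
    intro j
    have h1 := hsSq_sub_le (c • u j) (g * u j) (c • v j)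
    have h2 := hsSq_sub_le (g * u j) (v j * h.conjTranspose) (c • v j)
    have h3 := hsSq_sub_le (v j * h.conjTranspose) (v j * g) (c • v j)
    have e1 : hsSq (c • u j - g * u j) = hsSq (g - c • 1) := by
      rw [hsSq_sub_comm, ← hsSq_mul_right (mul_eq_one_comm.mp (hu j)) (g - c • 1), Matrix.sub_mul]
      simp
    have e2 : hsSq (v j * h.conjTranspose - v j * g) = hsSq (h.conjTranspose - g) := by
      rw [← Matrix.mul_sub, hsSq_mul_left (hv j)]
    have e3 : hsSq (v j * g - c • v j) = hsSq (g - c • 1) := by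
      rw [← hsSq_mul_left (hv j) (g - c • 1), Matrix.mul_sub]
      simp
    rw [e1] at h1
    rw [hmove] at h2
    rw [e2, e3] at h3
    rw [← hsSq_smul, smul_sub]
    linarith
  have hsum := Finset.sum_le_sum fun j (_ : j ∈ Finset.univ) => hterm j
  rw [← Finset.mul_sum, Finset.sum_add_distrib, Finset.sum_const, Finset.card_univ,
    Fintype.card_fin, nsmul_eq_mul, ← Finset.mul_sum] at hsum
  have hpos : 0 ≤ ∑ j, hsSq (u j - v j) := Finset.sum_nonneg fun j _ => hsSq_nonneg _
  have h1 : 1 / 4 * ∑ j, hsSq (u j - v j) ≤ ‖c‖ ^ 2 * ∑ j, hsSq (u j - v j) :=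
    mul_le_mul_of_nonneg_right hcsq hpos
  have h2 : 0 ≤ δ * (n * N) := by positivity
  linarith

/-- Two tuples of unitaries that contain the same quantum expander and nearly norm the same `z`
are close. -/
theorem sum_hsSq_sub_le_of_common {u v z : Fin n → Matrix (Fin N) (Fin N) ℂ}
    {w : Fin 3 → Matrix (Fin N) (Fin N) ℂ} (hw : HasGap w) {I₀ : Finset (Fin n)}
    {I : Fin 3 → Finset (Fin n)} (huw : Contains u w I₀ I) (hvw : Contains v w I₀ I)
    (hn : 1 ≤ n) (hN : 1 ≤ N) (hu : ∀ j, (u j).conjTranspose * u j = 1)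
    (hv : ∀ j, (v j).conjTranspose * v j = 1) (hz : ‖tensorConj z z‖ ≤ n)
    {κ : ℝ} (hκ : 0 ≤ κ) (hκ1 : κ ≤ 1 / 4838400000) (huz : (1 - κ ^ 2) * n < ‖tensorConj u z‖)
    (hvz : (1 - κ ^ 2) * n < ‖tensorConj v z‖) :
    ∑ j, hsSq (u j - v j) ≤ 50400000000 * κ * (n * N) := by
  have hκ2 : κ ≤ 1 := hκ1.trans (by norm_num)
  obtain ⟨W, V, hW, hV, h1⟩ := exists_unitary_close hw huw hn hN hu hz hκ hκ2 huz
  obtain ⟨W', V', hW', hV', h2⟩ := exists_unitary_close hw hvw hn hN hv hz hκ hκ2 hvz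
  have hg := unitary_mul_conjTranspose hW' hW
  have hh := unitary_mul_conjTranspose hV hV'
  have h := sum_hsSq_sub_le_of_equivalent hw huw hvw hn hN hu hv hg hh (δ := 4200 * κ)
    (by positivity) (by linarith) ?_
  · linarith
  have hterm : ∀ j, hsSq (W' * W.conjTranspose * u j * (V * V'.conjTranspose) - v j) ≤
      2 * hsSq (u j - W * z j * V.conjTranspose) +
        2 * hsSq (v j - W' * z j * V'.conjTranspose) := by
    intro j
    have h3 := hsSq_sub_le (W' * W.conjTranspose * u j * (V * V'.conjTranspose))
      (W' * z j * V'.conjTranspose) (v j)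
    have h4 : W' * W.conjTranspose * u j * (V * V'.conjTranspose) - W' * z j * V'.conjTranspose =
        W' * W.conjTranspose * (u j - W * z j * V.conjTranspose) * (V * V'.conjTranspose) := by
      have h5 : W' * W.conjTranspose * (W * z j * V.conjTranspose) * (V * V'.conjTranspose) =
          W' * (W.conjTranspose * W) * z j * (V.conjTranspose * V) * V'.conjTranspose := by
        simp only [Matrix.mul_assoc]
      rw [Matrix.mul_sub, Matrix.sub_mul, h5, hW, hV]
      simp
    rw [h4, hsSq_mul_right (mul_eq_one_comm.mp hh), hsSq_mul_left hg,
      hsSq_sub_comm (W' * z j * V'.conjTranspose) (v j)] at h3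
    exact h3
  refine (Finset.sum_le_sum fun j _ => hterm j).trans ?_
  rw [Finset.sum_add_distrib, ← Finset.mul_sum, ← Finset.mul_sum]
  linarith

/-- The indices in a residue class modulo `5`. -/
def residueClass (n r : ℕ) : Finset (Fin n) := {j | j.val % 5 = r}

/-- `n ≤ 10 ⌊n/5⌋` as soon as `n ≥ 5`; this is where `n₀ = 5` comes from. -/
theorem le_card_residueClass {n r : ℕ} (hn : 5 ≤ n) (hr : r < 5) :
    n ≤ 10 * (residueClass n r).card := by
  have h : n / 5 ≤ (residueClass n r).card := by
    have := Finset.card_le_card_of_injOn (s := (Finset.univ : Finset (Fin (n / 5))))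
      (t := residueClass n r) (fun m => ⟨5 * m.val + r, by omega⟩)
      (by intro m _; simp [residueClass]; omega)
      (by intro m _ m' _ h; simp at h; exact Fin.ext (by omega))
    simpa using this
  omega

/-- There are exponentially many tuples of unitaries no two of which nearly norm the same `z`. -/
theorem exists_separated_tuples (n N : ℕ) (hn : 5 ≤ n) (hN : 1 ≤ N) :
    ∃ T : Finset (Fin n → Matrix (Fin N) (Fin N) ℂ),
      (∀ u ∈ T, ∀ j, (u j).conjTranspose * u j = 1) ∧
      (∀ u ∈ T, ∀ v ∈ T, u ≠ v → ∀ z : Fin n → Matrix (Fin N) (Fin N) ℂ,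
        ‖tensorConj z z‖ ≤ n → (1 - 1 / 10 ^ 26) * n < ‖tensorConj u z‖ →
        ‖tensorConj v z‖ ≤ (1 - 1 / 10 ^ 26) * n) ∧
      Real.exp (1 / 500 * n * (N : ℝ) ^ 2) ≤ T.card := by
  classical
  obtain ⟨w, hw⟩ := exists_expander N hN
  obtain ⟨T, hT, hsep, hcard⟩ := exists_packing (residueClass n 4) N
  -- Residue classes `0` to `3` hold `1` and the three expander matrices; class `4` is free and
  -- carries the packing.
  let F : (residueClass n 4 → Matrix (Fin N) (Fin N) ℂ) → Fin n → Matrix (Fin N) (Fin N) ℂ :=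
    fun t j => if h : j ∈ residueClass n 4 then t ⟨j, h⟩ else
      if j.val % 5 = 0 then 1 else if j.val % 5 = 1 then w 0 else if j.val % 5 = 2 then w 1 else w 2
  have hF4 : ∀ t (j : residueClass n 4), F t j = t j := by
    intro t j
    simp only [F]
    rw [dif_pos j.2]
  have hFw : ∀ t, Contains (F t) w (residueClass n 0) (fun k => residueClass n (k.val + 1)) := by
    intro t
    refine ⟨fun j hj => ?_, fun k j hj => ?_, le_card_residueClass hn (by omega),
      fun k => le_card_residueClass hn (by omega)⟩
    · have h : j.val % 5 = 0 := by simpa [residueClass] using hj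
      simp [F, residueClass, h]
    · have h : j.val % 5 = k.val + 1 := by simpa [residueClass] using hj
      fin_cases k <;> simp [F, residueClass, h]
  have hFinj : Function.Injective F := by
    intro t t' h
    ext1 j
    rw [← hF4 t, ← hF4 t', h]
  have hJ : (n : ℝ) / 10 ≤ Fintype.card (residueClass n 4) := by
    have h := le_card_residueClass hn (r := 4) (by omega)
    rw [Fintype.card_coe]
    have h1 : (n : ℝ) ≤ 10 * (residueClass n 4).card := by exact_mod_cast h
    linarith
  have hFu : ∀ t ∈ T, ∀ j, (F t j).conjTranspose * F t j = 1 := by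
    intro t ht j
    simp only [F]
    split_ifs
    · exact hT t ht _
    · simp
    · exact hw.1 0
    · exact hw.1 1
    · exact hw.1 2
  refine ⟨T.map ⟨F, hFinj⟩, ?_, ?_, ?_⟩
  · intro u hu
    obtain ⟨t, ht, rfl⟩ := Finset.mem_map.mp hu
    exact hFu t ht
  · intro u hu v hv huv z hz huz
    obtain ⟨t, ht, rfl⟩ := Finset.mem_map.mp hu
    obtain ⟨t', ht', rfl⟩ := Finset.mem_map.mp hv
    by_contra! hvz
    -- With `κ = 10⁻¹³` rigidity gives a distance of at most `0.00504 nN`, while the packing has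
    -- separation at least `(n/10) N/4 = 0.025 nN`.
    have hκ : (1 - 1 / 10 ^ 26 : ℝ) = 1 - (1 / 10 ^ 13) ^ 2 := by norm_num
    rw [hκ] at huz hvz
    have h1 := sum_hsSq_sub_le_of_common hw (hFw t) (hFw t') (by omega) hN (hFu t ht) (hFu t' ht')
      hz (by norm_num) (by norm_num) huz hvz
    have h2 := hsep t ht t' ht' fun h => huv (by rw [h])
    have h3 : ∑ j, hsSq (t j - t' j) ≤ ∑ j, hsSq (F t j - F t' j) := by
      have h4 : ∑ j, hsSq (t j - t' j) = ∑ j ∈ residueClass n 4, hsSq (F t j - F t' j) := by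
        rw [← Finset.sum_coe_sort (residueClass n 4) fun j => hsSq (F t j - F t' j)]
        simp only [hF4]
      rw [h4]
      exact Finset.sum_le_sum_of_subset_of_nonneg (Finset.subset_univ _) fun j _ _ => hsSq_nonneg _
    have hn0 : (0 : ℝ) < n := by exact_mod_cast (by omega : 0 < n)
    have hN0 : (0 : ℝ) < N := by exact_mod_cast hN
    have h5 : (n : ℝ) / 10 * N ≤ Fintype.card (residueClass n 4) * N := by gcongr
    have h6 : (0 : ℝ) < n * N := by positivity
    linarith
  · rw [Finset.card_map]
    refine le_trans (Real.exp_le_exp.mpr ?_) hcard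
    have h1 : (n : ℝ) / 10 * (N : ℝ) ^ 2 ≤ Fintype.card (residueClass n 4) * (N : ℝ) ^ 2 := by gcongr
    linarith

end Separation

/-! ### From separated tuples to a lower bound for the multiplicity. -/

section Multiplicity

variable {E F : Type*} [AddCommGroup E] [Module ℂ E] [AddCommGroup F] [Module ℂ F] {n N : ℕ}

/-- The element `∑ x_j ⊗ e_j` of `M_N(E)`. -/
def tupleElement (e : Fin n → E) (x : Fin n → Matrix (Fin N) (Fin N) ℂ) :
    Matrix (Fin N) (Fin N) E :=
  Matrix.of fun a b => ∑ j, x j a b • e j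

/-- The tuple of the complex conjugates of the values of a linear map at the vectors `e_j`. -/
def conjTuple {k : ℕ} (e : Fin n → E) (w : E →ₗ[ℂ] Matrix (Fin k) (Fin k) ℂ) :
    Fin n → Matrix (Fin k) (Fin k) ℂ :=
  fun j => (w (e j)).map (starRingEnd ℂ)

/-- The conjugations in `conjTuple` and `tensorConj` cancel, so that norms in `M_N(M_k)` take the
form to which Haagerup's inequality applies. -/
theorem norm_amplify_tupleElement {k : ℕ} (e : Fin n → E) (w : E →ₗ[ℂ] Matrix (Fin k) (Fin k) ℂ)
    (x : Fin n → Matrix (Fin N) (Fin N) ℂ) :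
    (matrixSpace (Fin k) (Fin k)).norm N (amplify w N (tupleElement e x)) =
      ‖tensorConj x (conjTuple e w)‖ := by
  change ‖Matrix.comp (Fin N) (Fin N) (Fin k) (Fin k) ℂ (amplify w N (tupleElement e x))‖ = _
  congr 1
  ext ⟨i, a⟩ ⟨j, b⟩
  simp [tensorConj, conjTuple, amplify, tupleElement, Matrix.sum_apply]

theorem norm_amplify_le_of_amplifyNorm (S : OperatorSpace E) (T : OperatorSpace F) (f : E →ₗ[ℂ] F)
    (h : amplifyNorm S T f N ≠ ⊤) (x : Matrix (Fin N) (Fin N) E) :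
    T.norm N (amplify f N x) ≤ (amplifyNorm S T f N).toReal * S.norm N x := by
  rcases (S.norm_nonneg N x).eq_or_lt with h0 | h0
  · have hx := S.eq_zero_of_norm N x h0.symm
    have : amplify f N x = 0 := by rw [hx]; ext; simp [amplify]
    rw [this, T.norm_zero, ← h0, mul_zero]
  · set c : ℂ := (((S.norm N x)⁻¹ : ℝ) : ℂ) with hc
    have hcn : ‖c‖ = (S.norm N x)⁻¹ := by
      rw [hc, Complex.norm_real, Real.norm_of_nonneg (by positivity)]
    have h1 : S.norm N (c • x) ≤ 1 := by
      rw [S.smul_eq, hcn, inv_mul_cancel₀ h0.ne']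
    have h2 : ENNReal.ofReal (T.norm N (amplify f N (c • x))) ≤ amplifyNorm S T f N :=
      le_iSup₂ (f := fun (x : Matrix (Fin N) (Fin N) E) (_ : S.norm N x ≤ 1) =>
        ENNReal.ofReal (T.norm N (amplify f N x))) (c • x) h1
    have h3 := (ENNReal.ofReal_le_iff_le_toReal h).mp h2
    rw [amplify_smul, T.smul_eq, hcn, inv_mul_le_iff₀ h0, mul_comm] at h3
    exact h3

/-- Linear maps `M_N(E) → M_N(M_N)` of the form `w_N` with norm at most `1` send the `e_j` to tuples
with `‖∑ z_j ⊗ conj(z_j)‖ ≤ β²`, and the norm of `∑ u_j ⊗ e_j` in `M_N(E)` is as large as this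
allows for all tuples of unitaries. -/
structure NormsUnitaries (S : OperatorSpace E) (e : Fin n → E) (N : ℕ) (β : ℝ) : Prop where
  pos : 0 < β
  le_norm : ∀ u : Fin n → Matrix (Fin N) (Fin N) ℂ, (∀ j, (u j).conjTranspose * u j = 1) →
    √n * β ≤ S.norm N (tupleElement e u)
  norm_le : ∀ w : E →ₗ[ℂ] Matrix (Fin N) (Fin N) ℂ,
    (∀ x, (matrixSpace (Fin N) (Fin N)).norm N (amplify w N x) ≤ S.norm N x) →
    ‖tensorConj (conjTuple e w) (conjTuple e w)‖ ≤ β ^ 2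

/-- Positivity excludes `k = 0`, where the supremum is `0` by convention; otherwise a finite
supremum is attained. -/
theorem exists_coordinate_ge {k : ℕ} (x : Matrix (Fin N) (Fin N) (Fin k → Matrix (Fin N) (Fin N) ℂ))
    (hx : 0 < (directSum k N).norm N x) :
    ∃ i, (directSum k N).norm N x ≤
      (matrixSpace (Fin N) (Fin N)).norm N (amplify (LinearMap.proj i) N x) := by
  have h : (directSum k N).norm N x =
    ⨆ i, (matrixSpace (Fin N) (Fin N)).norm N (amplify (LinearMap.proj i) N x) := rfl
  rcases isEmpty_or_nonempty (Fin k) with hk | hk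
  · rw [h, Real.iSup_of_isEmpty] at hx
    exact absurd hx (lt_irrefl 0)
  · obtain ⟨i, hi⟩ := exists_eq_ciSup_of_finite
      (f := fun i => (matrixSpace (Fin N) (Fin N)).norm N (amplify (LinearMap.proj i) N x))
    exact ⟨i, by rw [h, ← hi]⟩

theorem coordinate_le {k : ℕ} (x : Matrix (Fin N) (Fin N) (Fin k → Matrix (Fin N) (Fin N) ℂ))
    (i : Fin k) : (matrixSpace (Fin N) (Fin N)).norm N (amplify (LinearMap.proj i) N x) ≤
      (directSum k N).norm N x :=
  MatrixSeminorm.le_sup (fun i : Fin k =>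
    (matrixSpace (Fin N) (Fin N)).toMatrixSeminorm.pullback (LinearMap.proj i))
    (fun _ _ => Set.finite_range _ |>.bddAbove) i N x

/-- The maps are the coordinates of an isomorphism onto `V`, divided by its norm at level `N`. The
strict inequality on the distance provides an actual isomorphism, since the infimum need not be
attained. -/
theorem exists_norming_maps {S : OperatorSpace E} {k : ℕ}
    {V : Submodule ℂ (Fin k → Matrix (Fin N) (Fin N) ℂ)} {C : ℝ}
    (hV : matrixDist S ((directSum k N).restrict V) N < ENNReal.ofReal C)
    (hS : ∃ x, 0 < S.norm N x) :
    ∃ w : Fin k → E →ₗ[ℂ] Matrix (Fin N) (Fin N) ℂ,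
      (∀ i x, (matrixSpace (Fin N) (Fin N)).norm N (amplify (w i) N x) ≤ S.norm N x) ∧
      ∀ x, 0 < S.norm N x → ∃ i, S.norm N x <
        C * (matrixSpace (Fin N) (Fin N)).norm N (amplify (w i) N x) := by
  obtain ⟨f, hf⟩ := iInf_lt_iff.mp hV
  set T := (directSum k N).restrict V with hT
  set a := amplifyNorm S T f.toLinearMap N with ha
  set b := amplifyNorm T S f.symm.toLinearMap N with hb
  have hinv : ∀ x : Matrix (Fin N) (Fin N) E,
      amplify f.symm.toLinearMap N (amplify f.toLinearMap N x) = x := by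
    intro x; ext i j; simp [amplify]
  obtain ⟨x₀, hx₀⟩ := hS
  -- In `[0, ∞]` a finite product may be `0 · ∞`. A zero factor is impossible because `E` has an
  -- element of positive norm.
  have hfin : a < ⊤ ∧ b < ⊤ := by
    rcases ENNReal.mul_lt_top_iff.mp (hf.trans ENNReal.ofReal_lt_top) with h | h | h
    · exact h
    · have h1 := norm_amplify_le_of_amplifyNorm S T f.toLinearMap (N := N)
        (by rw [← ha, h]; exact ENNReal.zero_ne_top) x₀
      rw [← ha, h, ENNReal.toReal_zero, zero_mul] at h1
      have h2 := T.eq_zero_of_norm N _ (le_antisymm h1 (T.norm_nonneg _ _))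
      have h3 := hinv x₀
      rw [h2] at h3
      have h4 : x₀ = 0 := by rw [← h3]; ext; simp [amplify]
      rw [h4, S.norm_zero] at hx₀
      exact absurd hx₀ (lt_irrefl 0)
    · have h1 := norm_amplify_le_of_amplifyNorm T S f.symm.toLinearMap (N := N)
        (by rw [← hb, h]; exact ENNReal.zero_ne_top) (amplify f.toLinearMap N x₀)
      rw [← hb, h, ENNReal.toReal_zero, zero_mul, hinv] at h1
      exact absurd hx₀ (not_lt.mpr h1)
  have hA := norm_amplify_le_of_amplifyNorm S T f.toLinearMap (N := N) hfin.1.ne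
  have hB : ∀ x, S.norm N x ≤ b.toReal * T.norm N (amplify f.toLinearMap N x) := by
    intro x
    have := norm_amplify_le_of_amplifyNorm T S f.symm.toLinearMap (N := N) hfin.2.ne
      (amplify f.toLinearMap N x)
    rwa [hinv] at this
  have hab : a.toReal * b.toReal < C := by
    rw [← ENNReal.toReal_mul]
    refine (ENNReal.lt_ofReal_iff_toReal_lt ?_).mp hf
    exact (ENNReal.mul_lt_top hfin.1 hfin.2).ne
  have ha0 : 0 < a.toReal := by
    refine lt_of_le_of_ne ENNReal.toReal_nonneg fun h => ?_
    have h1 := hA x₀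
    rw [← ha, ← h, zero_mul] at h1
    have h2 := (hB x₀).trans (mul_le_mul_of_nonneg_left h1 ENNReal.toReal_nonneg)
    rw [mul_zero] at h2
    exact absurd hx₀ (not_lt.mpr h2)
  set w : Fin k → E →ₗ[ℂ] Matrix (Fin N) (Fin N) ℂ := fun i =>
    (((a.toReal)⁻¹ : ℝ) : ℂ) • (LinearMap.proj i ∘ₗ V.subtype ∘ₗ f.toLinearMap) with hw
  have hamp : ∀ i x, (matrixSpace (Fin N) (Fin N)).norm N (amplify (w i) N x) =
      (a.toReal)⁻¹ * (matrixSpace (Fin N) (Fin N)).norm N (amplify (LinearMap.proj i) N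
        (amplify V.subtype N (amplify f.toLinearMap N x))) := by
    intro i x
    have : amplify (w i) N x = (((a.toReal)⁻¹ : ℝ) : ℂ) • amplify (LinearMap.proj i) N
        (amplify V.subtype N (amplify f.toLinearMap N x)) := by
      ext; simp [amplify, hw]
    rw [this, (matrixSpace (Fin N) (Fin N)).smul_eq, Complex.norm_real,
      Real.norm_of_nonneg (by positivity)]
  refine ⟨w, fun i x => ?_, fun x hx => ?_⟩
  · rw [hamp, inv_mul_le_iff₀ ha0]
    exact (coordinate_le _ i).trans (hA x)
  · have h1 : 0 < (directSum k N).norm N (amplify V.subtype N (amplify f.toLinearMap N x)) := by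
      have h2 := hx.trans_le (hB x)
      exact pos_of_mul_pos_right h2 ENNReal.toReal_nonneg
    obtain ⟨i, hi⟩ := exists_coordinate_ge _ h1
    refine ⟨i, ?_⟩
    rw [hamp]
    set m := (matrixSpace (Fin N) (Fin N)).norm N (amplify (LinearMap.proj i) N
      (amplify V.subtype N (amplify f.toLinearMap N x))) with hm
    have hm0 : 0 < m := h1.trans_le hi
    have h3 : S.norm N x ≤ b.toReal * m :=
      (hB x).trans (mul_le_mul_of_nonneg_left hi ENNReal.toReal_nonneg)
    refine h3.trans_lt ?_
    rw [← mul_assoc]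
    refine mul_lt_mul_of_pos_right ?_ hm0
    rw [← div_eq_mul_inv, lt_div_iff₀ ha0, mul_comm]
    exact hab

/-- Each `u ∈ T` is almost normed by some coordinate, and by separation no coordinate serves two of
them, so `k` is at least the cardinality of `T`. -/
theorem le_multiplicity {S : OperatorSpace E} {e : Fin n → E} {β : ℝ} (hn : 5 ≤ n) (hN : 1 ≤ N)
    (hS : NormsUnitaries S e N β) :
    ENNReal.ofReal (Real.exp (1 / 500 * n * (N : ℝ) ^ 2)) ≤
      (multiplicity S N (1 + 1 / 10 ^ 27) : ENNReal) := by
  obtain ⟨T, hT, hsep, hcard⟩ := exists_separated_tuples n N hn hN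
  have hn0 : (0 : ℝ) < n := by exact_mod_cast (by omega : 0 < n)
  suffices h : (T.card : ℕ∞) ≤ multiplicity S N (1 + 1 / 10 ^ 27) by
    refine (ENNReal.ofReal_le_ofReal hcard).trans ?_
    rw [ENNReal.ofReal_natCast]
    exact_mod_cast h
  refine le_iInf₂ fun k hk => ?_
  obtain ⟨V, hV⟩ := hk
  -- The gap between `10⁻²⁷` and `10⁻²⁶` turns the distance bound into the strict one required by
  -- `exists_norming_maps`.
  have hV' : matrixDist S ((directSum k N).restrict V) N < ENNReal.ofReal (1 + 1 / 10 ^ 26) :=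
    hV.trans_lt ((ENNReal.ofReal_lt_ofReal_iff (by norm_num)).mpr (by norm_num))
  have hpos : ∀ u : Fin n → Matrix (Fin N) (Fin N) ℂ, (∀ j, (u j).conjTranspose * u j = 1) →
      0 < S.norm N (tupleElement e u) := fun u hu =>
    lt_of_lt_of_le (mul_pos (Real.sqrt_pos.mpr hn0) hS.pos) (hS.le_norm u hu)
  obtain ⟨w, hw, hw'⟩ := exists_norming_maps hV' ⟨_, hpos (fun _ => 1) (by simp)⟩
  set c : ℝ := √n / β with hc
  have hc0 : 0 < c := div_pos (Real.sqrt_pos.mpr hn0) hS.pos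
  have hcβ : c * β = √n := div_mul_cancel₀ _ hS.pos.ne'
  have hnn : √n * √n = n := Real.mul_self_sqrt hn0.le
  -- The scale `√n/β` turns the bound `β²` into `n`. By `1/(1 + t) ≥ 1 - t`, the constant `1 +
  -- 10⁻²⁶` then yields the threshold of `exists_separated_tuples`.
  let z : Fin k → Fin n → Matrix (Fin N) (Fin N) ℂ := fun i => (c : ℂ) • conjTuple e (w i)
  have hz : ∀ i, ‖tensorConj (z i) (z i)‖ ≤ n := by
    intro i
    have h1 := hS.norm_le (w i) (hw i)
    simp only [z]
    rw [tensorConj_smul_smul, norm_smul, Complex.norm_real, Real.norm_of_nonneg (by positivity)]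
    calc c * c * ‖tensorConj (conjTuple e (w i)) (conjTuple e (w i))‖ ≤ c * c * β ^ 2 := by gcongr
      _ = (c * β) * (c * β) := by ring
      _ = n := by rw [hcβ, hnn]
  have hTz : ∀ u ∈ T, ∃ i, (1 - 1 / 10 ^ 26) * n < ‖tensorConj u (z i)‖ := by
    intro u hu
    obtain ⟨i, hi⟩ := hw' _ (hpos u (hT u hu))
    refine ⟨i, ?_⟩
    rw [norm_amplify_tupleElement] at hi
    have h1 := (hS.le_norm u (hT u hu)).trans_lt hi
    have h2 := tensorConj_smul_smul 1 c u (conjTuple e (w i))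
    rw [Complex.ofReal_one, one_smul] at h2
    simp only [z]
    rw [h2, norm_smul, Complex.norm_real, one_mul, Real.norm_of_nonneg hc0.le]
    set m := ‖tensorConj u (conjTuple e (w i))‖ with hm
    have h3 : (n : ℝ) < (1 + 1 / 10 ^ 26) * (c * m) := by
      calc (n : ℝ) = c * (√n * β) := by rw [mul_left_comm, hcβ, hnn]
        _ < c * ((1 + 1 / 10 ^ 26) * m) := by gcongr
        _ = _ := by ring
    nlinarith
  have : Nonempty (Fin k) := (hw' _ (hpos (fun _ => 1) (by simp))).nonempty
  choose! i hi using hTz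
  by_contra! hlt
  have hlt' : k < T.card := by exact_mod_cast hlt
  obtain ⟨u, hu, v, hv, huv, hiuv⟩ := Finset.exists_ne_map_eq_of_card_lt_of_maps_to
    (s := T) (t := (Finset.univ : Finset (Fin k))) (f := i) (by simpa using hlt')
    (fun u _ => Finset.mem_univ _)
  have h1 := hsep u hu v hv huv (z (i u)) (hz _) (hi u hu)
  rw [hiuv] at h1
  exact absurd (hi v hv) (not_lt.mpr h1)

end Multiplicity

/-! ### The spaces `OH_n` and `max(ℓ₁^n)`. -/

section Spaces

variable {n N : ℕ}

/-- The identity matrix is an eigenvector of `ξ ↦ ∑ u_j ξ u_j^*` with eigenvalue `n`. -/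
theorem le_norm_tensorConj_of_unitary (hN : 1 ≤ N) {u : Fin n → Matrix (Fin N) (Fin N) ℂ}
    (hu : ∀ j, (u j).conjTranspose * u j = 1) : n ≤ ‖tensorConj u u‖ := by
  have hN0 : (0 : ℝ) < N := by exact_mod_cast hN
  have h := norm_hsInner_tensorAct_le u u (1 : Matrix (Fin N) (Fin N) ℂ) 1
  rw [hsInner_tensorAct, hsSq_one, Fintype.card_fin, mul_assoc, Real.mul_self_sqrt hN0.le] at h
  have h1 : ∀ j, hsInner (u j * 1 * (u j).conjTranspose) (1 : Matrix (Fin N) (Fin N) ℂ) = N := by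
    intro j
    rw [Matrix.mul_one, mul_eq_one_comm.mp (hu j), hsInner_self, hsSq_one]
    simp
  simp only [h1, Finset.sum_const, Finset.card_univ, Fintype.card_fin, nsmul_eq_mul, norm_mul,
    RCLike.norm_natCast] at h
  exact le_of_mul_le_mul_right h hN0

theorem conj_conj_tuple (u : Fin n → Matrix (Fin N) (Fin N) ℂ) (j : Fin n) :
    ((u j).map (starRingEnd ℂ)).map (starRingEnd ℂ) = u j := by
  ext; simp

theorem coeff_tupleElement (x : Fin n → Matrix (Fin N) (Fin N) ℂ) :
    coeff (tupleElement (fun j => EuclideanSpace.single j (1 : ℂ)) x) = x := by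
  ext j a b
  simp [coeff, tupleElement, Pi.single_apply]

/-- Self-duality of `OH_n`: testing `w` on its own tuple `z` gives `m ≤ √m` for `m = ‖∑ z_j ⊗
conj(z_j)‖`, hence `m ≤ 1`. -/
theorem normsUnitaries_operatorHilbert (n N : ℕ) (hN : 1 ≤ N) :
    NormsUnitaries (operatorHilbert n) (fun j => EuclideanSpace.single j (1 : ℂ)) N 1 where
  pos := one_pos
  le_norm u hu := by
    change _ ≤ √‖tensorConj (coeff (tupleElement _ u)) (coeff (tupleElement _ u))‖
    rw [coeff_tupleElement, mul_one]
    exact Real.sqrt_le_sqrt (le_norm_tensorConj_of_unitary hN hu)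
  norm_le w hw := by
    set z := conjTuple (fun j => EuclideanSpace.single j (1 : ℂ)) w with hz
    have h := hw (tupleElement (fun j => EuclideanSpace.single j (1 : ℂ)) z)
    rw [norm_amplify_tupleElement] at h
    change ‖tensorConj z z‖ ≤ √‖tensorConj (coeff (tupleElement _ z)) (coeff (tupleElement _ z))‖ at h
    rw [coeff_tupleElement] at h
    set m := ‖tensorConj z z‖ with hm
    have hm0 : 0 ≤ m := norm_nonneg _
    have h1 : m ^ 2 ≤ m := by
      have := pow_le_pow_left₀ hm0 h 2
      rwa [Real.sq_sqrt hm0] at this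
    nlinarith

/-- The canonical basis of `ℓ₁^n`. -/
def ellOneBasis (n : ℕ) (j : Fin n) : PiLp 1 fun _ : Fin n => ℂ := WithLp.toLp 1 (Pi.single j 1)

theorem le_maximalSpace {E : Type*} [NormedAddCommGroup E] [NormedSpace ℂ E] {k : ℕ}
    (w : E →ₗ[ℂ] Matrix (Fin k) (Fin k) ℂ) (hw : ∀ a, ‖w a‖ ≤ ‖a‖) (m : ℕ)
    (x : Matrix (Fin m) (Fin m) E) :
    (matrixSpace (Fin k) (Fin k)).norm m (amplify w m x) ≤ (maximalSpace E).norm m x := by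
  refine le_ciSup (f := fun i : (k : ℕ) ×
      {u : E →ₗ[ℂ] Matrix (Fin k) (Fin k) ℂ // ∀ e, ‖u e‖ ≤ ‖e‖} =>
        ((matrixSpace (Fin i.1) (Fin i.1)).toMatrixSeminorm.pullback i.2.1).norm m x)
    ⟨∑ i, ∑ j, ‖x i j‖, ?_⟩ ⟨k, w, hw⟩
  rintro _ ⟨⟨k, u, hu⟩, rfl⟩
  refine (MatrixSeminorm.norm_le_sum _ m _).trans
    (Finset.sum_le_sum fun i _ => Finset.sum_le_sum fun j _ => ?_)
  exact (matrixSpace_norm_one _).trans_le (hu (x i j))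

theorem maximalSpace_le {E : Type*} [NormedAddCommGroup E] [NormedSpace ℂ E] (m : ℕ)
    (x : Matrix (Fin m) (Fin m) E) {c : ℝ} (hc : 0 ≤ c)
    (h : ∀ (k : ℕ) (w : E →ₗ[ℂ] Matrix (Fin k) (Fin k) ℂ), (∀ a, ‖w a‖ ≤ ‖a‖) →
      (matrixSpace (Fin k) (Fin k)).norm m (amplify w m x) ≤ c) :
    (maximalSpace E).norm m x ≤ c :=
  Real.iSup_le (fun i : (k : ℕ) ×
      {u : E →ₗ[ℂ] Matrix (Fin k) (Fin k) ℂ // ∀ e, ‖u e‖ ≤ ‖e‖} => h i.1 i.2.1 i.2.2) hc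

/-- The linear map on `ℓ₁^n` that sends the basis vectors to `y_j`. -/
def ellOneMap (y : Fin n → Matrix (Fin N) (Fin N) ℂ) :
    (PiLp 1 fun _ : Fin n => ℂ) →ₗ[ℂ] Matrix (Fin N) (Fin N) ℂ where
  toFun a := ∑ j, a j • y j
  map_add' a b := by simp [add_smul, Finset.sum_add_distrib]
  map_smul' c a := by simp [mul_smul, Finset.smul_sum]

/-- The lower bound uses the contraction `e_j ↦ conj(u_j)`. For the upper bound, `w` is tested on
its own tuple `z`: Haagerup's inequality against an arbitrary contraction gives `m ≤ √m √n`. -/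
theorem normsUnitaries_maxEllOne (n N : ℕ) (hn : 1 ≤ n) (hN : 1 ≤ N) :
    NormsUnitaries (maxEllOne n) (ellOneBasis n) N √n where
  pos := Real.sqrt_pos.mpr (by exact_mod_cast hn)
  le_norm u hu := by
    rw [Real.mul_self_sqrt (Nat.cast_nonneg n)]
    set w := ellOneMap fun j => (u j).map (starRingEnd ℂ) with hw
    have hwu : conjTuple (ellOneBasis n) w = u := by
      funext j
      have : w (ellOneBasis n j) = (u j).map (starRingEnd ℂ) := by
        simp [hw, ellOneMap, ellOneBasis]
      rw [conjTuple, this, conj_conj_tuple]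
    have h := le_maximalSpace w (fun a => ?_) N (tupleElement (ellOneBasis n) u)
    · rw [norm_amplify_tupleElement, hwu] at h
      exact (le_norm_tensorConj_of_unitary hN hu).trans h
    · rw [PiLp.norm_eq_of_L1]
      change ‖∑ j, a j • (u j).map (starRingEnd ℂ)‖ ≤ _
      refine (norm_sum_le _ _).trans (Finset.sum_le_sum fun j _ => ?_)
      rw [norm_smul]
      exact mul_le_of_le_one_right (norm_nonneg _)
        ((norm_map_conj_le _).trans (norm_le_one_of_unitary (hu j)))
  norm_le w hw := by
    set z := conjTuple (ellOneBasis n) w with hz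
    have h := hw (tupleElement (ellOneBasis n) z)
    rw [norm_amplify_tupleElement, ← hz] at h
    set m := ‖tensorConj z z‖ with hm
    have hm0 : 0 ≤ m := norm_nonneg _
    have h2 : m ≤ √m * √n := by
      refine h.trans (maximalSpace_le N _ (by positivity) fun k v hv => ?_)
      rw [norm_amplify_tupleElement]
      refine (norm_tensorConj_le _ _).trans ?_
      gcongr
      refine norm_tensorConj_self_le fun j => ?_
      refine (norm_map_conj_le _).trans ((hv _).trans (le_of_eq ?_))
      simp [ellOneBasis]
    rw [Real.sq_sqrt (Nat.cast_nonneg n)]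
    have h3 : m ^ 2 ≤ m * n := by
      have := pow_le_pow_left₀ hm0 h2 2
      rwa [mul_pow, Real.sq_sqrt hm0, Real.sq_sqrt (Nat.cast_nonneg n)] at this
    rcases hm0.eq_or_lt with h0 | h0
    · rw [← h0]; positivity
    · rw [sq] at h3
      exact le_of_mul_le_mul_left h3 h0

end Spaces

/-! ### Complete contractions on `R_n + C_n`. -/

section RowPlusColumnSpace

variable {n N : ℕ}

/-- The pair `(w, w)` factors through addition, so it takes the same value on every lifting of `x`.
-/
theorem le_rowPlusColumn {k : ℕ} (w : (Fin n → ℂ) →ₗ[ℂ] Matrix (Fin k) (Fin k) ℂ)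
    (hr : IsCompleteContraction (rowSpace n) (matrixSpace (Fin k) (Fin k)) w)
    (hc : IsCompleteContraction (columnSpace n) (matrixSpace (Fin k) (Fin k)) w) (m : ℕ)
    (x : Matrix (Fin m) (Fin m) (Fin n → ℂ)) :
    (matrixSpace (Fin k) (Fin k)).norm m (amplify w m x) ≤ (rowPlusColumn n).norm m x := by
  have hne : Nonempty {z : Matrix (Fin m) (Fin m) ((Fin n → ℂ) × (Fin n → ℂ)) //
      amplify (LinearMap.id.coprod LinearMap.id) m z = x} :=
    ⟨x.map fun a => (a, 0), by ext; simp [amplify]⟩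
  refine le_ciInf fun z => ?_
  have hz : amplify w m x = amplify (w.coprod w) m z.1 := by
    conv_lhs => rw [← z.2]
    ext; simp [amplify]
  rw [hz]
  exact le_oneSum (rowSpace n) (columnSpace n) _ _ hr hc m z.1

theorem rowPlusColumn_le_oneSum (m : ℕ) (x : Matrix (Fin m) (Fin m) (Fin n → ℂ))
    (z : Matrix (Fin m) (Fin m) ((Fin n → ℂ) × (Fin n → ℂ)))
    (hz : amplify (LinearMap.id.coprod LinearMap.id) m z = x) :
    (rowPlusColumn n).norm m x ≤ (oneSum (rowSpace n) (columnSpace n)).norm m z :=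
  ciInf_le (f := fun z : {z : Matrix (Fin m) (Fin m) ((Fin n → ℂ) × (Fin n → ℂ)) //
      amplify (LinearMap.id.coprod LinearMap.id) m z = x} =>
      (oneSum (rowSpace n) (columnSpace n)).norm m z)
    ⟨0, by rintro _ ⟨z, rfl⟩; exact MatrixSeminorm.norm_nonneg _ _ _⟩ ⟨z, hz⟩

theorem rowPlusColumn_le_row (m : ℕ) (x : Matrix (Fin m) (Fin m) (Fin n → ℂ)) :
    (rowPlusColumn n).norm m x ≤ (rowSpace n).norm m x := by
  refine (rowPlusColumn_le_oneSum m x (x.map fun a => (a, 0)) (by ext; simp [amplify])).trans ?_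
  refine Real.iSup_le ?_ ((rowSpace n).norm_nonneg m x)
  rintro ⟨k, ⟨u, hu⟩, ⟨v, hv⟩⟩
  refine le_trans (le_of_eq ?_) (hu m x)
  change (matrixSpace (Fin k) (Fin k)).norm m (amplify (u.coprod v) m _) = _
  congr 1
  ext; simp [amplify]

theorem rowPlusColumn_le_column (m : ℕ) (x : Matrix (Fin m) (Fin m) (Fin n → ℂ)) :
    (rowPlusColumn n).norm m x ≤ (columnSpace n).norm m x := by
  refine (rowPlusColumn_le_oneSum m x (x.map fun a => (0, a)) (by ext; simp [amplify])).trans ?_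
  refine Real.iSup_le ?_ ((columnSpace n).norm_nonneg m x)
  rintro ⟨k, ⟨u, hu⟩, ⟨v, hv⟩⟩
  refine le_trans (le_of_eq ?_) (hv m x)
  change (matrixSpace (Fin k) (Fin k)).norm m (amplify (u.coprod v) m _) = _
  congr 1
  ext; simp [amplify]

/-- The matrix `(x_1, …, x_n)`, whose norm is the norm of `x` in `M_m(R_n)`. -/
def rowMatrix {m : ℕ} (x : Matrix (Fin m) (Fin m) (Fin n → ℂ)) :
    Matrix (Fin m × Unit) (Fin m × Fin n) ℂ :=
  Matrix.of fun a b => x a.1 b.1 b.2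

/-- The column with entries `x_1, …, x_n`, whose norm is the norm of `x` in `M_m(C_n)`. -/
def columnMatrix {m : ℕ} (x : Matrix (Fin m) (Fin m) (Fin n → ℂ)) :
    Matrix (Fin m × Fin n) (Fin m × Unit) ℂ :=
  Matrix.of fun a b => x a.1 b.1 a.2

theorem rowSpace_norm (m : ℕ) (x : Matrix (Fin m) (Fin m) (Fin n → ℂ)) :
    (rowSpace n).norm m x = ‖rowMatrix x‖ := rfl

theorem columnSpace_norm (m : ℕ) (x : Matrix (Fin m) (Fin m) (Fin n → ℂ)) :
    (columnSpace n).norm m x = ‖columnMatrix x‖ := rfl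

/-- The linear map on `ℂ^n` that sends the basis vectors to `y_j`. -/
def piMap (y : Fin n → Matrix (Fin N) (Fin N) ℂ) :
    (Fin n → ℂ) →ₗ[ℂ] Matrix (Fin N) (Fin N) ℂ where
  toFun a := ∑ j, a j • y j
  map_add' a b := by simp [add_smul, Finset.sum_add_distrib]
  map_smul' c a := by simp [mul_smul, Finset.smul_sum]

/-- The hypothesis says `‖y_j‖ ≤ n^{-1/2}`, so `∑ y_j^* y_j ≤ 1`. The operator `∑ x_j ⊗ y_j` is the
column of the `y_j` followed by the row of the `x_j`. -/
theorem piMap_completeContraction_row {y : Fin n → Matrix (Fin N) (Fin N) ℂ}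
    (hy : ∀ j v, n * ∑ t, ‖((y j).mulVec v) t‖ ^ 2 ≤ ∑ t, ‖v t‖ ^ 2) (hn : 1 ≤ n) :
    IsCompleteContraction (rowSpace n) (matrixSpace (Fin N) (Fin N)) (piMap y) := by
  intro m x
  rw [rowSpace_norm]
  refine opNorm_le_of_sq (norm_nonneg _) fun v => ?_
  have hn0 : (0 : ℝ) < n := by exact_mod_cast hn
  have h1 : ∀ a t, ((Matrix.comp (Fin m) (Fin m) (Fin N) (Fin N) ℂ
      (amplify (piMap y) m x)).mulVec v) (a, t) =
      ((rowMatrix x).mulVec fun c => ((y c.2).mulVec fun s => v (c.1, s)) t) (a, ()) := by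
    intro a t
    simp only [Matrix.mulVec, dotProduct, Fintype.sum_prod_type, Matrix.comp_apply, amplify, piMap,
      rowMatrix, Matrix.map_apply, LinearMap.coe_mk, AddHom.coe_mk, Matrix.sum_apply,
      Matrix.smul_apply, Matrix.of_apply, smul_eq_mul, Finset.sum_mul, Finset.mul_sum]
    refine Finset.sum_congr rfl fun b _ => ?_
    rw [Finset.sum_comm]
    exact Finset.sum_congr rfl fun j _ => Finset.sum_congr rfl fun s _ => by ring
  rw [Fintype.sum_prod_type_right]
  simp only [h1]
  have h2 : ∀ t : Fin N, ∑ a, ‖((rowMatrix x).mulVec fun c =>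
      ((y c.2).mulVec fun s => v (c.1, s)) t) (a, ())‖ ^ 2 ≤
      ‖rowMatrix x‖ ^ 2 * ∑ c : Fin m × Fin n, ‖((y c.2).mulVec fun s => v (c.1, s)) t‖ ^ 2 := by
    intro t
    refine le_trans (le_of_eq ?_) (sum_norm_mulVec_sq_le (rowMatrix x) _)
    rw [Fintype.sum_prod_type]
    simp
  refine (Finset.sum_le_sum fun t _ => h2 t).trans ?_
  rw [← Finset.mul_sum]
  gcongr
  rw [Finset.sum_comm, Fintype.sum_prod_type, Fintype.sum_prod_type]
  refine Finset.sum_le_sum fun b _ => ?_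
  have h3 := Finset.sum_le_card_nsmul Finset.univ
    (fun j : Fin n => ∑ t, ‖((y j).mulVec fun s => v (b, s)) t‖ ^ 2)
    ((n : ℝ)⁻¹ * ∑ s, ‖v (b, s)‖ ^ 2) (fun j _ => by
      rw [← div_eq_inv_mul, le_div_iff₀ hn0, mul_comm]
      exact hy j _)
  rw [Finset.card_univ, Fintype.card_fin, nsmul_eq_mul, ← mul_assoc, mul_inv_cancel₀ hn0.ne',
    one_mul] at h3
  exact h3

/-- Here the column of the `x_j` acts first and the row of the `y_j` second; Cauchy-Schwarz over `j`
costs the factor `n`. -/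
theorem piMap_completeContraction_column {y : Fin n → Matrix (Fin N) (Fin N) ℂ}
    (hy : ∀ j v, n * ∑ t, ‖((y j).mulVec v) t‖ ^ 2 ≤ ∑ t, ‖v t‖ ^ 2) :
    IsCompleteContraction (columnSpace n) (matrixSpace (Fin N) (Fin N)) (piMap y) := by
  intro m x
  rw [columnSpace_norm]
  refine opNorm_le_of_sq (norm_nonneg _) fun v => ?_
  have h1 : ∀ a t, ((Matrix.comp (Fin m) (Fin m) (Fin N) (Fin N) ℂ
      (amplify (piMap y) m x)).mulVec v) (a, t) =
      ∑ j, ((y j).mulVec fun s => ((columnMatrix x).mulVec fun b => v (b.1, s)) (a, j)) t := by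
    intro a t
    simp only [Matrix.mulVec, dotProduct, Fintype.sum_prod_type, Matrix.comp_apply, amplify, piMap,
      columnMatrix, Matrix.map_apply, LinearMap.coe_mk, AddHom.coe_mk, Matrix.sum_apply,
      Matrix.smul_apply, Matrix.of_apply, smul_eq_mul, Finset.sum_mul, Finset.mul_sum,
      Finset.univ_unique, Finset.sum_singleton]
    rw [Finset.sum_congr rfl fun b _ => Finset.sum_comm, Finset.sum_comm]
    refine Finset.sum_congr rfl fun j _ => ?_
    rw [Finset.sum_comm]
    exact Finset.sum_congr rfl fun j _ => Finset.sum_congr rfl fun s _ => by ring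
  rw [Fintype.sum_prod_type]
  simp only [h1]
  have h2 : ∀ a : Fin m, ∑ t, ‖∑ j, ((y j).mulVec fun s =>
      ((columnMatrix x).mulVec fun b => v (b.1, s)) (a, j)) t‖ ^ 2 ≤
      ∑ j, ∑ s, ‖((columnMatrix x).mulVec fun b => v (b.1, s)) (a, j)‖ ^ 2 := by
    intro a
    have h3 : ∀ t, ‖∑ j, ((y j).mulVec fun s =>
        ((columnMatrix x).mulVec fun b => v (b.1, s)) (a, j)) t‖ ^ 2 ≤
        n * ∑ j, ‖((y j).mulVec fun s =>
          ((columnMatrix x).mulVec fun b => v (b.1, s)) (a, j)) t‖ ^ 2 := by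
      intro t
      have h4 := sq_sum_le_card_mul_sum_sq (s := (Finset.univ : Finset (Fin n)))
        (f := fun j => ‖((y j).mulVec fun s =>
          ((columnMatrix x).mulVec fun b => v (b.1, s)) (a, j)) t‖)
      rw [Finset.card_univ, Fintype.card_fin] at h4
      exact (pow_le_pow_left₀ (norm_nonneg _) (norm_sum_le _ _) 2).trans h4
    refine (Finset.sum_le_sum fun t _ => h3 t).trans ?_
    rw [← Finset.mul_sum, Finset.sum_comm, Finset.mul_sum]
    exact Finset.sum_le_sum fun j _ => hy j _
  refine (Finset.sum_le_sum fun a _ => h2 a).trans ?_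
  have h5 : ∑ a, ∑ j, ∑ s, ‖((columnMatrix x).mulVec fun b => v (b.1, s)) (a, j)‖ ^ 2 =
      ∑ s, ∑ c : Fin m × Fin n, ‖((columnMatrix x).mulVec fun b => v (b.1, s)) c‖ ^ 2 := by
    simp only [Fintype.sum_prod_type]
    rw [Finset.sum_congr rfl fun a _ => Finset.sum_comm, Finset.sum_comm]
  rw [h5, Fintype.sum_prod_type_right, Finset.mul_sum]
  refine Finset.sum_le_sum fun s _ => ?_
  refine (sum_norm_mulVec_sq_le (columnMatrix x) _).trans (le_of_eq ?_)
  rw [Fintype.sum_prod_type]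
  simp

/-- There is a partial isometry `X` such that `X Y^*` is the absolute value of `Y^*` up to a
unitary. -/
theorem exists_contraction_hsSq_eq (Y : Matrix (Fin N) (Fin n) ℂ) :
    ∃ X : Matrix (Fin N) (Fin n) ℂ, ‖X‖ ≤ 1 ∧ hsSq (X * Y.conjTranspose) = hsSq Y := by
  have hH := Matrix.isHermitian_mul_conjTranspose_self Y
  have hpos : ∀ i, 0 ≤ hH.eigenvalues i := by
    open scoped ComplexOrder in
    exact (Matrix.posSemidef_self_mul_conjTranspose Y).eigenvalues_nonneg
  set d := hH.eigenvalues with hd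
  set V : Matrix (Fin N) (Fin N) ℂ := hH.eigenvectorUnitary.1 with hV
  have hVV : V.conjTranspose * V = 1 := Unitary.coe_star_mul_self hH.eigenvectorUnitary
  have hspec : Y * Y.conjTranspose =
      V * Matrix.diagonal (fun i => (d i : ℂ)) * V.conjTranspose := by
    have := hH.spectral_theorem
    rw [Unitary.conjStarAlgAut_apply] at this
    exact this
  -- Zero eigenvalues are inverted to `0`, which makes `D V^* Y` a partial isometry.
  set D := Matrix.diagonal (fun i => (((√(d i))⁻¹ : ℝ) : ℂ)) with hD
  have hDD : D.conjTranspose = D := conjTranspose_diagonal_ofReal _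
  have hmul : D * V.conjTranspose * (Y * Y.conjTranspose) =
      Matrix.diagonal (fun i => ((√(d i) : ℝ) : ℂ)) * V.conjTranspose := by
    rw [hspec]
    calc _ = D * (V.conjTranspose * V) * Matrix.diagonal (fun i => (d i : ℂ)) *
          V.conjTranspose := by simp only [Matrix.mul_assoc]
      _ = _ := by
        rw [hVV, Matrix.mul_one, hD, Matrix.diagonal_mul_diagonal]
        congr 2
        ext i
        rw [← Complex.ofReal_mul, inv_mul_eq_div, Real.div_sqrt]
  refine ⟨D * V.conjTranspose * Y, ?_, ?_⟩
  · have h1 : (D * V.conjTranspose * Y) * (D * V.conjTranspose * Y).conjTranspose =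
        Matrix.diagonal (fun i => ((√(d i) * (√(d i))⁻¹ : ℝ) : ℂ)) := by
      calc _ = (D * V.conjTranspose * (Y * Y.conjTranspose)) * (V * D) := by
            simp only [Matrix.conjTranspose_mul, Matrix.conjTranspose_conjTranspose, hDD,
              Matrix.mul_assoc]
        _ = Matrix.diagonal (fun i => ((√(d i) : ℝ) : ℂ)) * (V.conjTranspose * V) * D := by
            rw [hmul]; simp only [Matrix.mul_assoc]
        _ = _ := by
          rw [hVV, Matrix.mul_one, hD, Matrix.diagonal_mul_diagonal]
          congr 1
          ext i
          rw [Complex.ofReal_mul]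
    have h2 := Matrix.l2_opNorm_conjTranspose_mul_self (D * V.conjTranspose * Y).conjTranspose
    rw [Matrix.conjTranspose_conjTranspose, h1, Matrix.l2_opNorm_diagonal,
      Matrix.l2_opNorm_conjTranspose] at h2
    have h3 : ‖fun i => ((√(d i) * (√(d i))⁻¹ : ℝ) : ℂ)‖ ≤ 1 := by
      refine (pi_norm_le_iff_of_nonneg zero_le_one).mpr fun i => ?_
      rw [Complex.norm_real, Real.norm_of_nonneg (by positivity)]
      exact mul_inv_le_one
    nlinarith [norm_nonneg (D * V.conjTranspose * Y)]
  · rw [Matrix.mul_assoc, hmul, hsSq_mul_right (by simpa using hVV), hsSq_diagonal]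
    have h1 : ((hsSq Y : ℝ) : ℂ) = ((∑ i, d i : ℝ) : ℂ) := by
      rw [ofReal_hsSq, hspec, Matrix.trace_mul_comm, ← Matrix.mul_assoc, hVV, Matrix.one_mul,
        Matrix.trace_diagonal]
      push_cast
      rfl
    have h2 : hsSq Y = ∑ i, d i := by exact_mod_cast h1
    rw [h2]
    refine Finset.sum_congr rfl fun i _ => ?_
    rw [Complex.norm_real, Real.norm_eq_abs, sq_abs, Real.sq_sqrt (hpos i)]

end RowPlusColumnSpace

/-! ### Testing level-`N` contractions on rows and columns. -/

section RowColumnTests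

variable {n N : ℕ}

theorem piMap_single (w : (Fin n → ℂ) →ₗ[ℂ] Matrix (Fin N) (Fin N) ℂ) :
    piMap (fun j => w (Pi.single j 1)) = w := by
  refine LinearMap.pi_ext' fun j => LinearMap.ext_ring ?_
  change ∑ i, (Pi.single j (1 : ℂ) : Fin n → ℂ) i • w (Pi.single i 1) = w (Pi.single j 1)
  rw [Finset.sum_eq_single j (by intro i _ hi; simp [hi]) (by simp)]
  simp

theorem comp_amplify_piMap (y : Fin n → Matrix (Fin N) (Fin N) ℂ)
    (x : Matrix (Fin N) (Fin N) (Fin n → ℂ)) (a b t s : Fin N) :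
    Matrix.comp (Fin N) (Fin N) (Fin N) (Fin N) ℂ (amplify (piMap y) N x) (a, t) (b, s) =
      ∑ j, x a b j * y j t s := by
  simp [amplify, piMap, Matrix.sum_apply]

/-- Contractivity at level `N` alone gives `∑ y_j^* y_j ≤ 1`: the vectors `y_j h` span at most `N`
dimensions, so a contraction `X` with only `N` rows preserves their Hilbert-Schmidt norm. Placing
`X` in the block column `b₀` makes it a test element of `M_N(R_n)`. -/
theorem sum_mulVec_sq_le_of_row (hN : 1 ≤ N) {y : Fin n → Matrix (Fin N) (Fin N) ℂ}
    (hy : ∀ x, (matrixSpace (Fin N) (Fin N)).norm N (amplify (piMap y) N x) ≤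
      (rowSpace n).norm N x) (h : Fin N → ℂ) :
    ∑ j, ∑ t, ‖((y j).mulVec h) t‖ ^ 2 ≤ ∑ s, ‖h s‖ ^ 2 := by
  set b₀ : Fin N := ⟨0, hN⟩
  set Y : Matrix (Fin N) (Fin n) ℂ := Matrix.of fun t j => star ((y j).mulVec h t) with hY
  obtain ⟨X, hX, hXY⟩ := exists_contraction_hsSq_eq Y
  set x : Matrix (Fin N) (Fin N) (Fin n → ℂ) := Matrix.of fun a b j => if b = b₀ then X a j else 0
    with hx
  have hx1 : ‖rowMatrix x‖ ≤ 1 := by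
    refine opNorm_le_of_sq zero_le_one fun v => ?_
    have h1 : ∀ a, (rowMatrix x).mulVec v a = X.mulVec (fun j => v (b₀, j)) a.1 := by
      intro a
      simp only [Matrix.mulVec, dotProduct, Fintype.sum_prod_type, rowMatrix, hx, Matrix.of_apply]
      rw [Finset.sum_eq_single b₀ (by intro b _ hb; simp [hb]) (by simp)]
      simp
    simp only [h1, Fintype.sum_prod_type, Finset.univ_unique, Finset.sum_singleton]
    have h2 := sum_norm_mulVec_sq_le X (fun j => v (b₀, j))
    have h3 : ‖X‖ ^ 2 ≤ 1 ^ 2 := pow_le_pow_left₀ (norm_nonneg _) hX 2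
    refine h2.trans (mul_le_mul h3 ?_ (Finset.sum_nonneg fun _ _ => sq_nonneg _) (by norm_num))
    exact Finset.single_le_sum (f := fun b => ∑ j, ‖v (b, j)‖ ^ 2)
      (fun _ _ => Finset.sum_nonneg fun _ _ => sq_nonneg _) (Finset.mem_univ b₀)
  have h4 := (hy x).trans hx1
  set A := Matrix.comp (Fin N) (Fin N) (Fin N) (Fin N) ℂ (amplify (piMap y) N x) with hA
  change ‖A‖ ≤ 1 at h4
  have h5 := sum_norm_mulVec_sq_le A (fun c => if c.1 = b₀ then h c.2 else 0)
  have h6 : ∀ c, A.mulVec (fun c => if c.1 = b₀ then h c.2 else 0) c =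
      (X * Y.conjTranspose) c.1 c.2 := by
    rintro ⟨a, t⟩
    simp only [Matrix.mulVec, dotProduct, Fintype.sum_prod_type, hA, comp_amplify_piMap]
    rw [Finset.sum_eq_single b₀ (by intro b _ hb; simp [hb]) (by simp)]
    simp only [hx, hY, Matrix.of_apply, if_true, Matrix.mul_apply, Matrix.conjTranspose_apply,
      star_star, Matrix.mulVec, dotProduct, Finset.mul_sum, Finset.sum_mul]
    rw [Finset.sum_comm]
    exact Finset.sum_congr rfl fun j _ => Finset.sum_congr rfl fun s _ => by ring
  simp only [h6] at h5
  change hsSq (X * Y.conjTranspose) ≤ _ at h5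
  have h7 : ∑ c : Fin N × Fin N, ‖if c.1 = b₀ then h c.2 else 0‖ ^ 2 = ∑ s, ‖h s‖ ^ 2 := by
    rw [Fintype.sum_prod_type, Finset.sum_eq_single b₀ (by intro b _ hb; simp [hb]) (by simp)]
    simp
  rw [hXY, h7, hsSq_eq_sum, Finset.sum_comm] at h5
  simp only [hY, Matrix.of_apply, norm_star] at h5
  refine h5.trans (mul_le_of_le_one_left (Finset.sum_nonneg fun _ _ => sq_nonneg _) ?_)
  exact pow_le_one₀ (norm_nonneg _) h4

/-- The adjoint version of `sum_mulVec_sq_le_of_row`, giving `∑ y_j y_j^* ≤ 1`; the test element now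
occupies one block row. -/
theorem sum_conjTranspose_mulVec_sq_le_of_column (hN : 1 ≤ N)
    {y : Fin n → Matrix (Fin N) (Fin N) ℂ}
    (hy : ∀ x, (matrixSpace (Fin N) (Fin N)).norm N (amplify (piMap y) N x) ≤
      (columnSpace n).norm N x) (h : Fin N → ℂ) :
    ∑ j, ∑ t, ‖((y j).conjTranspose.mulVec h) t‖ ^ 2 ≤ ∑ s, ‖h s‖ ^ 2 := by
  set a₀ : Fin N := ⟨0, hN⟩
  set Y : Matrix (Fin N) (Fin n) ℂ :=
    Matrix.of fun t j => star ((y j).conjTranspose.mulVec h t) with hY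
  obtain ⟨X, hX, hXY⟩ := exists_contraction_hsSq_eq Y
  set x : Matrix (Fin N) (Fin N) (Fin n → ℂ) :=
    Matrix.of fun a b j => if a = a₀ then star (X b j) else 0 with hx
  have hx1 : ‖columnMatrix x‖ ≤ 1 := by
    refine opNorm_le_of_sq zero_le_one fun v => ?_
    have h1 : ∀ a j, (columnMatrix x).mulVec v (a, j) =
        if a = a₀ then X.conjTranspose.mulVec (fun b => v (b, ())) j else 0 := by
      intro a j
      by_cases ha : a = a₀ <;>
        simp [Matrix.mulVec, dotProduct, Fintype.sum_prod_type, columnMatrix, hx, ha]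
    rw [Fintype.sum_prod_type, Finset.sum_eq_single a₀ (by intro b _ hb; simp [h1, hb]) (by simp)]
    simp only [h1, if_true, Fintype.sum_prod_type, Finset.univ_unique, Finset.sum_singleton]
    have h2 := sum_norm_mulVec_sq_le X.conjTranspose (fun b => v (b, ()))
    have h3 : ‖X.conjTranspose‖ ^ 2 ≤ 1 ^ 2 := by
      rw [Matrix.l2_opNorm_conjTranspose]
      exact pow_le_pow_left₀ (norm_nonneg _) hX 2
    exact h2.trans (mul_le_mul_of_nonneg_right h3 (Finset.sum_nonneg fun _ _ => sq_nonneg _))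
  have h4 := (hy x).trans hx1
  set A := Matrix.comp (Fin N) (Fin N) (Fin N) (Fin N) ℂ (amplify (piMap y) N x) with hA
  change ‖A‖ ≤ 1 at h4
  rw [← Matrix.l2_opNorm_conjTranspose] at h4
  have h5 := sum_norm_mulVec_sq_le A.conjTranspose (fun c => if c.1 = a₀ then h c.2 else 0)
  have h6 : ∀ c, A.conjTranspose.mulVec (fun c => if c.1 = a₀ then h c.2 else 0) c =
      (X * Y.conjTranspose) c.1 c.2 := by
    rintro ⟨b, s⟩
    simp only [Matrix.mulVec, dotProduct, Fintype.sum_prod_type, Matrix.conjTranspose_apply, hA,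
      comp_amplify_piMap]
    rw [Finset.sum_eq_single a₀ (by intro b _ hb; simp [hb]) (by simp)]
    simp only [hx, hY, Matrix.of_apply, if_true, Matrix.mul_apply, Matrix.conjTranspose_apply,
      star_star, Matrix.mulVec, dotProduct, Finset.mul_sum, Finset.sum_mul, star_sum, star_mul']
    rw [Finset.sum_comm]
    exact Finset.sum_congr rfl fun j _ => Finset.sum_congr rfl fun s _ => by ring
  simp only [h6] at h5
  change hsSq (X * Y.conjTranspose) ≤ _ at h5
  have h7 : ∑ c : Fin N × Fin N, ‖if c.1 = a₀ then h c.2 else 0‖ ^ 2 = ∑ s, ‖h s‖ ^ 2 := by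
    rw [Fintype.sum_prod_type, Finset.sum_eq_single a₀ (by intro b _ hb; simp [hb]) (by simp)]
    simp
  rw [hXY, h7, hsSq_eq_sum, Finset.sum_comm] at h5
  simp only [hY, Matrix.of_apply, norm_star] at h5
  refine h5.trans (mul_le_of_le_one_left (Finset.sum_nonneg fun _ _ => sq_nonneg _) ?_)
  exact pow_le_one₀ (norm_nonneg _) h4

theorem sum_hsSq_mul_le {y : Fin n → Matrix (Fin N) (Fin N) ℂ}
    (hy : ∀ h : Fin N → ℂ, ∑ j, ∑ t, ‖((y j).mulVec h) t‖ ^ 2 ≤ ∑ s, ‖h s‖ ^ 2)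
    (A : Matrix (Fin N) (Fin N) ℂ) : ∑ j, hsSq (y j * A) ≤ hsSq A := by
  have h1 : ∀ B : Matrix (Fin N) (Fin N) ℂ, hsSq B = ∑ k, ∑ t, ‖B t k‖ ^ 2 := fun B => by
    rw [hsSq_eq_sum, Finset.sum_comm]
  simp only [h1]
  rw [Finset.sum_comm]
  exact Finset.sum_le_sum fun k _ => hy fun s => A s k

theorem sum_map_conj_mulVec_sq_le {y : Fin n → Matrix (Fin N) (Fin N) ℂ}
    (hy : ∀ h : Fin N → ℂ, ∑ j, ∑ t, ‖((y j).mulVec h) t‖ ^ 2 ≤ ∑ s, ‖h s‖ ^ 2)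
    (h : Fin N → ℂ) :
    ∑ j, ∑ t, ‖(((y j).map (starRingEnd ℂ)).mulVec h) t‖ ^ 2 ≤ ∑ s, ‖h s‖ ^ 2 := by
  have h1 : ∀ j t, (((y j).map (starRingEnd ℂ)).mulVec h) t =
      starRingEnd ℂ ((y j).mulVec (fun s => starRingEnd ℂ (h s)) t) := by
    intro j t
    simp [Matrix.mulVec, dotProduct]
  simpa [h1] using hy fun s => starRingEnd ℂ (h s)

/-- Cauchy-Schwarz for `⟨∑ z_j ξ z_j^*, η⟩ = ∑ ⟨ξ z_j^*, z_j^* η⟩`: the row bound controls the first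
factor and the column bound the second. -/
theorem norm_tensorConj_le_one {z : Fin n → Matrix (Fin N) (Fin N) ℂ}
    (hr : ∀ A, ∑ j, hsSq (z j * A) ≤ hsSq A)
    (hc : ∀ A, ∑ j, hsSq ((z j).conjTranspose * A) ≤ hsSq A) : ‖tensorConj z z‖ ≤ 1 := by
  by_contra! hlt
  obtain ⟨ξ, η, hξ, hη, h⟩ := exists_hsInner_tensorAct_gt zero_le_one hlt
  have h1 : hsInner (tensorAct z z ξ) η =
      ∑ j, hsInner (ξ * (z j).conjTranspose) ((z j).conjTranspose * η) := by
    rw [hsInner_tensorAct]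
    refine Finset.sum_congr rfl fun j _ => ?_
    rw [hsInner_eq_trace, hsInner_eq_trace, Matrix.conjTranspose_mul,
      Matrix.conjTranspose_conjTranspose, Matrix.mul_assoc, Matrix.mul_assoc, Matrix.trace_mul_comm]
    simp only [Matrix.mul_assoc]
  have h2 : ∑ j, hsSq (ξ * (z j).conjTranspose) ≤ 1 := by
    have := hr ξ.conjTranspose
    rw [hsSq_conjTranspose, hξ] at this
    refine le_trans (le_of_eq (Finset.sum_congr rfl fun j _ => ?_)) this
    rw [← hsSq_conjTranspose, Matrix.conjTranspose_mul, Matrix.conjTranspose_conjTranspose]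
  have h3 := sum_norm_hsInner_le (fun j => ξ * (z j).conjTranspose)
    (fun j => (z j).conjTranspose * η)
  rw [← h1] at h3
  have h4 : √(∑ j, hsSq (ξ * (z j).conjTranspose)) ≤ 1 := Real.sqrt_le_one.mpr h2
  have h5 : √(∑ j, hsSq ((z j).conjTranspose * η)) ≤ 1 := Real.sqrt_le_one.mpr ((hc η).trans hη.le)
  have h6 := mul_le_one₀ h4 (Real.sqrt_nonneg _) h5
  linarith [Complex.re_le_norm (hsInner (tensorAct z z ξ) η)]

/-- The lower bound comes from `e_j ↦ n^{-1/2} conj(u_j)`, completely contractive on both `R_n` and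
`C_n`. For the upper bound, `w` is contractive at level `N` on rows and on columns, and
`norm_tensorConj_le_one` applies. -/
theorem normsUnitaries_rowPlusColumn (n N : ℕ) (hn : 1 ≤ n) (hN : 1 ≤ N) :
    NormsUnitaries (rowPlusColumn n) (fun j => Pi.single j (1 : ℂ)) N 1 where
  pos := one_pos
  le_norm u hu := by
    have hn0 : (0 : ℝ) < n := by exact_mod_cast hn
    set y : Fin n → Matrix (Fin N) (Fin N) ℂ :=
      fun j => (((√n)⁻¹ : ℝ) : ℂ) • (u j).map (starRingEnd ℂ) with hy
    have hyv : ∀ j v, n * ∑ t, ‖((y j).mulVec v) t‖ ^ 2 ≤ ∑ t, ‖v t‖ ^ 2 := by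
      intro j v
      have h1 := sum_norm_mulVec_sq_le ((u j).map (starRingEnd ℂ)) v
      have h2 : ‖(u j).map (starRingEnd ℂ)‖ ^ 2 ≤ 1 := pow_le_one₀ (norm_nonneg _)
        ((norm_map_conj_le _).trans (norm_le_one_of_unitary (hu j)))
      have h3 : n * ∑ t, ‖((y j).mulVec v) t‖ ^ 2 =
          ∑ t, ‖(((u j).map (starRingEnd ℂ)).mulVec v) t‖ ^ 2 := by
        rw [Finset.mul_sum]
        refine Finset.sum_congr rfl fun t _ => ?_
        simp only [hy, Matrix.smul_mulVec, Pi.smul_apply, norm_smul, Complex.norm_real,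
          Real.norm_eq_abs, mul_pow, sq_abs, inv_pow, Real.sq_sqrt hn0.le]
        rw [mul_inv_cancel_left₀ hn0.ne']
      rw [h3]
      exact h1.trans (mul_le_of_le_one_left (Finset.sum_nonneg fun _ _ => sq_nonneg _) h2)
    have hconj : conjTuple (fun j => Pi.single j (1 : ℂ)) (piMap y) = (((√n)⁻¹ : ℝ) : ℂ) • u := by
      funext j
      have h1 : piMap y (Pi.single j 1) = y j := by simp [piMap]
      rw [conjTuple, h1]
      ext a b
      simp [hy]
    have h := le_rowPlusColumn (piMap y) (piMap_completeContraction_row hyv hn)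
      (piMap_completeContraction_column hyv) N (tupleElement (fun j => Pi.single j (1 : ℂ)) u)
    rw [norm_amplify_tupleElement, hconj] at h
    have h2 := tensorConj_smul_smul 1 (√n)⁻¹ u u
    rw [Complex.ofReal_one, one_smul, one_mul] at h2
    rw [h2, norm_smul, Complex.norm_real, Real.norm_of_nonneg (by positivity)] at h
    refine le_trans ?_ h
    rw [mul_one, ← div_eq_inv_mul, le_div_iff₀ (Real.sqrt_pos.mpr hn0),
      Real.mul_self_sqrt hn0.le]
    exact le_norm_tensorConj_of_unitary hN hu
  norm_le w hw := by
    set y : Fin n → Matrix (Fin N) (Fin N) ℂ := fun j => w (Pi.single j 1) with hy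
    have hwy : piMap y = w := piMap_single w
    have hr := sum_mulVec_sq_le_of_row hN (y := y) fun x => by
      rw [hwy]; exact (hw x).trans (rowPlusColumn_le_row N x)
    have hc := sum_conjTranspose_mulVec_sq_le_of_column hN (y := y) fun x => by
      rw [hwy]; exact (hw x).trans (rowPlusColumn_le_column N x)
    rw [one_pow]
    refine norm_tensorConj_le_one (sum_hsSq_mul_le (sum_map_conj_mulVec_sq_le hr))
      (sum_hsSq_mul_le (y := fun j => ((y j).map (starRingEnd ℂ)).conjTranspose) ?_)
    have h1 : ∀ j, ((y j).map (starRingEnd ℂ)).conjTranspose =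
        (y j).conjTranspose.map (starRingEnd ℂ) := fun j => by ext; simp
    simp only [h1]
    exact sum_map_conj_mulVec_sq_le hc

end RowColumnTests

end MatricialMultiplicity

end

theorem mainTheorem2 :
    ∃ (C₁ b : ℝ) (n₀ : ℕ), 1 < C₁ ∧ 0 < b ∧ 1 < n₀ ∧
      ∀ n N : ℕ, n₀ ≤ n → 1 ≤ N →
        ENNReal.ofReal (Real.exp (b * n * N ^ 2)) ≤
            (MatricialMultiplicity.multiplicity (MatricialMultiplicity.operatorHilbert n) N C₁ :
              ENNReal) ∧
        ENNReal.ofReal (Real.exp (b * n * N ^ 2)) ≤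
            (MatricialMultiplicity.multiplicity (MatricialMultiplicity.maxEllOne n) N C₁ :
              ENNReal) ∧
        ENNReal.ofReal (Real.exp (b * n * N ^ 2)) ≤
            (MatricialMultiplicity.multiplicity (MatricialMultiplicity.rowPlusColumn n) N C₁ :
              ENNReal) := by
  -- `1/500` is `1/50` from the packing times the tenth of the entries that are free.
  refine ⟨1 + 1 / 10 ^ 27, 1 / 500, 5, by norm_num, by norm_num, by norm_num, fun n N hn hN => ?_⟩
  have hn1 : 1 ≤ n := by omega
  exact ⟨MatricialMultiplicity.le_multiplicity hn hN
      (MatricialMultiplicity.normsUnitaries_operatorHilbert n N hN),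
    MatricialMultiplicity.le_multiplicity hn hN
      (MatricialMultiplicity.normsUnitaries_maxEllOne n N hn1 hN),
    MatricialMultiplicity.le_multiplicity hn hN
      (MatricialMultiplicity.normsUnitaries_rowPlusColumn n N hn1 hN)⟩
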